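/- Let $d\ge 3$ be an integer. For $j\ge 0$ let $\mathcal P_j(x)={}_2F_1\big(-j,\,j+d-3;\,\tfrac{d-2}{2};\,\tfrac{1-x}{2}\big)$ be the $d$-dimensional Gegenbauer polynomial. Let $A(s,u)$ be a function of two complex variables (the color-ordered four-point amplitude of massless scalars) with the following properties. 1. (Crossing) $A(s,u)=A(u,s)$. 2. (Weak-coupling analyticity) There are a cut-off $\Lambda\in(0,\infty]$ and a finite or infinite list of masses $0=m_0<m_1<\cdots<\Lambda$, with $m_n\to\Lambda$ if the list is infinite, such that for every fixed $u<0$ the function $s\mapsto A(s,u)$ is analytic on $\mathbb C$ except for simple poles at the points $s=m_n^2$ and arbitrary singularities on $[\Lambda^2,\infty)$. 3. (Finite spin exchange) For every level $n\ge1$ there are an integer $J_n\ge 0$ and real numbers $g_{n,j}^2$ with $g_{n,J_n}^2\ne0$ such that for all $u<0$ the residue of $A(s,u)$ at $s=m_n^2$ is $-m_n^{6-d}\sum_{j=0}^{J_n}g_{n,j}^2\,\mathcal P_j(1+2u/m_n^2)$. There are an integer $J_0\ge -1$ and real numbers $\lambda_j^2$, with $\lambda_{J_0}^2\neq0$ if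 $J_0\ge0$, such that the residue at $s=0$ is $-\sum_{j=0}^{J_0}\lambda_j^2u^j$ ($J_0=-1$ means that there is no massless pole). A state of spin $j$ is exchanged at level $n$ if $j\le J_n$ and $g_{n,j}^2\ne0$ (for $n=0$: $j\le J_0$ and $\lambda_j^2\neq0$). 4. (Low-energy expansion) With $A_{\rm massless}(s,u)=-\sum_{j=0}^{J_0}\lambda_j^2\big(\tfrac{u^j}{s}+\tfrac{s^j}{u}\big)$, one has $A(s,u)=A_{\rm massless}(s,u)+\sum_{k\ge0}\sum_{q=0}^{k}a_{k,q}s^{k-q}u^q$, an absolutely convergent double series for nonzero $|s|,|u|<m_1^2$ (for $|s|,|u|<\Lambda^2$ if there is no massive level). 5. (Polynomial boundedness) For an integer $\alpha$ and every fixed $u<0$, $A(s,u)/s^\alpha\to0$ as $|s|\to\infty$ away from the half-line $[0,\infty)$. Precisely: with $\theta(s)=\operatorname{dist}(s,[0,\infty))/|s|$, for every $u<0$ there is $M\in\mathbb N$ with $\theta(s)^M\,|A(s,u)|/|s|^{\alpha}\to0$ as $|s|\to\infty$, $s\notin[0,\infty)$. Moreover the bound is not lost in the forward limit $u\to0^-$: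 there are $M\in\mathbb N$, $\delta>0$ and $C,R$ such that $\theta(s)^M\,|A(s,u)-A_{\rm massless}(s,u)|\le C|s|^{\max(\alpha,\,J_0+1)}$ for all $u\in(-\delta,0)$ and all $s\notin[0,\infty)$ with $|s|\ge R$. 6. (Partial waves and positivity) There are spectral densities $\rho_j\ge0$ ($j=0,1,2,\dots$), i.e. measures, with $\sum_j\rho_j(K)<\infty$ for every compact $K\subset(0,\infty)$, such that for every fixed $u<0$ the boundary values $A(s\pm i0,u)$ exist as distributions in $s\in(-u,\infty)$ and $$\frac{A(s+i0,u)-A(s-i0,u)}{2i}=\pi\, s^{\frac{4-d}{2}}\sum_{j\ge0}\rho_j(s)\,\mathcal P_j\Big(1+\frac{2u}{s}\Big)$$ as distributions in $s\in(-u,\infty)$, the sum over $j$ converging absolutely on every test function. Then $$J_n\le\max(\alpha-1,J_0,J_1,\dots,J_{n-1})+1$$ for every level $n\ge1$ of the spectrum $\{m_n\}$. Moreover (an equivalent form), for every integer $j\ge\max(\alpha,J_0+1)$: if a state of spin $j+1$ occurs in the spectrum $\{m_n\}$, then a state of spin $j$ occurs too, and the lightest state of spin $j$ is strictly lighter than the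 lightest state of spin $j+1$. -/

import Mathlib

open Filter Topology MeasureTheory
open scoped ContDiff

/-- The `d`-dimensional spin-`j` Gegenbauer polynomial
`₂F₁(-j, j + d - 3; (d - 2) / 2; (1 - x) / 2)`, normalised to be `1` at `x = 1`. -/
noncomputable def gegenbauerP (d j : ℕ) (x : ℝ) : ℝ :=
  ordinaryHypergeometric (-(j : ℝ)) ((j : ℝ) + (d : ℝ) - 3) (((d : ℝ) - 2) / 2) ((1 - x) / 2)

/-- A color-ordered amplitude of four massless scalars, together with the data that enter the
bootstrap assumptions.  The relations between these data are stated in `SUAmplitude.Bootstrap`. -/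
structure SUAmplitude where
  /-- The amplitude `A(s, u)`. -/
  A : ℂ → ℂ → ℂ
  /-- The exponent of the polynomial Regge bound. -/
  α : ℤ
  /-- The cut-off (an energy), finite or infinite. -/
  Λ : ENNReal
  /-- The number of weakly-coupled mass levels (the massless level `0` included),
  finite or infinite. -/
  N : ℕ∞
  /-- The masses; `m n` is meaningful for `n < N`. -/
  m : ℕ → ℝ
  /-- The maximum spin at each mass level, with `J 0 = -1` if nothing massless is exchanged. -/
  J : ℕ → ℤ
  /-- The squared couplings `λ_j²` of the massless spin-`j` states. -/
  lamSq : ℕ → ℝ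
  /-- The squared couplings `g_{n,j}²` of the spin-`j` state of mass `m n > 0`. -/
  gSq : ℕ → ℕ → ℝ
  /-- The spectral densities `ρ_j(s) ds`. Non-negative distributions are measures. -/
  ρ : ℕ → Measure ℝ

namespace SUAmplitude

/-- `n` is (the index of) a mass level of the weakly-coupled spectrum. -/
def IsLevel (X : SUAmplitude) (n : ℕ) : Prop := (n : ℕ∞) < X.N

/-- The branch-cut region `[Λ², ∞)`, as a subset of the complex plane (empty if `Λ = ∞`). -/
def cut (X : SUAmplitude) : Set ℂ := {s | s.im = 0 ∧ X.Λ ^ 2 ≤ ENNReal.ofReal s.re}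

/-- The positions `s = m_n²` of the poles. -/
def poles (X : SUAmplitude) : Set ℂ := {s | ∃ n, X.IsLevel n ∧ s = ((X.m n ^ 2 : ℝ) : ℂ)}

/-- `|z|` lies below all the massive thresholds: `|z| < m_1²` (`|z| < Λ²` if there is no massive
level). -/
def IsLowEnergy (X : SUAmplitude) (z : ℂ) : Prop :=
  (∀ n, 1 ≤ n → X.IsLevel n → ‖z‖ < X.m n ^ 2) ∧ ENNReal.ofReal ‖z‖ < X.Λ ^ 2

/-- The contribution `-∑_{j ≤ J_0} λ_j² (u^j / s + s^j / u)` of the massless poles. -/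
noncomputable def massless (X : SUAmplitude) (s u : ℂ) : ℂ :=
  -∑ j ∈ Finset.range (X.J 0 + 1).toNat, (X.lamSq j : ℂ) * (u ^ j / s + s ^ j / u)

/-- A state of spin `j` is exchanged at the mass level `n`. -/
def Exchanges (X : SUAmplitude) (n j : ℕ) : Prop :=
  (j : ℤ) ≤ X.J n ∧ if n = 0 then X.lamSq j ≠ 0 else X.gSq n j ≠ 0

/-- The lightest state of spin `j` in the weakly-coupled spectrum sits at the mass level `n`. -/
def IsLightest (X : SUAmplitude) (n j : ℕ) : Prop :=
  X.IsLevel n ∧ X.Exchanges n j ∧ ∀ p < n, ¬ X.Exchanges p j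

/-- `max(α - 1, J_0, …, J_{n-1})`. -/
def maxBelow (X : SUAmplitude) : ℕ → ℤ
  | 0 => X.α - 1
  | n + 1 => max (X.maxBelow n) (X.J n)

/-- The half-line `[0, ∞)` in the complex plane, which contains all the non-analyticities in `s`
at fixed `u < 0`. -/
def posAxis : Set ℂ := {s | s.im = 0 ∧ 0 ≤ s.re}

/-- `dist(s, [0, ∞)) / |s|`: it is `1` for `Re s ≤ 0`, and it is bounded below on every closed
sector that avoids the half-line `[0, ∞)`. -/
noncomputable def angDist (s : ℂ) : ℝ := Metric.infDist s posAxis / ‖s‖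

/-- `φ` is a test function on the half-line `(-u, ∞)` of physical values of `s`. -/
structure IsTest (u : ℝ) (φ : ℝ → ℝ) : Prop where
  smooth : ContDiff ℝ ∞ φ
  compact : HasCompactSupport φ
  supp : tsupport φ ⊆ Set.Ioi (-u)

/-- The boundary value `A(s + i0, u)` (for `σ = 1`) or `A(s - i0, u)` (for `σ = -1`), paired with
the test function `φ`, exists and equals `L`. -/
def HasBoundaryValue (X : SUAmplitude) (σ u : ℝ) (φ : ℝ → ℝ) (L : ℂ) : Prop :=
  Tendsto (fun ε : ℝ => ∫ x : ℝ, (φ x : ℂ) * X.A ((x : ℂ) + ((σ * ε : ℝ) : ℂ) * Complex.I) (u : ℂ))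
    (𝓝[>] 0) (𝓝 L)

/-- The bootstrap assumptions for an `su`-symmetric amplitude in `d` spacetime dimensions. -/
structure Bootstrap (X : SUAmplitude) (d : ℕ) : Prop where
  /-- Masses `0 = m_0 < m_1 < ⋯ < Λ`, accumulating (if they are infinitely many) only at `Λ`. -/
  levels_pos : 1 ≤ X.N
  mass_zero : X.m 0 = 0
  mass_lt : ∀ n p, n < p → X.IsLevel p → X.m n < X.m p
  mass_lt_cutoff : ∀ n, X.IsLevel n → ENNReal.ofReal (X.m n) < X.Λ
  mass_tendsto : X.N = ⊤ → Tendsto (fun n => ENNReal.ofReal (X.m n)) atTop (𝓝 X.Λ)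
  /-- Crossing symmetry. -/
  crossing : ∀ s u : ℂ, X.A s u = X.A u s
  /-- Weak-coupling analyticity in `s` at fixed `u < 0`; that the singularities at `s = m_n²` are
  simple poles is part of `residue_massless` and `residue_massive`. -/
  analytic : ∀ u : ℝ, u < 0 → DifferentiableOn ℂ (fun s => X.A s (u : ℂ)) (X.poles ∪ X.cut)ᶜ
  /-- Finite spin exchange: maximum spins, and polynomial residues at `s = m_n²`, decomposed in
  spin, in which the maximum spin does occur. -/
  spin_massless : -1 ≤ X.J 0
  spin_massive : ∀ n, 1 ≤ n → X.IsLevel n → 0 ≤ X.J n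
  top_massless : 0 ≤ X.J 0 → X.lamSq (X.J 0).toNat ≠ 0
  top_massive : ∀ n, 1 ≤ n → X.IsLevel n → X.gSq n (X.J n).toNat ≠ 0
  residue_massless : ∀ u : ℝ, u < 0 →
    Tendsto (fun s : ℂ => s * X.A s (u : ℂ)) (𝓝[≠] 0)
      (𝓝 ((-∑ j ∈ Finset.range (X.J 0 + 1).toNat, X.lamSq j * u ^ j : ℝ) : ℂ))
  residue_massive : ∀ n, 1 ≤ n → X.IsLevel n → ∀ u : ℝ, u < 0 →
    Tendsto (fun s : ℂ => (s - ((X.m n ^ 2 : ℝ) : ℂ)) * X.A s (u : ℂ))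
      (𝓝[≠] ((X.m n ^ 2 : ℝ) : ℂ))
      (𝓝 ((-(X.m n ^ (6 - (d : ℤ)) * ∑ j ∈ Finset.range (X.J n + 1).toNat,
        X.gSq n j * gegenbauerP d j (1 + 2 * u / X.m n ^ 2)) : ℝ) : ℂ))
  /-- Low-energy expansion `A = A_massless + ∑_k ∑_{q ≤ k} a_{k,q} s^{k-q} u^q`
  for `|s|, |u| < m_1²`, summed over `(k - q, q)`. -/
  low_energy : ∃ a : ℕ → ℕ → ℂ, ∀ s u : ℂ, s ≠ 0 → u ≠ 0 → X.IsLowEnergy s → X.IsLowEnergy u →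
    HasSum (fun pq : ℕ × ℕ => a (pq.1 + pq.2) pq.2 * s ^ pq.1 * u ^ pq.2)
      (X.A s u - X.massless s u)
  /-- Polynomial boundedness: `A(s, u) / s^α → 0` as `|s| → ∞` at fixed `u < 0`, away from the
  half-line `[0, ∞)`; the power of `angDist` allows for poles, and for cuts with distributional
  boundary values, on that half-line. -/
  regge : ∀ u : ℝ, u < 0 → ∃ M : ℕ,
    Tendsto (fun s : ℂ => angDist s ^ M * (‖X.A s (u : ℂ)‖ / ‖s‖ ^ X.α))
      (Bornology.cobounded ℂ ⊓ 𝓟 posAxisᶜ) (𝓝 0)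
  /-- The polynomial bound is not lost in the forward limit `u → 0⁻`: without its massless poles,
  the amplitude is `O(s^max(α, J_0 + 1))`, uniformly for small `u < 0`. -/
  regge_forward : ∃ (M : ℕ) (δ C R : ℝ), 0 < δ ∧ ∀ u : ℝ, -δ < u → u < 0 →
    ∀ s : ℂ, s ∉ posAxis → R ≤ ‖s‖ →
      angDist s ^ M * ‖X.A s (u : ℂ) - X.massless s (u : ℂ)‖ ≤ C * ‖s‖ ^ max X.α (X.J 0 + 1)
  /-- The absorptive partial wave sum converges locally in `s > 0`, up to the forward direction,
  where every Gegenbauer polynomial takes its maximum `1`. -/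
  density_finite : ∀ K : Set ℝ, IsCompact K → K ⊆ Set.Ioi 0 → ∑' j, X.ρ j K ≠ ⊤
  /-- Partial wave decomposition and positivity: for physical `s > -u > 0` the amplitude has
  distributional boundary values on the two sides of the real axis, and its discontinuity is
  `Im A(s, u) = π s^((4-d)/2) ∑_j ρ_j(s) P_j(1 + 2u/s)` with non-negative `ρ_j`. -/
  partial_waves : ∀ u : ℝ, u < 0 → ∀ φ : ℝ → ℝ, IsTest u φ →
    ∃ Lp Lm : ℂ, X.HasBoundaryValue 1 u φ Lp ∧ X.HasBoundaryValue (-1) u φ Lm ∧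
      HasSum (fun j : ℕ => ((Real.pi * ∫ x : ℝ, φ x * x ^ ((4 - (d : ℝ)) / 2) *
        gegenbauerP d j (1 + 2 * u / x) ∂(X.ρ j) : ℝ) : ℂ)) ((Lp - Lm) / (2 * Complex.I))

end SUAmplitude

/-!
At fixed small `u < 0` the amplitude without its massless poles, `B = A - A_massless`, is analytic
in `s` off `[m_1², ∞)`, and Regge boundedness allows an unsubtracted dispersion relation for its
`p`-th Taylor coefficient in `s` as soon as `p ≥ β = max(α, J_0 + 1)`. Inserting the partial waves
and expanding in `u` at the forward limit expresses the coefficient `r(p, q)` of `s ^ p u ^ q` as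

  `r(p, q) = ∑_j ∫ x ^ ((4 - d) / 2) x ^ (-(p + 1 + q)) v_{j,q} dρ_j(x)`,

where `P_j(1 + 2 y) = ∑_q v_{j,q} y ^ q` has `v_{j,q} > 0` for `q ≤ j` and `v_{j,q} = 0` for `q > j`
(`Bootstrap.exists_moments`). Crossing makes `r` symmetric.

Suppose that a level at `y = m_P²` has a spin `> j ≥ β`, while no lower level has a spin `≥ j`. Only
spins `≥ i` contribute to `r(n, i)`, so `r(n, i) = O(y ^ (-n))` for `i ≥ j`, and
`r(n, j + 1) ≥ c y ^ (-n)`. By symmetry `q ↦ r(n, q) = r(q, n)` is also a moment sequence of a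
positive measure, hence log-convex: `r(n, q + 1)² ≤ r(n, q) r(n, q + 2)`. So the growth rate
propagates upwards: `r(n, i) ≥ c_i y ^ (-n)` for all `i > j`. But spins above `J_P` only occur
strictly above `y`, so `r(n, J_P + 1) = o(y ^ (-n))`, a contradiction
(`false_of_symmetric_moments`). Both forms of the theorem follow from this by combinatorics.

The analytic inputs are the following.

* Each Gegenbauer polynomial and its `y`-derivatives take their maximal modulus over `[-1/2, 0]` at
  `y = 0` (Sonine's monotone function, `abs_gegPoly_eval_le`). By Fatou's lemma and dominated
  convergence, the Taylor expansion in `u` may then be taken under the integral sign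
  (`integral_coeff_of_hasSum`).
* Distributional boundary values may be multiplied by `s ^ (-p)`, by the uniform boundedness
  principle (`tendsto_integral_mul_div_pow`).
* The dispersion relation is obtained from pairings of `B` with the almost analytic extension of a
  smooth cut-off; their variation with the height above the real axis is bounded by the Regge
  behaviour of `B` (`cutoffPairing`, `exists_norm_discontinuity_sub_coeff_le`), so that
  no pointwise boundary values and no contours are needed.
* Comparing the discontinuity near a point of `(0, Λ²)` with the residue there shows that the
  spectral measure lives on the poles below the cut-off, and that `J_n` is the maximum spin in it
  at `m_n²` (`Bootstrap.null_below_cutoff`, `Bootstrap.ae_spin_le`,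
  `Bootstrap.spectralMeasure_top_ne_zero`).
-/

/-! ### Gegenbauer polynomials near the forward direction -/

/-- The coefficient of `y ^ n` in the Gegenbauer polynomial `P_j(1 + 2 y)` in `d = 2 c + 2`
dimensions. It vanishes for `n > j` because of the factor `j - i` with `i = j`. -/
noncomputable def gegCoeff (c : ℝ) (j n : ℕ) : ℝ :=
  ∏ i ∈ Finset.range n, ((j : ℝ) - i) * ((j : ℝ) + 2 * c - 1 + i) / ((i + 1) * (c + i))

/-- The Gegenbauer polynomial `P_j(1 + 2 y)` in `d = 2 c + 2` dimensions, as a polynomial in `y`. -/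
noncomputable def gegPoly (c : ℝ) (j : ℕ) : Polynomial ℝ :=
  ∑ n ∈ Finset.range (j + 1), Polynomial.monomial n (gegCoeff c j n)

theorem gegCoeff_zero (c : ℝ) (j : ℕ) : gegCoeff c j 0 = 1 := by simp [gegCoeff]

theorem gegCoeff_succ (c : ℝ) (j n : ℕ) : gegCoeff c j (n + 1) =
    gegCoeff c j n * (((j : ℝ) - n) * ((j : ℝ) + 2 * c - 1 + n) / ((n + 1) * (c + n))) := by
  rw [gegCoeff, Finset.prod_range_succ]; rfl

theorem gegCoeff_eq_zero (c : ℝ) {j n : ℕ} (h : j < n) : gegCoeff c j n = 0 := by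
  rw [gegCoeff]
  exact Finset.prod_eq_zero (Finset.mem_range.2 h) (by simp)

theorem gegCoeff_pos {c : ℝ} (hc : 1 / 2 ≤ c) {j n : ℕ} (h : n ≤ j) : 0 < gegCoeff c j n := by
  rw [gegCoeff]
  refine Finset.prod_pos fun i hi => ?_
  have hi' : i < j := (Finset.mem_range.1 hi).trans_le h
  have h1 : (i : ℝ) < j := by exact_mod_cast hi'
  have h0 : (0 : ℝ) ≤ i := by positivity
  apply div_pos
  · exact mul_pos (by linarith) (by linarith)
  · exact mul_pos (by linarith) (by linarith)

theorem gegCoeff_nonneg {c : ℝ} (hc : 1 / 2 ≤ c) (j n : ℕ) : 0 ≤ gegCoeff c j n := by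
  rcases le_or_gt n j with h | h
  · exact (gegCoeff_pos hc h).le
  · exact (gegCoeff_eq_zero c h).ge

theorem coeff_gegPoly (c : ℝ) (j n : ℕ) : (gegPoly c j).coeff n = gegCoeff c j n := by
  simp only [gegPoly, Polynomial.finsetSum_coeff, Polynomial.coeff_monomial]
  rw [Finset.sum_ite_eq' (Finset.range (j + 1)) n (fun i => gegCoeff c j i)]
  split_ifs with h
  · rfl
  · rw [Finset.mem_range, not_lt] at h
    exact (gegCoeff_eq_zero c (by omega)).symm

theorem gegPoly_eval_zero (c : ℝ) (j : ℕ) : (gegPoly c j).eval 0 = 1 := by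
  rw [← Polynomial.coeff_zero_eq_eval_zero, coeff_gegPoly, gegCoeff_zero]

theorem gegPoly_zero (c : ℝ) : gegPoly c 0 = 1 := by
  simp [gegPoly, gegCoeff_zero]

/-- The hypergeometric normalisation of the Gegenbauer polynomial as a polynomial in
`y = (x - 1) / 2`. -/
theorem gegenbauerP_eq_eval (d j : ℕ) (x : ℝ) :
    gegenbauerP d j x = (gegPoly (((d : ℝ) - 2) / 2) j).eval ((x - 1) / 2) := by
  set c : ℝ := ((d : ℝ) - 2) / 2 with hc
  have hb : (j : ℝ) + (d : ℝ) - 3 = (j : ℝ) + 2 * c - 1 := by rw [hc]; ring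
  have key : ∀ n : ℕ, ordinaryHypergeometricCoefficient (-(j : ℝ)) ((j : ℝ) + 2 * c - 1) c n
      = (-1) ^ n * gegCoeff c j n := by
    intro n
    induction n with
    | zero => simp [gegCoeff_zero, ordinaryHypergeometricCoefficient]
    | succ n ih =>
      have e : ordinaryHypergeometricCoefficient (-(j : ℝ)) ((j : ℝ) + 2 * c - 1) c (n + 1) =
          ordinaryHypergeometricCoefficient (-(j : ℝ)) ((j : ℝ) + 2 * c - 1) c n *
          ((-(j : ℝ) + n) * ((j : ℝ) + 2 * c - 1 + n) / ((n + 1) * (c + n))) := by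
        simp only [ordinaryHypergeometricCoefficient, ascPochhammer_succ_eval, Nat.factorial_succ,
          Nat.cast_mul, Nat.cast_add, Nat.cast_one, mul_inv, div_eq_mul_inv]
        ring
      rw [e, ih, gegCoeff_succ]
      ring
  rw [gegenbauerP, ordinaryHypergeometric_eq_tsum, hb]
  change ∑' n : ℕ, ordinaryHypergeometricCoefficient (-(j : ℝ)) ((j : ℝ) + 2 * c - 1) c n •
    ((1 - x) / 2) ^ n = _
  have e2 : ∀ n : ℕ, ordinaryHypergeometricCoefficient (-(j : ℝ)) ((j : ℝ) + 2 * c - 1) c n •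
      ((1 - x) / 2) ^ n = gegCoeff c j n * ((x - 1) / 2) ^ n := by
    intro n
    rw [key, smul_eq_mul, mul_comm _ (gegCoeff c j n), mul_assoc, ← mul_pow]
    congr 2; ring
  simp only [e2]
  rw [tsum_eq_sum (s := Finset.range (j + 1))]
  · simp [gegPoly, Polynomial.eval_finsetSum]
  · intro n hn
    rw [Finset.mem_range, not_lt] at hn
    rw [gegCoeff_eq_zero c (by omega), zero_mul]

/-- The derivative of a Gegenbauer polynomial is a multiple of the one of lower spin in two more
dimensions. -/
theorem derivative_gegPoly_succ {c : ℝ} (hc : 0 < c) (j : ℕ) :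
    (gegPoly c (j + 1)).derivative =
      Polynomial.C (((j : ℝ) + 1) * (j + 2 * c) / c) * gegPoly (c + 1) j := by
  ext n
  rw [Polynomial.coeff_derivative, Polynomial.coeff_C_mul, coeff_gegPoly, coeff_gegPoly]
  induction n with
  | zero => simp [gegCoeff_succ, gegCoeff_zero]; ring
  | succ n ih =>
    have h1 : (n : ℝ) + 1 ≠ 0 := by positivity
    have h2 : (n : ℝ) + 1 + 1 ≠ 0 := by positivity
    have h3 : c + (n + 1) ≠ 0 := by positivity
    have h4 : c + 1 + n ≠ 0 := by positivity
    rw [gegCoeff_succ, gegCoeff_succ (c + 1)]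
    rw [← mul_assoc (((j : ℝ) + 1) * (j + 2 * c) / c), ← ih]
    push_cast
    have h5 : c + 1 + (n : ℝ) = c + (n + 1) := by ring
    rw [h5]
    field_simp
    ring

/-- The Gegenbauer differential equation in the variable `y`. -/
theorem gegPoly_ode {c : ℝ} (hc : 0 < c) (j : ℕ) (y : ℝ) :
    y * (1 + y) * (gegPoly c j).derivative.derivative.eval y
      + c * (1 + 2 * y) * (gegPoly c j).derivative.eval y
      = j * (j + 2 * c - 1) * (gegPoly c j).eval y := by
  have key : (Polynomial.X + Polynomial.X ^ 2) * (gegPoly c j).derivative.derivative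
      + Polynomial.C c * ((1 + Polynomial.C 2 * Polynomial.X) * (gegPoly c j).derivative)
      = Polynomial.C ((j : ℝ) * (j + 2 * c - 1)) * gegPoly c j := by
    have rec0 : ∀ n : ℕ, gegCoeff c j (n + 1) * ((n + 1) * (c + n)) =
        gegCoeff c j n * (((j : ℝ) - n) * ((j : ℝ) + 2 * c - 1 + n)) := by
      intro n
      have h1 : (n : ℝ) + 1 ≠ 0 := by positivity
      have h3 : c + n ≠ 0 := by positivity
      rw [gegCoeff_succ]
      field_simp
    ext n
    rw [add_mul, add_mul, one_mul, mul_assoc, pow_two, mul_assoc]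
    simp only [Polynomial.coeff_add, Polynomial.coeff_C_mul]
    match n with
    | 0 =>
      have := rec0 0
      simp [Polynomial.coeff_derivative, coeff_gegPoly] at this ⊢
      linarith
    | 1 =>
      have := rec0 1
      simp [Polynomial.coeff_X_mul, Polynomial.coeff_derivative, coeff_gegPoly] at this ⊢
      linarith
    | n + 2 =>
      have := rec0 (n + 2)
      simp [Polynomial.coeff_X_mul, Polynomial.coeff_derivative, coeff_gegPoly] at this ⊢
      linear_combination this
  have := congrArg (Polynomial.eval y) key
  simp only [Polynomial.eval_add, Polynomial.eval_mul, Polynomial.eval_X, Polynomial.eval_pow,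
    Polynomial.eval_C, Polynomial.eval_one] at this
  linear_combination this

/-- `|P_j| ≤ 1` on `[0, 1]`. The Sonine function `Q² - y (1 + y) Q'² / N`, with
`N = j (j + 2 c - 1)`, is increasing there and equals `1` at `y = 0`. -/
theorem abs_gegPoly_eval_le {c : ℝ} (hc : 1 / 2 ≤ c) (j : ℕ) {y : ℝ} (hy : -(1 / 2) ≤ y)
    (hy0 : y ≤ 0) : |(gegPoly c j).eval y| ≤ 1 := by
  rcases Nat.eq_zero_or_pos j with rfl | hj
  · simp [gegPoly_zero]
  have hj' : (1 : ℝ) ≤ j := by exact_mod_cast hj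
  have hN : 0 < (j : ℝ) * (j + 2 * c - 1) := mul_pos (by linarith) (by linarith)
  set N : ℝ := (j : ℝ) * (j + 2 * c - 1) with hNdef
  set Q := gegPoly c j with hQ
  let F : ℝ → ℝ := fun y => (Q.eval y) ^ 2 - y * (1 + y) * (Q.derivative.eval y) ^ 2 / N
  -- by the differential equation; the sign is where `c ≥ 1 / 2`, that is `d ≥ 3`, enters
  have hF : ∀ y, HasDerivAt F ((2 * c - 1) * (1 + 2 * y) * (Q.derivative.eval y) ^ 2 / N) y := by
    intro y
    have h1 := Q.hasDerivAt y
    have h2 := Q.derivative.hasDerivAt y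
    have h3 : HasDerivAt (fun y : ℝ => y * (1 + y)) (1 * (1 + y) + y * 1) y :=
      (hasDerivAt_id y).mul ((hasDerivAt_id y).const_add 1)
    have h := (h1.pow 2).sub ((h3.mul (h2.pow 2)).div_const N)
    refine h.congr_deriv ?_
    have ode := gegPoly_ode (c := c) (by linarith) j y
    rw [← hQ, ← hNdef] at ode
    field_simp
    simp only [Pi.pow_apply]
    push_cast
    linear_combination (-2 * Q.derivative.eval y) * ode
  have hmono : MonotoneOn F (Set.Icc (-(1 / 2)) 0) := by
    apply monotoneOn_of_deriv_nonneg (convex_Icc _ _)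
    · exact fun y _ => (hF y).continuousAt.continuousWithinAt
    · exact fun y _ => (hF y).differentiableAt.differentiableWithinAt
    · intro y hy
      rw [interior_Icc] at hy
      rw [(hF y).deriv]
      have : 0 ≤ 1 + 2 * y := by linarith [hy.1]
      have : 0 ≤ 2 * c - 1 := by linarith
      positivity
  have h0 := hmono ⟨hy, hy0⟩ ⟨by norm_num, le_refl (0 : ℝ)⟩ hy0
  simp only [F, hQ, gegPoly_eval_zero] at h0
  rw [← hQ] at h0
  have h1 : 0 ≤ -(y * (1 + y)) * (Q.derivative.eval y) ^ 2 / N := by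
    have : 0 ≤ -(y * (1 + y)) := by nlinarith
    positivity
  rw [← sq_le_one_iff_abs_le_one]
  have h2 : -(y * (1 + y)) * (Q.derivative.eval y) ^ 2 / N
    = -(y * (1 + y) * (Q.derivative.eval y) ^ 2 / N) := by ring
  rw [h2] at h1
  simp at h0
  linarith

/-- Every derivative of a Gegenbauer polynomial is maximal in the forward direction. -/
theorem abs_iterate_derivative_gegPoly_le (q : ℕ) : ∀ {c : ℝ}, 1 / 2 ≤ c → ∀ (j : ℕ) {y : ℝ},
    -(1 / 2) ≤ y → y ≤ 0 → |(Polynomial.derivative^[q] (gegPoly c j)).eval y| ≤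
      (Polynomial.derivative^[q] (gegPoly c j)).eval 0 := by
  induction q with
  | zero =>
    intro c hc j y h1 h2
    simpa [gegPoly_eval_zero] using abs_gegPoly_eval_le hc j h1 h2
  | succ q ih =>
    intro c hc j y h1 h2
    rw [Function.iterate_succ_apply]
    rcases j with _ | j
    · simp [gegPoly_zero]
    -- the derivative is a multiple of the Gegenbauer polynomial in `d + 2` dimensions
    · rw [derivative_gegPoly_succ (by linarith), Polynomial.iterate_derivative_C_mul,
        Polynomial.eval_mul, Polynomial.eval_mul, Polynomial.eval_C, Polynomial.eval_C, abs_mul,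
        abs_of_nonneg (a := ((j : ℝ) + 1) * (j + 2 * c) / c)]
      · exact mul_le_mul_of_nonneg_left (ih (by linarith) j h1 h2) (by positivity)
      · positivity

/-! ### Taylor coefficients of positive superpositions of polynomials -/

/-- One differentiation under the integral sign at the endpoint `0`: for polynomials `p_w` that
are, with their derivatives, maximal at `0`, the one-sided difference quotients at `0` are
non-negative, and Fatou's lemma makes `p_w'(0)` integrable. -/
theorem integrable_derivative_eval_zero {Ω : Type*} [MeasurableSpace Ω] {ν : Measure Ω}
    {p : Ω → Polynomial ℝ} {δ : ℝ} (hδ : 0 < δ)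
    (hm : ∀ y, AEStronglyMeasurable (fun w => (p w).eval y) ν)
    (hm' : ∀ y, AEStronglyMeasurable (fun w => (p w).derivative.eval y) ν)
    (hb : ∀ᵐ w ∂ν, ∀ y, -δ ≤ y → y ≤ 0 → |(p w).eval y| ≤ (p w).eval 0)
    (hb' : ∀ᵐ w ∂ν, ∀ y, -δ ≤ y → y ≤ 0 → |(p w).derivative.eval y| ≤ (p w).derivative.eval 0)
    (hi : Integrable (fun w => (p w).eval 0) ν) {h : ℝ → ℝ} {h0 : ℝ} (hd : HasDerivAt h h0 0)
    (hf : ∀ y, -δ < y → y < 0 → ∫ w, (p w).eval y ∂ν = h y) (hf0 : ∫ w, (p w).eval 0 ∂ν = h 0) :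
    Integrable (fun w => (p w).derivative.eval 0) ν := by
  let y : ℕ → ℝ := fun n => -δ / (n + 2)
  have hy0 : ∀ n, y n < 0 := fun n => div_neg_of_neg_of_pos (by linarith) (by positivity)
  have hyδ : ∀ n, -δ < y n := by
    intro n
    simp only [y]
    rw [neg_div, neg_lt_neg_iff, div_lt_iff₀ (by positivity)]
    have : (0 : ℝ) ≤ n := by positivity
    nlinarith
  have hyt : Tendsto y atTop (𝓝[≠] 0) := by
    rw [tendsto_nhdsWithin_iff]
    refine ⟨?_, Eventually.of_forall fun n => (hy0 n).ne⟩
    have := (tendsto_natCast_atTop_atTop (R := ℝ)).atTop_add (tendsto_const_nhds (x := (2 : ℝ)))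
    exact this.const_div_atTop (-δ)
  have hiy : ∀ n, Integrable (fun w => (p w).eval (y n)) ν := fun n =>
    hi.mono' (hm _) (hb.mono fun w hw => hw (y n) (hyδ n).le (hy0 n).le)
  let q : ℕ → Ω → ℝ := fun n w => ((p w).eval (y n) - (p w).eval 0) / y n
  have hq0 : ∀ n, ∀ᵐ w ∂ν, 0 ≤ q n w := by
    intro n
    filter_upwards [hb] with w hw
    have := (le_abs_self _).trans (hw (y n) (hyδ n).le (hy0 n).le)
    exact div_nonneg_of_nonpos (by linarith) (hy0 n).le
  have hqi : ∀ n, ∫⁻ w, ENNReal.ofReal (q n w) ∂ν = ENNReal.ofReal ((h (y n) - h 0) / y n) := by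
    intro n
    have hqn : Integrable (q n) ν := ((hiy n).sub hi).div_const _
    rw [← ofReal_integral_eq_lintegral_ofReal hqn (hq0 n)]
    simp only [q]
    rw [integral_div, integral_sub (hiy n) hi, hf _ (hyδ n) (hy0 n), hf0]
  have hlim : Tendsto (fun n => ENNReal.ofReal ((h (y n) - h 0) / y n)) atTop
      (𝓝 (ENNReal.ofReal h0)) := by
    refine (ENNReal.continuous_ofReal.tendsto _).comp ?_
    have := (hasDerivAt_iff_tendsto_slope.1 hd).comp hyt
    refine this.congr fun n => ?_
    simp [slope_def_field]
  have hpt : ∀ w, Tendsto (fun n => ENNReal.ofReal (q n w)) atTop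
      (𝓝 (ENNReal.ofReal ((p w).derivative.eval 0))) := by
    intro w
    refine (ENNReal.continuous_ofReal.tendsto _).comp ?_
    have := (hasDerivAt_iff_tendsto_slope.1 ((p w).hasDerivAt 0)).comp hyt
    refine this.congr fun n => ?_
    simp [slope_def_field, q]
  refine ⟨hm' 0, ?_⟩
  have hpos : 0 ≤ᵐ[ν] fun w => (p w).derivative.eval 0 :=
    hb'.mono fun w hw => (abs_nonneg _).trans (hw 0 (by linarith) le_rfl)
  rw [hasFiniteIntegral_iff_ofReal hpos]
  calc ∫⁻ w, ENNReal.ofReal ((p w).derivative.eval 0) ∂ν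
      = ∫⁻ w, liminf (fun n => ENNReal.ofReal (q n w)) atTop ∂ν := by
        simp only [(hpt _).liminf_eq]
    _ ≤ liminf (fun n => ∫⁻ w, ENNReal.ofReal (q n w) ∂ν) atTop :=
        lintegral_liminf_le' fun n =>
          (((hm _).sub (hm 0)).aemeasurable.div_const _).ennreal_ofReal
    _ = ENNReal.ofReal h0 := by simp only [hqi]; exact hlim.liminf_eq
    _ < ⊤ := ENNReal.ofReal_lt_top

/-- If a superposition of polynomials that are, with all their derivatives, maximal at `0` is given
for `y < 0` by a function that is smooth up to `y = 0`, then it may be differentiated termwise, to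
all orders, at `y = 0`. -/
theorem integral_iterate_derivative_eval_zero {Ω : Type*} [MeasurableSpace Ω] {ν : Measure Ω}
    {p : Ω → Polynomial ℝ} {δ : ℝ} (hδ : 0 < δ)
    (hm : ∀ q y, AEStronglyMeasurable (fun w => (Polynomial.derivative^[q] (p w)).eval y) ν)
    (hb : ∀ᵐ w ∂ν, ∀ q y, -δ ≤ y → y ≤ 0 → |(Polynomial.derivative^[q] (p w)).eval y| ≤
      (Polynomial.derivative^[q] (p w)).eval 0)
    (hi : Integrable (fun w => (p w).eval 0) ν) {h : ℕ → ℝ → ℝ}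
    (hd : ∀ q y, -δ < y → y ≤ 0 → HasDerivAt (h q) (h (q + 1) y) y)
    (hf : ∀ y, -δ < y → y < 0 → ∫ w, (p w).eval y ∂ν = h 0 y) (q : ℕ) :
    Integrable (fun w => (Polynomial.derivative^[q] (p w)).eval 0) ν ∧
      ∫ w, (Polynomial.derivative^[q] (p w)).eval 0 ∂ν = h q 0 := by
  have hb1 : ∀ q, ∀ᵐ w ∂ν, ∀ y, -δ ≤ y → y ≤ 0 → |(Polynomial.derivative^[q] (p w)).eval y| ≤
      (Polynomial.derivative^[q] (p w)).eval 0 := fun q => hb.mono fun w hw => hw q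
  -- the value at the endpoint follows from the values at `y < 0` by dominated convergence
  have hend : ∀ q, Integrable (fun w => (Polynomial.derivative^[q] (p w)).eval 0) ν →
      (∀ y, -δ < y → y < 0 → ∫ w, (Polynomial.derivative^[q] (p w)).eval y ∂ν = h q y) →
      ∫ w, (Polynomial.derivative^[q] (p w)).eval 0 ∂ν = h q 0 := by
    intro q hiq hfq
    have hev : ∀ᶠ y in 𝓝[<] (0 : ℝ), -δ < y ∧ y < 0 :=
      Ioo_mem_nhdsLT (by linarith : -δ < 0)
    have h1 : Tendsto (fun y => ∫ w, (Polynomial.derivative^[q] (p w)).eval y ∂ν) (𝓝[<] 0)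
        (𝓝 (∫ w, (Polynomial.derivative^[q] (p w)).eval 0 ∂ν)) := by
      refine tendsto_integral_filter_of_dominated_convergence _
        (Eventually.of_forall fun y => hm q y) ?_ hiq ?_
      · filter_upwards [hev] with y hy
        exact (hb1 q).mono fun w hw => hw y hy.1.le hy.2.le
      · exact Eventually.of_forall fun w =>
          ((Polynomial.continuous _).tendsto 0).mono_left nhdsWithin_le_nhds
    have h2 : Tendsto (h q) (𝓝[<] 0) (𝓝 (h q 0)) :=
      ((hd q 0 (by linarith) le_rfl).continuousAt.tendsto).mono_left nhdsWithin_le_nhds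
    refine tendsto_nhds_unique (h1.congr' ?_) h2
    filter_upwards [hev] with y hy using hfq y hy.1 hy.2
  suffices H : Integrable (fun w => (Polynomial.derivative^[q] (p w)).eval 0) ν ∧
      ∀ y, -δ < y → y < 0 → ∫ w, (Polynomial.derivative^[q] (p w)).eval y ∂ν = h q y from
    ⟨H.1, hend q H.1 H.2⟩
  induction q with
  | zero => exact ⟨hi, hf⟩
  | succ q ih =>
    obtain ⟨hiq, hfq⟩ := ih
    have hsucc : ∀ w, Polynomial.derivative^[q + 1] (p w) =
        (Polynomial.derivative^[q] (p w)).derivative := fun w =>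
      Function.iterate_succ_apply' _ _ _
    have hm1 := hm (q + 1)
    have hb2 := hb1 (q + 1)
    simp only [hsucc] at hm1 hb2 ⊢
    have hi1 := integrable_derivative_eval_zero hδ (hm q) hm1 (hb1 q) hb2 hiq
      (hd q 0 (by linarith) le_rfl) hfq (hend q hiq hfq)
    refine ⟨hi1, fun y hy1 hy2 => ?_⟩
    have hnhds : Set.Ioo (-δ) 0 ∈ 𝓝 y := Ioo_mem_nhds hy1 hy2
    have hder := (hasDerivAt_integral_of_dominated_loc_of_deriv_le
      (F := fun y w => (Polynomial.derivative^[q] (p w)).eval y)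
      (F' := fun y w => (Polynomial.derivative^[q] (p w)).derivative.eval y)
      (bound := fun w => (Polynomial.derivative^[q] (p w)).derivative.eval 0) hnhds
      (Eventually.of_forall fun y => hm q y)
      (hiq.mono' (hm q y) ((hb1 q).mono fun w hw => hw y hy1.le hy2.le)) (hm1 y)
      (hb2.mono fun w hw z hz => hw z hz.1.le hz.2.le) hi1
      (Eventually.of_forall fun w z _ => Polynomial.hasDerivAt _ z)).2
    refine (hder.congr_of_eventuallyEq ?_).unique (hd q y hy1 hy2.le)
    filter_upwards [hnhds] with z hz using (hfq z hz.1 hz.2).symm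

/-- Taylor coefficients of a positive superposition of polynomials that is given for `y < 0` by a
convergent power series. -/
theorem integral_coeff_of_hasSum {Ω : Type*} [MeasurableSpace Ω] {ν : Measure Ω}
    {p : Ω → Polynomial ℝ} {δ : ℝ} (hδ : 0 < δ)
    (hm : ∀ q y, AEStronglyMeasurable (fun w => (Polynomial.derivative^[q] (p w)).eval y) ν)
    (hb : ∀ᵐ w ∂ν, ∀ q y, -δ ≤ y → y ≤ 0 → |(Polynomial.derivative^[q] (p w)).eval y| ≤
      (Polynomial.derivative^[q] (p w)).eval 0)
    (hi : Integrable (fun w => (p w).eval 0) ν) {e : ℕ → ℝ}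
    (he : Summable fun q => |e q| * δ ^ q)
    (hf : ∀ y, -δ < y → y < 0 → ∫ w, (p w).eval y ∂ν = ∑' q, e q * y ^ q) (q : ℕ) :
    Integrable (fun w => (p w).coeff q) ν ∧ ∫ w, (p w).coeff q ∂ν = e q := by
  let P : FormalMultilinearSeries ℝ ℝ ℝ := FormalMultilinearSeries.ofScalars ℝ e
  obtain ⟨r, hrδ⟩ : ∃ r : NNReal, (r : ℝ) = δ := ⟨⟨δ, hδ.le⟩, rfl⟩
  have hr : (r : ENNReal) ≤ P.radius := by
    refine P.le_radius_of_summable_norm ?_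
    refine he.of_nonneg_of_le (fun n => by positivity) fun n => ?_
    rw [FormalMultilinearSeries.ofScalars_norm]
    simp [hrδ]
  have hr0 : 0 < (r : ENNReal) := by
    rw [ENNReal.coe_pos, ← NNReal.coe_pos, hrδ]; exact hδ
  have hP : HasFPowerSeriesOnBall P.sum P 0 r :=
    (P.hasFPowerSeriesOnBall (hr0.trans_le hr)).mono hr0 hr
  have hsum : ∀ y, P.sum y = ∑' q, e q * y ^ q := by
    intro y
    simp only [FormalMultilinearSeries.sum, P, FormalMultilinearSeries.ofScalars_apply_eq,
      smul_eq_mul]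
  have hana : ∀ n, ∀ y, -δ < y → y ≤ 0 → AnalyticAt ℝ (iteratedDeriv n P.sum) y := by
    intro n y h1 h2
    have : AnalyticAt ℝ P.sum y := by
      refine hP.analyticAt_of_mem ?_
      rw [Metric.mem_eball, edist_zero_right]
      rw [← ofReal_norm, Real.norm_eq_abs, abs_of_nonpos h2, ENNReal.ofReal,
        ENNReal.coe_lt_coe, ← NNReal.coe_lt_coe, Real.coe_toNNReal _ (by linarith)]
      linarith
    rw [iteratedDeriv_eq_iterate]
    exact this.iterated_deriv n
  have h0 := integral_iterate_derivative_eval_zero hδ hm hb hi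
    (h := fun n => iteratedDeriv n P.sum)
    (fun n y h1 h2 => by
      rw [iteratedDeriv_succ]
      exact (hana n y h1 h2).differentiableAt.hasDerivAt)
    (fun y h1 h2 => by rw [hf y h1 h2, iteratedDeriv_zero, hsum]) q
  have hco : ∀ w, (Polynomial.derivative^[q] (p w)).eval 0 = q.factorial * (p w).coeff q := by
    intro w
    rw [← Polynomial.coeff_zero_eq_eval_zero, Polynomial.coeff_iterate_derivative]
    simp [Nat.descFactorial_self]
  have hfac : (q.factorial : ℝ) ≠ 0 := by positivity
  have hde : iteratedDeriv q P.sum 0 = q.factorial * e q := by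
    have h2 := hP.factorial_smul (1 : ℝ) q
    rw [iteratedDeriv_eq_iteratedFDeriv, ← h2]
    simp [P]
  simp only [hco, hde] at h0
  constructor
  · refine (h0.1.const_mul (q.factorial : ℝ)⁻¹).congr (Eventually.of_forall fun w => ?_)
    simp only; field_simp
  · have := h0.2
    rw [integral_const_mul] at this
    exact mul_left_cancel₀ hfac this

/-! ### Distributional boundary values of analytic functions -/

namespace SUAmplitude.IsTest

theorem mul_of_contDiffOn {u : ℝ} {φ g : ℝ → ℝ} (hφ : IsTest u φ)
    (hg : ContDiffOn ℝ ∞ g (Set.Ioi (-u))) : IsTest u (fun x => φ x * g x) where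
  smooth := by
    rw [contDiff_iff_contDiffAt]
    intro x
    by_cases hx : x ∈ tsupport φ
    · exact hφ.smooth.contDiffAt.mul (hg.contDiffAt (Ioi_mem_nhds (hφ.supp hx)))
    · have h0 : (fun x => φ x * g x) =ᶠ[𝓝 x] fun _ => 0 := by
        filter_upwards [notMem_tsupport_iff_eventuallyEq.1 hx] with z hz
        simp [hz]
      exact contDiffAt_const.congr_of_eventuallyEq h0
  compact := hφ.compact.mul_right
  supp := (tsupport_mul_subset_left (f := φ) (g := g)).trans hφ.supp

theorem eq_zero {u x : ℝ} {φ : ℝ → ℝ} (hφ : IsTest u φ) (hx : x ≤ -u) : φ x = 0 := by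
  by_contra h
  exact absurd (hφ.supp (subset_tsupport φ h)) (not_lt.2 hx)

theorem div_pow {u : ℝ} (hu : u < 0) {φ : ℝ → ℝ} (hφ : IsTest u φ) (n : ℕ) :
    IsTest u (fun x => φ x / x ^ n) := by
  simp only [div_eq_mul_inv]
  refine hφ.mul_of_contDiffOn ((contDiff_id.pow n).contDiffOn.inv fun x hx => ?_)
  exact pow_ne_zero _ ((neg_pos.2 hu).trans hx).ne'

end SUAmplitude.IsTest

open SUAmplitude in
/-- Uniform boundedness behind the multiplication of a boundary value with an analytic function.
The expansion in powers of `t² / x²` embeds the bounded sequences into the test functions, and the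
Banach–Steinhaus theorem applies to the pairings on this Banach space. -/
theorem exists_bound_integral_div_one_add_sq {f : ℂ → ℂ} {u : ℝ} (hu : u < 0) {t : ℕ → ℝ}
    (ht : Tendsto t atTop (𝓝 0))
    (hf : ∀ n, Continuous fun x : ℝ => f ((x : ℂ) + ((t n : ℝ) : ℂ) * Complex.I))
    (hL : ∀ φ : ℝ → ℝ, IsTest u φ → ∃ L : ℂ, Tendsto
      (fun n => ∫ x : ℝ, (φ x : ℂ) * f ((x : ℂ) + ((t n : ℝ) : ℂ) * Complex.I)) atTop (𝓝 L))
    {φ : ℝ → ℝ} (hφ : IsTest u φ) :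
    ∃ C : ℝ, ∀ᶠ n in atTop, ‖∫ x : ℝ, ((φ x / (1 + t n ^ 2 / x ^ 2) : ℝ) : ℂ) *
      f ((x : ℂ) + ((t n : ℝ) : ℂ) * Complex.I)‖ ≤ C := by
  set r : ℝ := u ^ 2 / 2 with hr
  have hr0 : 0 < r := by have := hu.ne; positivity
  let w : ℝ → ℝ := fun x => r / x ^ 2
  have hw : ∀ x, -u < x → 0 ≤ w x ∧ w x ≤ 1 / 2 := by
    intro x hx
    have hx2 : u ^ 2 ≤ x ^ 2 := by nlinarith
    have hxp : 0 < x ^ 2 := lt_of_lt_of_le (by have := hu.ne; positivity) hx2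
    refine ⟨by positivity, ?_⟩
    simp only [w]
    rw [div_le_iff₀ hxp]; linarith
  -- the power series attached to a bounded sequence
  let g : (BoundedContinuousFunction ℕ ℝ) → ℝ → ℝ := fun c z => ∑' k, c k * z ^ k
  have hsum : ∀ (c : BoundedContinuousFunction ℕ ℝ) x, -u < x →
      Summable fun k => c k * w x ^ k := by
    intro c x hx
    refine Summable.of_norm_bounded (g := fun k : ℕ => ‖c‖ * (1 / 2) ^ k)
      ((summable_geometric_of_lt_one (by norm_num) (by norm_num)).mul_left _) fun k => ?_
    rw [norm_mul, norm_pow, Real.norm_of_nonneg (hw x hx).1]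
    gcongr
    · exact c.norm_coe_le_norm k
    · exact (hw x hx).2
  have hgb : ∀ (c : BoundedContinuousFunction ℕ ℝ) x, -u < x → |g c (w x)| ≤ 2 * ‖c‖ := by
    intro c x hx
    have hgeo : HasSum (fun k : ℕ => ‖c‖ * (1 / 2 : ℝ) ^ k) (2 * ‖c‖) := by
      rw [mul_comm 2]
      refine HasSum.mul_left _ hasSum_geometric_two
    refine tsum_of_norm_bounded (f := fun k => c k * w x ^ k) hgeo fun k => ?_
    rw [norm_mul, norm_pow, Real.norm_of_nonneg (hw x hx).1]
    gcongr
    · exact c.norm_coe_le_norm k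
    · exact (hw x hx).2
  have hgs : ∀ c : BoundedContinuousFunction ℕ ℝ,
      ContDiffOn ℝ ∞ (fun x => g c (w x)) (Set.Ioi (-u)) := by
    intro c
    let P : FormalMultilinearSeries ℝ ℝ ℝ := FormalMultilinearSeries.ofScalars ℝ c
    have hrad : ((1 : NNReal) : ENNReal) ≤ P.radius := by
      refine P.le_radius_of_bound ‖c‖ fun n => ?_
      rw [FormalMultilinearSeries.ofScalars_norm]
      simpa using c.norm_coe_le_norm n
    have hP : HasFPowerSeriesOnBall P.sum P 0 (1 : NNReal) :=
      (P.hasFPowerSeriesOnBall (lt_of_lt_of_le (by simp) hrad)).mono (by simp) hrad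
    have hPs : P.sum = g c := by
      funext z
      simp only [FormalMultilinearSeries.sum, P, FormalMultilinearSeries.ofScalars_apply_eq,
        smul_eq_mul, g]
    have hw' : ContDiffOn ℝ ∞ w (Set.Ioi (-u)) :=
      contDiffOn_const.div (contDiff_id.pow 2).contDiffOn fun x hx =>
        pow_ne_zero _ ((neg_pos.2 hu).trans hx).ne'
    refine ContDiffOn.comp (g := g c) (t := Metric.eball 0 (1 : NNReal)) ?_ hw' ?_
    · rw [← hPs]
      exact hP.analyticOnNhd.contDiffOn Metric.isOpen_eball.uniqueDiffOn
    · intro x hx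
      rw [Metric.mem_eball, edist_zero_right, ← ofReal_norm, Real.norm_of_nonneg (hw x hx).1]
      rw [ENNReal.coe_one, ENNReal.ofReal_lt_one]
      linarith [(hw x hx).2]
  have hT : ∀ c, IsTest u fun x => φ x * g c (w x) := fun c => hφ.mul_of_contDiffOn (hgs c)
  let s : ℕ → ℝ → ℂ := fun n x => (x : ℂ) + ((t n : ℝ) : ℂ) * Complex.I
  have hint : ∀ n (ψ : ℝ → ℝ), IsTest u ψ → Integrable fun x => (ψ x : ℂ) * f (s n x) := by
    intro n ψ hψ
    refine Continuous.integrable_of_hasCompactSupport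
      ((Complex.continuous_ofReal.comp hψ.smooth.continuous).mul (hf n)) ?_
    exact (hψ.compact.comp_left (g := ((↑) : ℝ → ℂ)) Complex.ofReal_zero).mul_right
  let T : ℕ → BoundedContinuousFunction ℕ ℝ →L[ℝ] ℂ := fun n =>
    LinearMap.mkContinuous
      { toFun := fun c => ∫ x : ℝ, ((φ x * g c (w x) : ℝ) : ℂ) * f (s n x)
        map_add' := by
          intro c c'
          rw [← integral_add (hint n _ (hT c)) (hint n _ (hT c'))]
          congr 1; funext x
          rcases le_or_gt x (-u) with hx | hx
          · simp [hφ.eq_zero hx]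
          · have : g (c + c') (w x) = g c (w x) + g c' (w x) := by
              simp only [g]
              rw [← (hsum c x hx).tsum_add (hsum c' x hx)]
              simp [add_mul]
            rw [this]; push_cast; ring
        map_smul' := by
          intro a c
          rw [RingHom.id_apply, ← integral_smul]
          congr 1; funext x
          have : g (a • c) (w x) = a * g c (w x) := by
            simp only [g]
            rw [← tsum_mul_left]
            simp [mul_assoc]
          rw [this, Complex.real_smul]; push_cast; ring }
      (∫ x : ℝ, 2 * ‖(φ x : ℂ) * f (s n x)‖) (by
        intro c
        rw [LinearMap.coe_mk, AddHom.coe_mk, mul_comm, ← integral_const_mul]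
        refine norm_integral_le_of_norm_le
          (((hint n _ hφ).norm.const_mul 2).const_mul ‖c‖) (Eventually.of_forall fun x => ?_)
        rcases le_or_gt x (-u) with hx | hx
        · simp [hφ.eq_zero hx]
        · rw [norm_mul, norm_mul, Complex.norm_real, Complex.norm_real, norm_mul,
            Real.norm_eq_abs (g c (w x))]
          have := mul_le_mul_of_nonneg_left (hgb c x hx)
            (mul_nonneg (norm_nonneg (φ x)) (norm_nonneg (f (s n x))))
          nlinarith [this])
  have hTapp : ∀ n c, T n c = ∫ x : ℝ, ((φ x * g c (w x) : ℝ) : ℂ) * f (s n x) := fun n c => rfl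
  obtain ⟨C, hC⟩ := banach_steinhaus (g := T) (fun c => by
    obtain ⟨L, hL'⟩ := hL _ (hT c)
    obtain ⟨C, hC⟩ := hL'.norm.bddAbove_range
    exact ⟨C, fun n => hC ⟨n, rfl⟩⟩)
  refine ⟨C, ?_⟩
  have hev : ∀ᶠ n in atTop, t n ^ 2 ≤ r := by
    have h2 : Tendsto (fun n => t n ^ 2) atTop (𝓝 0) := by simpa using ht.pow 2
    exact h2.eventually (Iic_mem_nhds hr0)
  filter_upwards [hev] with n hn
  have hq1 : |-(t n ^ 2 / r)| ≤ 1 := by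
    rw [abs_neg, abs_of_nonneg (by positivity), div_le_one hr0]; exact hn
  let b : BoundedContinuousFunction ℕ ℝ :=
    BoundedContinuousFunction.ofNormedAddCommGroupDiscrete (fun k => (-(t n ^ 2 / r)) ^ k) 1
      fun k => by
        rw [norm_pow, Real.norm_eq_abs]
        exact pow_le_one₀ (abs_nonneg _) hq1
  have hb : ‖b‖ ≤ 1 := by
    refine (BoundedContinuousFunction.norm_le zero_le_one).2 fun k => ?_
    change ‖(-(t n ^ 2 / r)) ^ k‖ ≤ 1
    rw [norm_pow, Real.norm_eq_abs]
    exact pow_le_one₀ (abs_nonneg _) hq1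
  have hgeq : ∀ x, -u < x → g b (w x) = (1 + t n ^ 2 / x ^ 2)⁻¹ := by
    intro x hx
    have hx0 : x ≠ 0 := ((neg_pos.2 hu).trans hx).ne'
    have hz : -(t n ^ 2 / r) * w x = -(t n ^ 2 / x ^ 2) := by
      simp only [w]; field_simp
    have hz1 : |-(t n ^ 2 / x ^ 2)| < 1 := by
      rw [← hz, abs_mul, abs_of_nonneg (hw x hx).1]
      nlinarith [(hw x hx).1, (hw x hx).2]
    have : g b (w x) = ∑' k : ℕ, (-(t n ^ 2 / x ^ 2)) ^ k := by
      simp only [g]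
      refine tsum_congr fun k => ?_
      change (-(t n ^ 2 / r)) ^ k * w x ^ k = _
      rw [← mul_pow, hz]
    rw [this, tsum_geometric_of_norm_lt_one hz1, sub_neg_eq_add]
  have heq : T n b = ∫ x : ℝ, ((φ x / (1 + t n ^ 2 / x ^ 2) : ℝ) : ℂ) * f (s n x) := by
    rw [hTapp]
    congr 1; funext x
    rcases le_or_gt x (-u) with hx | hx
    · simp [hφ.eq_zero hx]
    · rw [hgeq x hx, div_eq_mul_inv (φ x)]
  rw [← heq]
  calc ‖T n b‖ ≤ ‖T n‖ * ‖b‖ := (T n).le_opNorm b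
    _ ≤ C * 1 := mul_le_mul (hC n) hb (norm_nonneg _) ((norm_nonneg _).trans (hC n))
    _ = C := mul_one C

open SUAmplitude in
/-- Distributional boundary values on `x > -u > 0` can be divided by `s`. -/
theorem tendsto_integral_mul_div {f : ℂ → ℂ} {σ u : ℝ} (hu : u < 0)
    (hf : ∀ ε : ℝ, 0 < ε → Continuous fun x : ℝ => f ((x : ℂ) + ((σ * ε : ℝ) : ℂ) * Complex.I))
    {L : (ℝ → ℝ) → ℂ} (hL : ∀ φ : ℝ → ℝ, IsTest u φ → Tendsto (fun ε : ℝ =>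
      ∫ x : ℝ, (φ x : ℂ) * f ((x : ℂ) + ((σ * ε : ℝ) : ℂ) * Complex.I)) (𝓝[>] 0) (𝓝 (L φ)))
    {φ : ℝ → ℝ} (hφ : IsTest u φ) :
    Tendsto (fun ε : ℝ => ∫ x : ℝ, (φ x : ℂ) * (f ((x : ℂ) + ((σ * ε : ℝ) : ℂ) * Complex.I) /
      ((x : ℂ) + ((σ * ε : ℝ) : ℂ) * Complex.I))) (𝓝[>] 0) (𝓝 (L fun x => φ x / x)) := by
  refine tendsto_of_seq_tendsto fun ε hε => ?_
  have hεpos : ∀ᶠ n in atTop, 0 < ε n :=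
    (tendsto_nhdsWithin_iff.1 hε).2
  obtain ⟨n0, hn0⟩ := eventually_atTop.1 hεpos
  rw [← tendsto_add_atTop_iff_nat n0]
  have hε' : Tendsto (fun n => ε (n + n0)) atTop (𝓝[>] 0) :=
    hε.comp (tendsto_add_atTop_nat n0)
  set e : ℕ → ℝ := fun n => ε (n + n0) with he
  have hepos : ∀ n, 0 < e n := fun n => hn0 _ (by omega)
  have ht : Tendsto (fun n => σ * e n) atTop (𝓝 0) := by
    have := (tendsto_nhdsWithin_iff.1 hε').1.const_mul σ
    simpa using this
  let s : ℕ → ℝ → ℂ := fun n x => (x : ℂ) + ((σ * e n : ℝ) : ℂ) * Complex.I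
  have hfn : ∀ n, Continuous fun x : ℝ => f (s n x) := fun n => hf _ (hepos n)
  have hint : ∀ n (ψ : ℝ → ℝ), IsTest u ψ → Integrable fun x => (ψ x : ℂ) * f (s n x) := by
    intro n ψ hψ
    refine Continuous.integrable_of_hasCompactSupport
      ((Complex.continuous_ofReal.comp hψ.smooth.continuous).mul (hfn n)) ?_
    exact (hψ.compact.comp_left (g := ((↑) : ℝ → ℂ)) Complex.ofReal_zero).mul_right
  have hbd : ∀ ψ : ℝ → ℝ, IsTest u ψ → ∃ C : ℝ, ∀ᶠ n in atTop,
      ‖∫ x : ℝ, ((ψ x / (1 + (σ * e n) ^ 2 / x ^ 2) : ℝ) : ℂ) * f (s n x)‖ ≤ C := fun ψ hψ =>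
    exists_bound_integral_div_one_add_sq hu ht hfn (fun χ hχ => ⟨_, (hL χ hχ).comp hε'⟩) hψ
  have hφ1 : IsTest u fun x => φ x / x := by simpa using hφ.div_pow hu 1
  have hφ2 : IsTest u fun x => φ x / x ^ 2 := hφ.div_pow hu 2
  have hφ3 : IsTest u fun x => φ x / x ^ 3 := hφ.div_pow hu 3
  have hreg : ∀ n (ψ : ℝ → ℝ), IsTest u ψ →
      IsTest u fun x => ψ x / (1 + (σ * e n) ^ 2 / x ^ 2) := by
    intro n ψ hψ
    simp only [div_eq_mul_inv (ψ _)]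
    refine hψ.mul_of_contDiffOn (ContDiffOn.inv (contDiffOn_const.add
      (contDiffOn_const.div (contDiff_id.pow 2).contDiffOn fun x hx =>
        pow_ne_zero _ ((neg_pos.2 hu).trans hx).ne')) fun x _ => ?_)
    positivity
  obtain ⟨C2, hC2⟩ := hbd _ hφ2
  obtain ⟨C3, hC3⟩ := hbd _ hφ3
  -- `1 / s = 1 / x - (t² / x³ + i t / x²) / (1 + t² / x²)` for `s = x + i t`
  have hdec : ∀ n, ∫ x : ℝ, (φ x : ℂ) * (f (s n x) / s n x) =
      (∫ x : ℝ, ((φ x / x : ℝ) : ℂ) * f (s n x)) -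
      (((σ * e n : ℝ) : ℂ) ^ 2 * ∫ x : ℝ,
        (((φ x / x ^ 3) / (1 + (σ * e n) ^ 2 / x ^ 2) : ℝ) : ℂ) * f (s n x)) -
      (((σ * e n : ℝ) : ℂ) * Complex.I) * ∫ x : ℝ,
        (((φ x / x ^ 2) / (1 + (σ * e n) ^ 2 / x ^ 2) : ℝ) : ℂ) * f (s n x) := by
    intro n
    have i1 := hint n _ hφ1
    have i2 := (hint n _ (hreg n _ hφ3)).const_mul (((σ * e n : ℝ) : ℂ) ^ 2)
    have i3 := (hint n _ (hreg n _ hφ2)).const_mul (((σ * e n : ℝ) : ℂ) * Complex.I)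
    have i12 := i1.sub i2
    simp only [Pi.sub_def] at i12
    rw [← integral_const_mul, ← integral_const_mul, ← integral_sub i1 i2, ← integral_sub i12 i3]
    congr 1; funext x
    rcases le_or_gt x (-u) with hx | hx
    · simp [hφ.eq_zero hx]
    · have hx0 : 0 < x := (neg_pos.2 hu).trans hx
      simp only [s]
      generalize f ((x : ℂ) + ((σ * e n : ℝ) : ℂ) * Complex.I) = z
      generalize σ * e n = t
      have hq : (1 + t ^ 2 / x ^ 2 : ℝ) ≠ 0 := by positivity
      have hq2 : x ^ 2 + t ^ 2 ≠ 0 := by positivity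
      have hs : (x : ℂ) + (t : ℂ) * Complex.I ≠ 0 := by
        intro h
        have := congrArg Complex.re h
        simp at this
        exact hx0.ne' this
      have hs' : ((x : ℂ) + (t : ℂ) * Complex.I)⁻¹ =
          (x - t * Complex.I) / ((x ^ 2 + t ^ 2 : ℝ) : ℂ) := by
        rw [eq_div_iff (by exact_mod_cast hq2), inv_mul_eq_iff_eq_mul₀ hs]
        push_cast
        linear_combination (t : ℂ) ^ 2 * Complex.I_sq
      have hr : ∀ a : ℝ, a / (1 + t ^ 2 / x ^ 2) = a * x ^ 2 / (x ^ 2 + t ^ 2) := by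
        intro a; field_simp
      rw [hr, hr, div_eq_mul_inv z, hs']
      have hx0' : (x : ℂ) ≠ 0 := by exact_mod_cast hx0.ne'
      have hq2' : (x : ℂ) ^ 2 + (t : ℂ) ^ 2 ≠ 0 := by exact_mod_cast hq2
      push_cast
      field_simp
      ring
  have hmul0 : ∀ (c : ℕ → ℂ) (z : ℕ → ℂ) (C : ℝ), Tendsto c atTop (𝓝 0) →
      (∀ᶠ n in atTop, ‖z n‖ ≤ C) → Tendsto (fun n => c n * z n) atTop (𝓝 0) := by
    intro c z C hc hz
    exact hc.zero_mul_isBoundedUnder_le (isBoundedUnder_of_eventually_le hz)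
  have htc : Tendsto (fun n => ((σ * e n : ℝ) : ℂ)) atTop (𝓝 0) := by
    have := (Complex.continuous_ofReal.tendsto 0).comp ht
    rwa [Complex.ofReal_zero] at this
  have l1 := (hL _ hφ1).comp hε'
  have l2 := hmul0 (fun n => ((σ * e n : ℝ) : ℂ) ^ 2) _ C3 
    (by have := htc.pow 2; rwa [zero_pow two_ne_zero] at this) hC3
  have l3 := hmul0 (fun n => ((σ * e n : ℝ) : ℂ) * Complex.I) _ C2
    (by have := htc.mul_const Complex.I; rwa [zero_mul] at this) hC2
  have := (l1.sub l2).sub l3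
  simp only [sub_zero] at this
  refine this.congr fun n => ?_
  exact (hdec n).symm

open SUAmplitude in
/-- Distributional boundary values on `x > -u > 0` can be divided by powers of `s`. -/
theorem tendsto_integral_mul_div_pow {f : ℂ → ℂ} {σ u : ℝ} (hu : u < 0) (hσ : σ ≠ 0)
    (hf : ∀ ε : ℝ, 0 < ε → Continuous fun x : ℝ => f ((x : ℂ) + ((σ * ε : ℝ) : ℂ) * Complex.I))
    {L : (ℝ → ℝ) → ℂ} (hL : ∀ φ : ℝ → ℝ, IsTest u φ → Tendsto (fun ε : ℝ =>
      ∫ x : ℝ, (φ x : ℂ) * f ((x : ℂ) + ((σ * ε : ℝ) : ℂ) * Complex.I)) (𝓝[>] 0) (𝓝 (L φ)))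
    (n : ℕ) {φ : ℝ → ℝ} (hφ : IsTest u φ) :
    Tendsto (fun ε : ℝ => ∫ x : ℝ, (φ x : ℂ) * (f ((x : ℂ) + ((σ * ε : ℝ) : ℂ) * Complex.I) /
      ((x : ℂ) + ((σ * ε : ℝ) : ℂ) * Complex.I) ^ n)) (𝓝[>] 0) (𝓝 (L fun x => φ x / x ^ n)) := by
  induction n generalizing φ with
  | zero => simpa using hL φ hφ
  | succ n ih =>
    have hne : ∀ ε : ℝ, 0 < ε → ∀ x : ℝ, (x : ℂ) + ((σ * ε : ℝ) : ℂ) * Complex.I ≠ 0 := by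
      intro ε hε x h
      have := congrArg Complex.im h
      simp at this
      rcases this with h | h
      · exact hσ h
      · exact hε.ne' h
    have := tendsto_integral_mul_div (f := fun s => f s / s ^ n) (σ := σ) hu
      (fun ε hε => (hf ε hε).div (by fun_prop) fun x => pow_ne_zero _ (hne ε hε x))
      (L := fun φ => L fun x => φ x / x ^ n) (fun ψ hψ => ih hψ) hφ
    simp only [div_div] at this
    simp only [pow_succ' _ n]
    refine this.congr fun ε => ?_
    congr 1; funext x
    rw [mul_comm (_ ^ n)]

/-! ### Boundary values across poles -/

/-- Pairings with a function that is continuous across the real axis, near the support of the test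
function, converge to the pairing on the axis. -/
theorem tendsto_integral_of_continuousOn {h : ℂ → ℂ} {W : Set ℂ} (hW : IsOpen W)
    (hh : ContinuousOn h W) {φ : ℝ → ℝ} (hφ : Continuous φ) (hc : HasCompactSupport φ)
    (hφW : ∀ x ∈ tsupport φ, (x : ℂ) ∈ W) (σ : ℝ) :
    (∀ᶠ ε : ℝ in 𝓝[>] 0, Integrable fun x : ℝ => (φ x : ℂ) *
      h ((x : ℂ) + ((σ * ε : ℝ) : ℂ) * Complex.I)) ∧
    Tendsto (fun ε : ℝ => ∫ x : ℝ, (φ x : ℂ) * h ((x : ℂ) + ((σ * ε : ℝ) : ℂ) * Complex.I))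
      (𝓝[>] 0) (𝓝 (∫ x : ℝ, (φ x : ℂ) * h (x : ℂ))) := by
  have hφc : Continuous fun x => (φ x : ℂ) := Complex.continuous_ofReal.comp hφ
  have hcc : HasCompactSupport fun x => (φ x : ℂ) :=
    hc.comp_left (g := ((↑) : ℝ → ℂ)) Complex.ofReal_zero
  have hT : IsCompact (((↑) : ℝ → ℂ) '' tsupport φ) := hc.isCompact.image Complex.continuous_ofReal
  obtain ⟨δ, hδ, hsub⟩ := hT.exists_cthickening_subset_open hW (by
    rintro _ ⟨x, hx, rfl⟩; exact hφW x hx)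
  have hmem : ∀ x ∈ tsupport φ, ∀ t : ℝ, |t| ≤ δ →
      (x : ℂ) + (t : ℂ) * Complex.I ∈ Metric.cthickening δ (((↑) : ℝ → ℂ) '' tsupport φ) := by
    intro x hx t ht
    refine Metric.mem_cthickening_of_dist_le _ (x : ℂ) _ _ ⟨x, hx, rfl⟩ ?_
    rw [dist_eq_norm, add_sub_cancel_left, norm_mul, Complex.norm_I, mul_one, Complex.norm_real]
    exact ht
  obtain ⟨C, hC⟩ := hT.cthickening.exists_bound_of_continuousOn (hh.mono hsub)
  have hcont : ∀ t : ℝ, |t| ≤ δ →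
      Continuous fun x : ℝ => (φ x : ℂ) * h ((x : ℂ) + (t : ℂ) * Complex.I) := by
    intro t ht
    rw [continuous_iff_continuousAt]
    intro x
    by_cases hx : x ∈ tsupport φ
    · refine hφc.continuousAt.mul ?_
      have h1 := hh.continuousAt (hW.mem_nhds (hsub (hmem x hx t ht)))
      exact ContinuousAt.comp (f := fun x : ℝ => (x : ℂ) + (t : ℂ) * Complex.I) h1
        (by fun_prop)
    · have h0 : (fun x : ℝ => (φ x : ℂ) * h ((x : ℂ) + (t : ℂ) * Complex.I)) =ᶠ[𝓝 x]
          fun _ => 0 := by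
        filter_upwards [notMem_tsupport_iff_eventuallyEq.1 hx] with z hz
        simp [hz]
      exact continuousAt_const.congr h0.symm
  have hev : ∀ᶠ ε : ℝ in 𝓝[>] 0, |σ * ε| ≤ δ := by
    have h1 : Continuous fun ε : ℝ => |σ * ε| := by fun_prop
    have h2 : ∀ᶠ ε : ℝ in 𝓝 0, |σ * ε| < δ :=
      (h1.tendsto 0).eventually_lt_const (by simpa using hδ)
    exact (h2.filter_mono nhdsWithin_le_nhds).mono fun ε hε => hε.le
  refine ⟨hev.mono fun ε hε => (hcont _ hε).integrable_of_hasCompactSupport hcc.mul_right, ?_⟩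
  refine tendsto_integral_filter_of_dominated_convergence (fun x => ‖(φ x : ℂ)‖ * C)
    (hev.mono fun ε hε => (hcont _ hε).aestronglyMeasurable)
    (hev.mono fun ε hε => Eventually.of_forall fun x => ?_)
    ((hφc.norm.mul continuous_const).integrable_of_hasCompactSupport hcc.norm.mul_right)
    (Eventually.of_forall fun x => ?_)
  · by_cases hx : x ∈ tsupport φ
    · rw [norm_mul]
      gcongr
      exact hC _ (hmem x hx _ hε)
    · simp [image_eq_zero_of_notMem_tsupport hx]
  · by_cases hx : x ∈ tsupport φ
    · refine Tendsto.const_mul _ ?_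
      have h1 : Tendsto h (𝓝 (x : ℂ)) (𝓝 (h x)) := hh.continuousAt (hW.mem_nhds (hφW x hx))
      refine h1.comp ?_
      have h2 : Continuous fun ε : ℝ => (x : ℂ) + ((σ * ε : ℝ) : ℂ) * Complex.I := by fun_prop
      simpa using (h2.tendsto 0).mono_left nhdsWithin_le_nhds
    · simp [image_eq_zero_of_notMem_tsupport hx]

/-- The Sokhotski–Plemelj formula for the discontinuity of a simple pole. -/
theorem tendsto_integral_simple_pole {φ : ℝ → ℝ} (hφ : Continuous φ) (hc : HasCompactSupport φ)
    (y : ℝ) :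
    Tendsto (fun ε : ℝ => ∫ x : ℝ, (φ x : ℂ) * (1 / ((x : ℂ) + ((1 * ε : ℝ) : ℂ) * Complex.I - y) -
      1 / ((x : ℂ) + ((-1 * ε : ℝ) : ℂ) * Complex.I - y))) (𝓝[>] 0)
      (𝓝 (-(2 * Real.pi * Complex.I) * φ y)) := by
  obtain ⟨C, hC⟩ := hc.exists_bound_of_continuous hφ
  have hsub : ∀ ε : ℝ, 0 < ε → ∫ x : ℝ, (φ x : ℂ) *
      (1 / ((x : ℂ) + ((1 * ε : ℝ) : ℂ) * Complex.I - y) -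
      1 / ((x : ℂ) + ((-1 * ε : ℝ) : ℂ) * Complex.I - y)) =
      ∫ t : ℝ, (-2 * Complex.I) * ((φ (y + ε * t) * (1 + t ^ 2)⁻¹ : ℝ) : ℂ) := by
    intro ε hε
    have h1 := integral_add_left_eq_self (μ := (volume : Measure ℝ)) (fun x : ℝ => (φ x : ℂ) *
      (1 / ((x : ℂ) + ((1 * ε : ℝ) : ℂ) * Complex.I - y) -
      1 / ((x : ℂ) + ((-1 * ε : ℝ) : ℂ) * Complex.I - y))) y
    have h2 := Measure.integral_comp_mul_left (fun x : ℝ => (φ (y + x) : ℂ) *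
      (1 / (((y + x : ℝ) : ℂ) + ((1 * ε : ℝ) : ℂ) * Complex.I - y) -
      1 / (((y + x : ℝ) : ℂ) + ((-1 * ε : ℝ) : ℂ) * Complex.I - y))) ε
    rw [← h1]
    have h3 : ∀ z : ℂ, z = (ε : ℂ) * (|ε⁻¹| • z) := by
      intro z
      rw [abs_of_pos (inv_pos.2 hε), Complex.real_smul, ← mul_assoc, ← Complex.ofReal_mul,
        mul_inv_cancel₀ hε.ne']
      simp
    rw [h3 (∫ x : ℝ, _), ← h2, ← integral_const_mul]
    congr 1; funext t
    have e1 : ((1 : ℝ) + t ^ 2) ≠ 0 := by positivity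
    have e2 : (1 : ℂ) + (t : ℂ) ^ 2 ≠ 0 := by exact_mod_cast e1
    have ht1 : (t : ℂ) + Complex.I ≠ 0 := by
      intro h
      have := congrArg Complex.im h
      simp at this
    have ht2 : (t : ℂ) - Complex.I ≠ 0 := by
      intro h
      have := congrArg Complex.im h
      simp at this
    have hεc : (ε : ℂ) ≠ 0 := by exact_mod_cast hε.ne'
    have f1 : ((y + ε * t : ℝ) : ℂ) + ((1 * ε : ℝ) : ℂ) * Complex.I - y =
        ε * (t + Complex.I) := by push_cast; ring
    have f2 : ((y + ε * t : ℝ) : ℂ) + ((-1 * ε : ℝ) : ℂ) * Complex.I - y =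
        ε * (t - Complex.I) := by push_cast; ring
    rw [f1, f2]
    have f3 : (1 : ℂ) / (ε * (t + Complex.I)) - 1 / (ε * (t - Complex.I)) =
        (-2 * Complex.I) / (ε * (1 + t ^ 2)) := by
      have : (1 : ℂ) + t ^ 2 = (t + Complex.I) * (t - Complex.I) := by
        linear_combination Complex.I_sq
      rw [this]
      field_simp
      ring
    rw [f3]
    push_cast
    field_simp
  have hlim : Tendsto (fun ε : ℝ => ∫ t : ℝ, (-2 * Complex.I) *
      ((φ (y + ε * t) * (1 + t ^ 2)⁻¹ : ℝ) : ℂ)) (𝓝[>] 0)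
      (𝓝 (∫ t : ℝ, (-2 * Complex.I) * ((φ y * (1 + t ^ 2)⁻¹ : ℝ) : ℂ))) := by
    refine tendsto_integral_filter_of_dominated_convergence (fun t => 2 * (C * (1 + t ^ 2)⁻¹))
      (Eventually.of_forall fun ε => Continuous.aestronglyMeasurable ?_)
      (Eventually.of_forall fun ε => Eventually.of_forall fun t => ?_)
      ((integrable_inv_one_add_sq.const_mul C).const_mul 2)
      (Eventually.of_forall fun t => ?_)
    · refine continuous_const.mul (Complex.continuous_ofReal.comp ?_)
      refine (hφ.comp (by fun_prop)).mul (Continuous.inv₀ (by fun_prop) fun t => by positivity)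
    · have : (0 : ℝ) ≤ (1 + t ^ 2)⁻¹ := by positivity
      rw [norm_mul, Complex.norm_real, norm_mul (φ _), Real.norm_of_nonneg this]
      simp only [neg_mul, norm_neg, Complex.norm_mul, Complex.norm_ofNat, Complex.norm_I, mul_one]
      gcongr
      exact hC _
    · refine Tendsto.const_mul _ ((Complex.continuous_ofReal.tendsto _).comp
        (Tendsto.mul_const _ ?_))
      have : Continuous fun ε : ℝ => φ (y + ε * t) := hφ.comp (by fun_prop)
      simpa using (this.tendsto 0).mono_left nhdsWithin_le_nhds
  have hval : ∫ t : ℝ, (-2 * Complex.I) * ((φ y * (1 + t ^ 2)⁻¹ : ℝ) : ℂ) =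
      -(2 * Real.pi * Complex.I) * φ y := by
    rw [integral_const_mul, integral_complex_ofReal, integral_const_mul,
      integral_univ_inv_one_add_sq]
    push_cast; ring
  rw [hval] at hlim
  refine hlim.congr' ?_
  filter_upwards [self_mem_nhdsWithin] with ε hε using (hsub ε hε).symm

/-- Moving the contour: integration by parts turns the derivative in the height of the contour into
a derivative of the test function. -/
theorem hasDerivAt_integral_height {f : ℂ → ℂ} {σ : ℝ}
    (hf : DifferentiableOn ℂ f {s | 0 < σ * s.im}) (hσ : σ ≠ 0) {ψ : ℝ → ℝ} (hψ : ContDiff ℝ ∞ ψ)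
    (hc : HasCompactSupport ψ) {y : ℝ} (hy : 0 < y) :
    HasDerivAt (fun y : ℝ => ∫ x : ℝ, (ψ x : ℂ) * f ((x : ℂ) + ((σ * y : ℝ) : ℂ) * Complex.I))
      (-(σ * Complex.I) * ∫ x : ℝ, ((deriv ψ x : ℝ) : ℂ) *
        f ((x : ℂ) + ((σ * y : ℝ) : ℂ) * Complex.I)) y := by
  set U : Set ℂ := {s | 0 < σ * s.im} with hU
  have hUo : IsOpen U := isOpen_lt continuous_const (by fun_prop)
  have hmem : ∀ (x : ℝ) {y : ℝ}, 0 < y → (x : ℂ) + ((σ * y : ℝ) : ℂ) * Complex.I ∈ U := by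
    intro x y hy
    have : 0 < σ * (σ * y) := by
      rw [← mul_assoc]; exact mul_pos (mul_self_pos.2 hσ) hy
    simpa [hU] using this
  have hdf : DifferentiableOn ℂ (deriv f) U := hf.deriv hUo
  have hcont : ∀ {h : ℂ → ℂ}, DifferentiableOn ℂ h U → ∀ y, 0 < y →
      Continuous fun x : ℝ => h ((x : ℂ) + ((σ * y : ℝ) : ℂ) * Complex.I) := fun {h} hh y hy =>
    hh.continuousOn.comp_continuous (by fun_prop) fun x => hmem x hy
  have hψc : Continuous fun x => (ψ x : ℂ) := Complex.continuous_ofReal.comp hψ.continuous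
  have hcc : HasCompactSupport fun x => (ψ x : ℂ) :=
    hc.comp_left (g := ((↑) : ℝ → ℂ)) Complex.ofReal_zero
  have hdψ : Continuous fun x => ((deriv ψ x : ℝ) : ℂ) :=
    Complex.continuous_ofReal.comp (hψ.continuous_deriv (by simp))
  have hdcc : HasCompactSupport fun x => ((deriv ψ x : ℝ) : ℂ) :=
    hc.deriv.comp_left (g := ((↑) : ℝ → ℂ)) Complex.ofReal_zero
  have hint : ∀ {h : ℂ → ℂ}, DifferentiableOn ℂ h U → ∀ y, 0 < y → Integrable fun x : ℝ =>
      (ψ x : ℂ) * h ((x : ℂ) + ((σ * y : ℝ) : ℂ) * Complex.I) := fun {h} hh y hy =>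
    (hψc.mul (hcont hh y hy)).integrable_of_hasCompactSupport hcc.mul_right
  have hderf : ∀ s ∈ U, HasDerivAt f (deriv f s) s := fun s hs =>
    (hf.differentiableAt (hUo.mem_nhds hs)).hasDerivAt
  -- differentiation under the integral sign
  have hK : IsCompact (tsupport ψ ×ˢ Set.Icc (y / 2) (2 * y)) := hc.prod isCompact_Icc
  obtain ⟨C, hC⟩ := hK.exists_bound_of_continuousOn
    (f := fun p : ℝ × ℝ => deriv f ((p.1 : ℂ) + ((σ * p.2 : ℝ) : ℂ) * Complex.I))
    (hdf.continuousOn.comp (by fun_prop) fun p hp => hmem _ (by linarith [hp.2.1]))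
  have h1 := (hasDerivAt_integral_of_dominated_loc_of_deriv_le
    (μ := (volume : Measure ℝ)) (x₀ := y) (s := Set.Ioo (y / 2) (2 * y))
    (F := fun (y : ℝ) (x : ℝ) => (ψ x : ℂ) * f ((x : ℂ) + ((σ * y : ℝ) : ℂ) * Complex.I))
    (F' := fun (y : ℝ) (x : ℝ) => (ψ x : ℂ) *
      (deriv f ((x : ℂ) + ((σ * y : ℝ) : ℂ) * Complex.I) * (σ * Complex.I)))
    (bound := fun x => ‖(ψ x : ℂ)‖ * (C * ‖(σ * Complex.I : ℂ)‖))
    (Ioo_mem_nhds (by linarith) (by linarith))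
    (by
      filter_upwards [Ioi_mem_nhds hy] with z hz
      exact (hint hf z hz).aestronglyMeasurable)
    (hint hf y hy)
    ((hψc.mul ((hcont hdf y hy).mul continuous_const)).aestronglyMeasurable)
    (Eventually.of_forall fun x z hz => by
      rw [norm_mul, norm_mul]
      by_cases hx : x ∈ tsupport ψ
      · gcongr
        exact hC (x, z) ⟨hx, hz.1.le, hz.2.le⟩
      · rw [image_eq_zero_of_notMem_tsupport hx]; simp)
    ((hψc.norm.mul continuous_const).integrable_of_hasCompactSupport hcc.norm.mul_right)
    (Eventually.of_forall fun x z hz => by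
      refine HasDerivAt.const_mul _ ?_
      have hz0 : 0 < z := by linarith [hz.1]
      have hl : HasDerivAt (fun z : ℝ => (x : ℂ) + ((σ * z : ℝ) : ℂ) * Complex.I)
          (σ * Complex.I) z := by
        have := (((hasDerivAt_id z).const_mul σ).ofReal_comp.mul_const Complex.I).const_add (x : ℂ)
        simpa using this
      exact (hderf _ (hmem x hz0)).comp z hl)).2
  refine h1.congr_deriv ?_
  -- integration by parts
  have h2 := integral_mul_deriv_eq_deriv_mul_of_integrable
    (u := fun x => (ψ x : ℂ)) (u' := fun x => ((deriv ψ x : ℝ) : ℂ))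
    (v := fun x : ℝ => f ((x : ℂ) + ((σ * y : ℝ) : ℂ) * Complex.I))
    (v' := fun x : ℝ => deriv f ((x : ℂ) + ((σ * y : ℝ) : ℂ) * Complex.I))
    (fun x _ => ((hψ.differentiable (by simp)) x).hasDerivAt.ofReal_comp)
    (fun x _ => by
      have hl : HasDerivAt (fun x : ℝ => (x : ℂ) + ((σ * y : ℝ) : ℂ) * Complex.I) 1 x := by
        simpa using (hasDerivAt_id x).ofReal_comp.add_const (((σ * y : ℝ) : ℂ) * Complex.I)
      have := (hderf _ (hmem x hy)).comp x hl
      rw [mul_one] at this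
      exact this)
    (hint hdf y hy)
    ((hdψ.mul (hcont hf y hy)).integrable_of_hasCompactSupport hdcc.mul_right)
    (hint hf y hy)
  simp only [← mul_assoc]
  rw [integral_mul_const, integral_mul_const, h2]
  ring

/-! ### Pairings with an almost analytic cutoff -/

/-- A smooth cutoff: it equals `1` on `[-1, 1]` and is supported in `[-2, 2]`. -/
noncomputable def cutoff : ContDiffBump (0 : ℝ) := ⟨1, 2, one_pos, one_lt_two⟩

theorem contDiff_cutoff : ContDiff ℝ ∞ (cutoff : ℝ → ℝ) := cutoff.contDiff

theorem cutoff_eq_one {x : ℝ} (hx : |x| ≤ 1) : cutoff x = 1 :=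
  cutoff.one_of_mem_closedBall (by simpa [cutoff] using hx)

theorem cutoff_eq_zero {x : ℝ} (hx : 2 ≤ |x|) : cutoff x = 0 :=
  cutoff.zero_of_le_dist (by simpa [cutoff] using hx)

theorem hasCompactSupport_cutoff : HasCompactSupport (cutoff : ℝ → ℝ) := cutoff.hasCompactSupport

theorem contDiff_iteratedDeriv_cutoff (k : ℕ) :
    ContDiff ℝ ∞ (iteratedDeriv k (cutoff : ℝ → ℝ)) := by
  rw [iteratedDeriv_eq_iterate]
  exact ContDiff.iterate_deriv k contDiff_cutoff

theorem hasCompactSupport_iteratedDeriv_cutoff (k : ℕ) :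
    HasCompactSupport (iteratedDeriv k (cutoff : ℝ → ℝ)) := by
  induction k with
  | zero => simpa [iteratedDeriv_zero] using hasCompactSupport_cutoff
  | succ k ih => rw [iteratedDeriv_succ]; exact ih.deriv

theorem iteratedDeriv_cutoff_eq_zero (k : ℕ) {x : ℝ} (hx : 2 < |x|) :
    iteratedDeriv k (cutoff : ℝ → ℝ) x = 0 := by
  have h : (cutoff : ℝ → ℝ) =ᶠ[𝓝 x] fun _ => 0 := by
    filter_upwards [(isOpen_lt continuous_const continuous_abs).mem_nhds hx] with z hz
    exact cutoff_eq_zero hz.le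
  rw [(h.iteratedDeriv_eq k)]
  simp

theorem iteratedDeriv_succ_cutoff_eq_zero (k : ℕ) {x : ℝ} (hx : |x| < 1) :
    iteratedDeriv (k + 1) (cutoff : ℝ → ℝ) x = 0 := by
  have h : (cutoff : ℝ → ℝ) =ᶠ[𝓝 x] fun _ => 1 := by
    filter_upwards [(isOpen_lt continuous_abs continuous_const).mem_nhds hx] with z hz
    exact cutoff_eq_one (le_of_lt hz)
  rw [(h.iteratedDeriv_eq (k + 1))]
  simp [iteratedDeriv_const]

/-- The pairing, at height `y`, of `f` with the almost analytic extension of order `K` of the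
cutoff `φ`: `∑_{k ≤ K} (i σ y)^k / k! ∫ φ^(k)(x) f(x + i σ y) dx`. -/
noncomputable def cutoffPairing (K : ℕ) (σ : ℝ) (f : ℂ → ℂ) (y : ℝ) : ℂ :=
  ∑ k ∈ Finset.range (K + 1), ((σ * y : ℝ) * Complex.I) ^ k / (k.factorial : ℂ) *
    ∫ x : ℝ, ((iteratedDeriv k (cutoff : ℝ → ℝ) x : ℝ) : ℂ) *
      f ((x : ℂ) + ((σ * y : ℝ) : ℂ) * Complex.I)

/-- The sum telescopes: only the top derivative of the cutoff, with the factor `y ^ K`, survives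
in the derivative of the pairing. -/
theorem hasDerivAt_cutoffPairing {f : ℂ → ℂ} {σ : ℝ}
    (hf : DifferentiableOn ℂ f {s | 0 < σ * s.im}) (hσ : σ ≠ 0) (K : ℕ) {y : ℝ} (hy : 0 < y) :
    HasDerivAt (cutoffPairing K σ f)
      (-(σ * Complex.I) * (((σ * y : ℝ) * Complex.I) ^ K / (K.factorial : ℂ) *
        ∫ x : ℝ, ((iteratedDeriv (K + 1) (cutoff : ℝ → ℝ) x : ℝ) : ℂ) *
          f ((x : ℂ) + ((σ * y : ℝ) : ℂ) * Complex.I))) y := by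
  have hF : ∀ k, HasDerivAt (fun y : ℝ => ∫ x : ℝ, ((iteratedDeriv k (cutoff : ℝ → ℝ) x : ℝ) : ℂ) *
      f ((x : ℂ) + ((σ * y : ℝ) : ℂ) * Complex.I)) (-(σ * Complex.I) *
        ∫ x : ℝ, ((iteratedDeriv (k + 1) (cutoff : ℝ → ℝ) x : ℝ) : ℂ) *
          f ((x : ℂ) + ((σ * y : ℝ) : ℂ) * Complex.I)) y := by
    intro k
    rw [iteratedDeriv_succ]
    exact hasDerivAt_integral_height hf hσ (contDiff_iteratedDeriv_cutoff k)
      (hasCompactSupport_iteratedDeriv_cutoff k) hy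
  have hl : HasDerivAt (fun y : ℝ => ((σ * y : ℝ) : ℂ) * Complex.I) (σ * Complex.I) y := by
    have := ((hasDerivAt_id y).const_mul σ).ofReal_comp.mul_const Complex.I
    simpa using this
  induction K with
  | zero =>
    have h := hF 0
    simp only [zero_add] at h ⊢
    have e : cutoffPairing 0 σ f = fun y : ℝ => ∫ x : ℝ,
        ((iteratedDeriv 0 (cutoff : ℝ → ℝ) x : ℝ) : ℂ) *
          f ((x : ℂ) + ((σ * y : ℝ) : ℂ) * Complex.I) := by
      funext y; simp [cutoffPairing]
    rw [e]
    simpa using h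
  | succ K ih =>
    have e : cutoffPairing (K + 1) σ f = fun y : ℝ => cutoffPairing K σ f y +
        ((σ * y : ℝ) * Complex.I) ^ (K + 1) / ((K + 1).factorial : ℂ) *
          ∫ x : ℝ, ((iteratedDeriv (K + 1) (cutoff : ℝ → ℝ) x : ℝ) : ℂ) *
            f ((x : ℂ) + ((σ * y : ℝ) : ℂ) * Complex.I) := by
      funext y
      rw [cutoffPairing, Finset.sum_range_succ]
      rfl
    rw [e]
    have h := ih.add (((hl.pow (K + 1)).div_const ((K + 1).factorial : ℂ)).mul (hF (K + 1)))
    refine h.congr_deriv ?_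
    have hk : ((K : ℂ) + 1) ≠ 0 := by exact_mod_cast Nat.succ_ne_zero K
    have hk2 : (K.factorial : ℂ) ≠ 0 := by exact_mod_cast K.factorial_ne_zero
    rw [Nat.factorial_succ]
    simp only [Pi.pow_apply, Nat.add_sub_cancel]
    push_cast
    field_simp
    ring

/-- The contour estimate at unit scale. Only values of `f` away from the disc `|s| < 1` enter, and
they may blow up like `|Im s| ^ (-K)` at the real axis. -/
theorem exists_norm_cutoffPairing_le (K : ℕ) : ∃ C : ℝ, 0 ≤ C ∧ ∀ (f : ℂ → ℂ) (σ S : ℝ), |σ| = 1 →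
    DifferentiableOn ℂ f {s | 0 < σ * s.im} → 0 ≤ S →
    (∀ x y : ℝ, |x| ≤ 2 → 0 < y → y ≤ 1 → (1 ≤ |x| ∨ y = 1) →
      y ^ K * ‖f ((x : ℂ) + ((σ * y : ℝ) : ℂ) * Complex.I)‖ ≤ S) →
    ∀ y, 0 < y → y ≤ 1 → ‖cutoffPairing K σ f y‖ ≤ C * S := by
  let N : ℕ → ℝ := fun k => ∫ x : ℝ, ‖iteratedDeriv k (cutoff : ℝ → ℝ) x‖
  have hN0 : ∀ k, 0 ≤ N k := fun k => integral_nonneg fun x => norm_nonneg _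
  have hNi : ∀ k, Integrable fun x => ‖iteratedDeriv k (cutoff : ℝ → ℝ) x‖ := fun k =>
    ((contDiff_iteratedDeriv_cutoff k).continuous.integrable_of_hasCompactSupport
      (hasCompactSupport_iteratedDeriv_cutoff k)).norm
  refine ⟨∑ k ∈ Finset.range (K + 1), N k + N (K + 1), add_nonneg
    (Finset.sum_nonneg fun k _ => hN0 k) (hN0 _), fun f σ S hσ hf hS hb y hy hy1 => ?_⟩
  have hσ0 : σ ≠ 0 := by rintro rfl; simp at hσ
  have hnorm : ∀ y : ℝ, 0 < y → ‖((σ * y : ℝ) : ℂ) * Complex.I‖ = y := by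
    intro y hy
    rw [norm_mul, Complex.norm_I, mul_one, Complex.norm_real, Real.norm_eq_abs, abs_mul, hσ,
      one_mul, abs_of_pos hy]
  have hfac : ∀ k : ℕ, ‖(k.factorial : ℂ)‖⁻¹ ≤ 1 := by
    intro k
    rw [Complex.norm_natCast]
    exact inv_le_one_of_one_le₀ (by exact_mod_cast k.factorial_pos)
  -- the horizontal part of the contour, at height `1`
  have h1 : ‖cutoffPairing K σ f 1‖ ≤ (∑ k ∈ Finset.range (K + 1), N k) * S := by
    rw [cutoffPairing, Finset.sum_mul]
    refine norm_sum_le_of_le _ fun k _ => ?_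
    rw [norm_mul, norm_div, norm_pow, hnorm 1 one_pos, one_pow, one_div]
    have hI : ‖∫ x : ℝ, ((iteratedDeriv k (cutoff : ℝ → ℝ) x : ℝ) : ℂ) *
        f ((x : ℂ) + ((σ * 1 : ℝ) : ℂ) * Complex.I)‖ ≤ N k * S := by
      rw [← integral_mul_const]
      refine norm_integral_le_of_norm_le ((hNi k).mul_const S) (Eventually.of_forall fun x => ?_)
      rw [norm_mul, Complex.norm_real]
      rcases le_or_gt |x| 2 with hx | hx
      · have := hb x 1 hx one_pos le_rfl (Or.inr rfl)
        rw [one_pow, one_mul] at this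
        gcongr
      · simp [iteratedDeriv_cutoff_eq_zero k hx]
    calc _ ≤ 1 * (N k * S) := mul_le_mul (hfac k) hI (norm_nonneg _) zero_le_one
      _ = N k * S := one_mul _
  -- the descent to height `y`: the derivative of the pairing only sees `1 ≤ |x| ≤ 2`
  have hder : ∀ z ∈ Set.Icc y 1, HasDerivWithinAt (cutoffPairing K σ f)
      (-(σ * Complex.I) * (((σ * z : ℝ) * Complex.I) ^ K / (K.factorial : ℂ) *
        ∫ x : ℝ, ((iteratedDeriv (K + 1) (cutoff : ℝ → ℝ) x : ℝ) : ℂ) *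
          f ((x : ℂ) + ((σ * z : ℝ) : ℂ) * Complex.I))) (Set.Icc y 1) z := fun z hz =>
    (hasDerivAt_cutoffPairing hf hσ0 K (hy.trans_le hz.1)).hasDerivWithinAt
  have hdb : ∀ z ∈ Set.Icc y 1, ‖-(σ * Complex.I) * (((σ * z : ℝ) * Complex.I) ^ K /
      (K.factorial : ℂ) * ∫ x : ℝ, ((iteratedDeriv (K + 1) (cutoff : ℝ → ℝ) x : ℝ) : ℂ) *
          f ((x : ℂ) + ((σ * z : ℝ) : ℂ) * Complex.I))‖ ≤ N (K + 1) * S := by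
    intro z hz
    have hz0 : 0 < z := hy.trans_le hz.1
    have hI : z ^ K * ‖∫ x : ℝ, ((iteratedDeriv (K + 1) (cutoff : ℝ → ℝ) x : ℝ) : ℂ) *
        f ((x : ℂ) + ((σ * z : ℝ) : ℂ) * Complex.I)‖ ≤ N (K + 1) * S := by
      have e : z ^ K * ‖∫ x : ℝ, ((iteratedDeriv (K + 1) (cutoff : ℝ → ℝ) x : ℝ) : ℂ) *
          f ((x : ℂ) + ((σ * z : ℝ) : ℂ) * Complex.I)‖ =
          ‖∫ x : ℝ, ((z ^ K : ℝ) : ℂ) * (((iteratedDeriv (K + 1) (cutoff : ℝ → ℝ) x : ℝ) : ℂ) *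
          f ((x : ℂ) + ((σ * z : ℝ) : ℂ) * Complex.I))‖ := by
        rw [integral_const_mul, norm_mul, Complex.norm_real, Real.norm_of_nonneg (by positivity)]
      rw [e, ← integral_mul_const]
      refine norm_integral_le_of_norm_le ((hNi _).mul_const S) (Eventually.of_forall fun x => ?_)
      rw [norm_mul, norm_mul, Complex.norm_real, Complex.norm_real,
        Real.norm_of_nonneg (by positivity : 0 ≤ z ^ K), mul_left_comm]
      rcases le_or_gt |x| 2 with hx | hx
      · rcases lt_or_ge |x| 1 with hx1 | hx1
        · simp [iteratedDeriv_succ_cutoff_eq_zero K hx1]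
        · have := hb x z hx hz0 hz.2 (Or.inl hx1)
          gcongr
      · simp [iteratedDeriv_cutoff_eq_zero (K + 1) hx]
    rw [norm_mul, norm_neg, norm_mul, Complex.norm_real, Real.norm_eq_abs, hσ, Complex.norm_I,
      one_mul, one_mul, norm_mul, norm_div, norm_pow, hnorm z hz0, div_mul_eq_mul_div,
      div_eq_mul_inv]
    calc _ ≤ N (K + 1) * S * 1 := mul_le_mul hI (hfac K) (by positivity) (by
            exact mul_nonneg (hN0 _) hS)
      _ = _ := mul_one _
  have h2 := (convex_Icc y 1).norm_image_sub_le_of_norm_hasDerivWithin_le hder hdb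
    (Set.right_mem_Icc.2 hy1) (Set.left_mem_Icc.2 hy1)
  have h3 : ‖y - 1‖ ≤ 1 := by
    rw [Real.norm_eq_abs, abs_le]; constructor <;> linarith
  have h4 : ‖cutoffPairing K σ f y‖ ≤ ‖cutoffPairing K σ f 1‖ +
      ‖cutoffPairing K σ f y - cutoffPairing K σ f 1‖ := by
    have := norm_add_le (cutoffPairing K σ f 1) (cutoffPairing K σ f y - cutoffPairing K σ f 1)
    rwa [add_sub_cancel] at this
  have h5 : N (K + 1) * S * ‖y - 1‖ ≤ N (K + 1) * S :=
    mul_le_of_le_one_right (mul_nonneg (hN0 _) hS) h3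
  rw [add_mul]
  linarith

/-! ### The spectral measure and the dispersive pairing -/

/-- The discontinuity of a function with a simple pole of residue `R` at `y`, paired with a test
function supported near `y`. -/
theorem tendsto_integral_discontinuity_of_residue {f : ℂ → ℂ} {y r r' : ℝ} {R : ℂ} (hr : r' < r)
    (hr0 : 0 < r)
    (hf : DifferentiableOn ℂ f (Metric.ball (y : ℂ) r \ {(y : ℂ)}))
    (hR : Tendsto (fun s => (s - y) * f s) (𝓝[≠] (y : ℂ)) (𝓝 R)) {φ : ℝ → ℝ} (hφ : Continuous φ)
    (hφs : ∀ x, φ x ≠ 0 → |x - y| ≤ r') :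
    Tendsto (fun ε : ℝ => ∫ x : ℝ, (φ x : ℂ) * (f ((x : ℂ) + ((1 * ε : ℝ) : ℂ) * Complex.I) -
      f ((x : ℂ) + ((-1 * ε : ℝ) : ℂ) * Complex.I))) (𝓝[>] 0)
      (𝓝 (-(2 * Real.pi * Complex.I) * R * φ y)) := by
  have hc : HasCompactSupport φ := by
    refine HasCompactSupport.of_support_subset_isCompact (isCompact_closedBall y r') ?_
    intro x hx
    rw [Metric.mem_closedBall, Real.dist_eq]
    exact hφs x hx
  set B : Set ℂ := Metric.ball (y : ℂ) r with hB
  have hBo : IsOpen B := Metric.isOpen_ball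
  have hyB : (y : ℂ) ∈ B := Metric.mem_ball_self hr0
  let g : ℂ → ℂ := Function.update (fun s => (s - y) * f s) y R
  have hgne : ∀ s, s ≠ (y : ℂ) → g s = (s - y) * f s := fun s hs => Function.update_of_ne hs _ _
  have hgy : g y = R := Function.update_self _ _ _
  have hgd : ∀ s ∈ B, s ≠ (y : ℂ) → DifferentiableAt ℂ g s := by
    intro s hs hsy
    have h1 : DifferentiableAt ℂ f s := hf.differentiableAt
      ((hBo.sdiff isClosed_singleton).mem_nhds ⟨hs, hsy⟩)
    have h2 : DifferentiableAt ℂ (fun s => (s - y) * f s) s :=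
      (differentiableAt_id.sub_const _).mul h1
    refine h2.congr_of_eventuallyEq ?_
    filter_upwards [isOpen_ne.mem_nhds hsy] with z hz using hgne z hz
  have hgc : ContinuousAt g y := by
    rw [continuousAt_update_same]; exact hR
  have hga : DifferentiableAt ℂ g y := by
    refine (Complex.analyticAt_of_differentiable_on_punctured_nhds_of_continuousAt ?_
      hgc).differentiableAt
    rw [eventually_nhdsWithin_iff]
    filter_upwards [hBo.mem_nhds hyB] with s hs hsy using hgd s hs hsy
  have hgon : ContinuousOn g B := by
    intro s hs
    by_cases hsy : s = y
    · rw [hsy]; exact hgc.continuousWithinAt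
    · exact (hgd s hs hsy).continuousAt.continuousWithinAt
  let h : ℂ → ℂ := dslope g y
  have hh : ContinuousOn h B := (continuousOn_dslope (hBo.mem_nhds hyB)).2 ⟨hgon, hga⟩
  have hdec : ∀ s, s ≠ (y : ℂ) → f s = R * (1 / (s - y)) + h s := by
    intro s hs
    have hs' : s - y ≠ 0 := sub_ne_zero.2 hs
    simp only [h]
    rw [dslope_of_ne _ hs, slope_def_field, hgne s hs, hgy]
    field_simp
    ring
  have hφc : Continuous fun x => (φ x : ℂ) := Complex.continuous_ofReal.comp hφ
  have hcc : HasCompactSupport fun x => (φ x : ℂ) :=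
    hc.comp_left (g := ((↑) : ℝ → ℂ)) Complex.ofReal_zero
  have hts : ∀ x ∈ tsupport φ, (x : ℂ) ∈ B := by
    intro x hx
    have hcl : IsClosed {x : ℝ | |x - y| ≤ r'} := isClosed_le (by fun_prop) continuous_const
    have h1 : |x - y| ≤ r' := closure_minimal (fun x hx => hφs x hx) hcl hx
    rw [hB, Metric.mem_ball, dist_eq_norm, ← Complex.ofReal_sub, Complex.norm_real]
    exact h1.trans_lt hr
  -- the remainder is continuous across the real axis
  have hrest := tendsto_integral_of_continuousOn hBo hh hφ hc hts
  have hs0 : ∀ (x t : ℝ), t ≠ 0 → (x : ℂ) + (t : ℂ) * Complex.I ≠ y := by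
    intro x t ht e
    have := congrArg Complex.im e
    simp at this
    exact ht this
  have hpole := (tendsto_integral_simple_pole hφ hc y).const_mul R
  have hrem := (hrest 1).2.sub (hrest (-1)).2
  have htot := hpole.add hrem
  rw [sub_self, add_zero] at htot
  rw [show -(2 * Real.pi * Complex.I) * R * φ y = R * (-(2 * Real.pi * Complex.I) * φ y) by ring]
  refine htot.congr' ?_
  filter_upwards [self_mem_nhdsWithin, (hrest 1).1, (hrest (-1)).1] with ε hε i1 i2
  have hε0 : (0 : ℝ) < ε := hε
  have hpint : ∀ t : ℝ, t ≠ 0 → Integrable fun x : ℝ => (φ x : ℂ) *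
      (1 / ((x : ℂ) + (t : ℂ) * Complex.I - y)) := by
    intro t ht
    refine Continuous.integrable_of_hasCompactSupport ?_ hcc.mul_right
    refine hφc.mul (continuous_const.div (by fun_prop) fun x => sub_ne_zero.2 (hs0 x t ht))
  have hne1 : (1 * ε : ℝ) ≠ 0 := by linarith
  have hne2 : (-1 * ε : ℝ) ≠ 0 := by linarith
  have i3 : Integrable fun x : ℝ => R * ((φ x : ℂ) *
      (1 / ((x : ℂ) + ((1 * ε : ℝ) : ℂ) * Complex.I - y) -
        1 / ((x : ℂ) + ((-1 * ε : ℝ) : ℂ) * Complex.I - y))) := by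
    simp only [mul_sub]
    exact ((hpint _ hne1).const_mul R).sub ((hpint _ hne2).const_mul R)
  have i4 := i1.sub i2
  simp only [Pi.sub_def] at i4
  rw [← integral_const_mul, ← integral_sub i1 i2, ← integral_add i3 i4]
  congr 1; funext x
  rw [hdec _ (hs0 x _ hne1), hdec _ (hs0 x _ hne2)]
  ring

namespace SUAmplitude

/-- The spectral densities of all spins, restricted to `s > 0`, as a single measure on pairs
(spin, `s`). -/
noncomputable def spectralMeasure (X : SUAmplitude) : Measure (ℕ × ℝ) :=
  Measure.sum fun j => ((X.ρ j).restrict (Set.Ioi 0)).map (Prod.mk j)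

variable {X : SUAmplitude} {d : ℕ}

theorem spectralMeasure_apply {S : Set (ℕ × ℝ)} (hS : MeasurableSet S) :
    X.spectralMeasure S = ∑' j, X.ρ j ({x | (j, x) ∈ S} ∩ Set.Ioi 0) := by
  rw [spectralMeasure, Measure.sum_apply _ hS]
  refine tsum_congr fun j => ?_
  rw [Measure.map_apply measurable_prodMk_left hS,
    Measure.restrict_apply (measurable_prodMk_left hS)]
  rfl

theorem Bootstrap.spectralMeasure_lt_top (hX : X.Bootstrap d) {K : Set ℝ} (hK : IsCompact K)
    (hK0 : K ⊆ Set.Ioi 0) : X.spectralMeasure (Prod.snd ⁻¹' K) < ⊤ := by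
  rw [spectralMeasure_apply (measurable_snd hK.measurableSet)]
  refine lt_of_le_of_lt ?_ (lt_top_iff_ne_top.2 (hX.density_finite K hK hK0))
  exact ENNReal.tsum_le_tsum fun j => measure_mono Set.inter_subset_left

theorem ae_snd_pos : ∀ᵐ p ∂X.spectralMeasure, 0 < p.2 := by
  rw [ae_iff, spectralMeasure_apply (by measurability)]
  simp only [not_lt, Set.mem_ofPred_eq, ENNReal.tsum_eq_zero]
  intro j
  convert measure_empty (μ := X.ρ j)
  ext x
  simp

/-- Integrals against the spectral measure are sums over the spins. -/
theorem hasSum_integral_spectralMeasure {F : ℕ × ℝ → ℝ} (hF : Integrable F X.spectralMeasure)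
    (hF0 : ∀ j x, x ≤ 0 → F (j, x) = 0) (hFm : Measurable F) :
    HasSum (fun j => ∫ x, F (j, x) ∂X.ρ j) (∫ p, F p ∂X.spectralMeasure) := by
  have h := hasSum_integral_measure hF
  refine h.congr_fun fun j => ?_
  rw [integral_map measurable_prodMk_left.aemeasurable hFm.aestronglyMeasurable]
  refine (setIntegral_eq_integral_of_forall_compl_eq_zero fun x hx => ?_).symm
  exact hF0 j x (not_lt.1 hx)

/-- A function of spin and `s` dominated by a multiple of the indicator of a compact set of
positive `s` is integrable. -/
theorem Bootstrap.integrable_of_bound (hX : X.Bootstrap d) {K : Set ℝ} (hK : IsCompact K)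
    (hK0 : K ⊆ Set.Ioi 0) {F : ℕ × ℝ → ℝ} (hF : Measurable F) {C : ℝ}
    (hb : ∀ j x, |F (j, x)| ≤ C) (hs : ∀ j x, x ∉ K → F (j, x) = 0) :
    Integrable F X.spectralMeasure := by
  have hKm : MeasurableSet (Prod.snd ⁻¹' K : Set (ℕ × ℝ)) := measurable_snd hK.measurableSet
  have h1 : IntegrableOn F (Prod.snd ⁻¹' K) X.spectralMeasure := by
    refine Measure.integrableOn_of_bounded (M := C) (hX.spectralMeasure_lt_top hK hK0).ne
      hF.aestronglyMeasurable (Eventually.of_forall fun p => hb p.1 p.2)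
  exact (integrableOn_iff_integrable_of_support_subset fun p hp => by
    by_contra h
    exact hp (hs p.1 p.2 h)).1 h1

theorem measurable_gegPoly_eval_div (c u : ℝ) :
    Measurable fun p : ℕ × ℝ => (gegPoly c p.1).eval (u / p.2) :=
  measurable_from_prod_countable_right fun j =>
    (Polynomial.continuous (gegPoly c j)).measurable.comp
      (show Measurable fun x : ℝ => u / x from measurable_const.div measurable_id)

theorem Bootstrap.half_le (hd : 3 ≤ d) : (1 : ℝ) / 2 ≤ ((d : ℝ) - 2) / 2 := by
  have : (3 : ℝ) ≤ d := by exact_mod_cast hd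
  linarith

theorem poles_im {s : ℂ} (hs : s ∈ X.poles ∪ X.cut) : s.im = 0 := by
  rcases hs with ⟨n, _, rfl⟩ | hs
  · exact Complex.ofReal_im _
  · exact hs.1

/-- The amplitude is continuous along horizontal lines off the real axis. -/
theorem Bootstrap.continuous_line (hX : X.Bootstrap d) {u : ℝ} (hu : u < 0) {t : ℝ} (ht : t ≠ 0) :
    Continuous fun x : ℝ => X.A ((x : ℂ) + (t : ℂ) * Complex.I) u := by
  refine (hX.analytic u hu).continuousOn.comp_continuous (by fun_prop) fun x hx => ht ?_
  have := poles_im hx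
  simpa using this

/-- The partial wave decomposition as an integral against the spectral measure. The condition on
the support keeps the scattering angle in the half `[0, 1]` of the physical region, where the
Gegenbauer polynomials are bounded by `1`. -/
theorem Bootstrap.discontinuity (hX : X.Bootstrap d) (hd : 3 ≤ d) {u : ℝ} (hu : u < 0)
    {φ : ℝ → ℝ} (hφ : IsTest u φ) (hφs : ∀ x, φ x ≠ 0 → -2 * u ≤ x) {Lp Lm : ℂ}
    (hp : X.HasBoundaryValue 1 u φ Lp) (hm : X.HasBoundaryValue (-1) u φ Lm) :
    Lp - Lm = 2 * Real.pi * Complex.I * ((∫ p : ℕ × ℝ, φ p.2 * p.2 ^ ((4 - (d : ℝ)) / 2) *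
      (gegPoly (((d : ℝ) - 2) / 2) p.1).eval (u / p.2) ∂X.spectralMeasure : ℝ) : ℂ) := by
  obtain ⟨Lp', Lm', hp', hm', hsum⟩ := hX.partial_waves u hu φ hφ
  obtain rfl := tendsto_nhds_unique hp hp'
  obtain rfl := tendsto_nhds_unique hm hm'
  set F : ℕ × ℝ → ℝ := fun p => φ p.2 * p.2 ^ ((4 - (d : ℝ)) / 2) *
      (gegPoly (((d : ℝ) - 2) / 2) p.1).eval (u / p.2) with hF
  have hFm : Measurable F := ((hφ.smooth.continuous.measurable.comp measurable_snd).mul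
    (measurable_snd.pow_const _)).mul (measurable_gegPoly_eval_div _ _)
  have hK0 : tsupport φ ⊆ Set.Ioi 0 := fun x hx => (neg_pos.2 hu).trans (hφ.supp hx)
  have hcont : Continuous fun x => φ x * x ^ ((4 - (d : ℝ)) / 2) := by
    rw [continuous_iff_continuousAt]
    intro x
    by_cases hx : x ∈ tsupport φ
    · exact hφ.smooth.continuous.continuousAt.mul
        (Real.continuousAt_rpow_const _ _ (Or.inl (hK0 hx).ne'))
    · refine continuousAt_const.congr (f := fun _ => (0 : ℝ)) ?_
      filter_upwards [notMem_tsupport_iff_eventuallyEq.1 hx] with z hz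
      simp [hz]
  obtain ⟨C, hC⟩ := (hφ.compact.mul_right (f' := fun x : ℝ =>
    x ^ ((4 - (d : ℝ)) / 2))).exists_bound_of_continuous hcont
  have hFi : Integrable F X.spectralMeasure := by
    refine hX.integrable_of_bound (C := C) hφ.compact hK0 hFm (fun j x => ?_) fun j x hx => ?_
    · by_cases hx : φ x = 0
      · simpa [hF, hx] using (norm_nonneg _).trans (hC x)
      · have hx2 := hφs x hx
        have hx0 : 0 < x := by linarith
        simp only [hF]
        rw [abs_mul]
        have h1 : |(gegPoly (((d : ℝ) - 2) / 2) j).eval (u / x)| ≤ 1 := by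
          refine abs_gegPoly_eval_le (Bootstrap.half_le hd) j ?_ ?_
          · rw [le_div_iff₀ hx0]; linarith
          · exact div_nonpos_of_nonpos_of_nonneg hu.le hx0.le
        calc _ ≤ C * 1 := mul_le_mul (hC x) h1 (abs_nonneg _) ((norm_nonneg _).trans (hC x))
          _ = C := mul_one C
    · simp [hF, image_eq_zero_of_notMem_tsupport hx]
  have h1 := hasSum_integral_spectralMeasure hFi (fun j x hx => by
    have : φ x = 0 := hφ.eq_zero (hx.trans (neg_pos.2 hu).le)
    simp [hF, this]) hFm
  have h2 : HasSum (fun j : ℕ => ((Real.pi * ∫ x : ℝ, φ x * x ^ ((4 - (d : ℝ)) / 2) *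
        gegenbauerP d j (1 + 2 * u / x) ∂(X.ρ j) : ℝ) : ℂ))
      ((Real.pi * ∫ p, F p ∂X.spectralMeasure : ℝ) : ℂ) := by
    rw [Complex.hasSum_ofReal]
    refine (h1.mul_left Real.pi).congr_fun fun j => ?_
    congr 2
    funext x
    rw [gegenbauerP_eq_eval]
    simp only [hF]
    congr 2
    ring
  have h3 := hsum.unique h2
  rw [div_eq_iff (by simp)] at h3
  rw [h3]
  push_cast
  ring

end SUAmplitude

/-! ### The spectral measure below the cut-off -/

namespace SUAmplitude

variable {X : SUAmplitude} {d : ℕ}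

theorem Bootstrap.mass_nonneg (hX : X.Bootstrap d) {n : ℕ} (hn : X.IsLevel n) : 0 ≤ X.m n := by
  rcases Nat.eq_zero_or_pos n with rfl | h
  · exact hX.mass_zero.ge
  · have := hX.mass_lt 0 n h hn
    rw [hX.mass_zero] at this
    exact this.le

theorem Bootstrap.mass_pos (hX : X.Bootstrap d) {n : ℕ} (h1 : 1 ≤ n) (hn : X.IsLevel n) :
    0 < X.m n := by
  have := hX.mass_lt 0 n h1 hn
  rwa [hX.mass_zero] at this

theorem isLevel_mono {n p : ℕ} (h : n ≤ p) (hp : X.IsLevel p) : X.IsLevel n :=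
  lt_of_le_of_lt (by exact_mod_cast h) hp

theorem Bootstrap.finite_levels_le (hX : X.Bootstrap d) {z : ℝ} (hz : ENNReal.ofReal z < X.Λ) :
    {n | X.IsLevel n ∧ X.m n ≤ z}.Finite := by
  by_cases hN : X.N = ⊤
  · have h1 := (hX.mass_tendsto hN).eventually (Ioi_mem_nhds hz)
    obtain ⟨n0, hn0⟩ := eventually_atTop.1 h1
    refine (Set.finite_lt_nat n0).subset fun n hn => ?_
    by_contra h
    have h2 := hn0 n (not_lt.1 h)
    exact absurd (ENNReal.ofReal_le_ofReal hn.2) (not_le.2 h2)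
  · obtain ⟨N, hN'⟩ := ENat.ne_top_iff_exists.1 hN
    refine (Set.finite_lt_nat N).subset fun n hn => ?_
    have h2 := hn.1
    rw [IsLevel, ← hN'] at h2
    exact_mod_cast h2

/-- The singularities below the cut-off are isolated. -/
theorem Bootstrap.eventually_regular (hX : X.Bootstrap d) {y : ℝ}
    (hyΛ : ENNReal.ofReal y < X.Λ ^ 2) :
    ∀ᶠ s in 𝓝[≠] (y : ℂ), s ∉ X.poles ∪ X.cut := by
  have h1 : ENNReal.ofReal (√y) < X.Λ := by
    refine lt_of_pow_lt_pow_left' 2 ?_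
    rwa [← ENNReal.ofReal_pow (Real.sqrt_nonneg y), Real.sq_sqrt', ENNReal.ofReal_max,
      ENNReal.ofReal_zero, max_eq_left zero_le]
  obtain ⟨z, hz1, hz2⟩ := ENNReal.lt_iff_exists_nnreal_btwn.1 h1
  rw [← ENNReal.ofReal_coe_nnreal] at hz1 hz2
  have hz1' : √y < z := (ENNReal.ofReal_lt_ofReal_iff' .. |>.1 hz1).1
  have hyz : y < (z : ℝ) ^ 2 := Real.lt_sq_of_sqrt_lt hz1'
  have hfin := hX.finite_levels_le hz2
  have hfin2 : (((fun n => ((X.m n ^ 2 : ℝ) : ℂ)) '' {n | X.IsLevel n ∧ X.m n ≤ z}) \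
      {(y : ℂ)}).Finite := (hfin.image _).sdiff
  have hn1 := hfin2.isClosed.isOpen_compl.mem_nhds (x := (y : ℂ)) (fun h => h.2 rfl)
  have hn2 : {s : ℂ | s.re < (z : ℝ) ^ 2} ∈ 𝓝 (y : ℂ) :=
    (isOpen_lt Complex.continuous_re continuous_const).mem_nhds (by simpa using hyz)
  rw [eventually_nhdsWithin_iff]
  filter_upwards [hn1, hn2] with s hs1 hs2 hsy hs
  rcases hs with ⟨n, hn, hsn⟩ | hs
  · refine hs1 ⟨⟨n, ⟨hn, ?_⟩, hsn.symm⟩, hsy⟩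
    rw [hsn] at hs2
    have hs3 : X.m n ^ 2 < (z : ℝ) ^ 2 := hs2
    exact (abs_le_of_sq_le_sq' hs3.le z.2).2
  · have h3 : ENNReal.ofReal s.re ≤ ENNReal.ofReal ((z : ℝ) ^ 2) :=
      ENNReal.ofReal_le_ofReal (le_of_lt hs2)
    have h4 := hs.2.trans h3
    rw [ENNReal.ofReal_pow z.coe_nonneg] at h4
    exact absurd h4 (not_le.2 (ENNReal.pow_right_strictMono two_ne_zero hz2))

/-- Near a point `y` below the cut-off the spectral measure is read off from the residue at `y`. -/
theorem Bootstrap.exists_pairing_eq (hX : X.Bootstrap d) (hd : 3 ≤ d) {y : ℝ} (hy : 0 < y)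
    (hyΛ : ENNReal.ofReal y < X.Λ ^ 2) {R : ℝ → ℝ}
    (hR : ∀ u : ℝ, u < 0 → Tendsto (fun s : ℂ => (s - (y : ℂ)) * X.A s (u : ℂ)) (𝓝[≠] (y : ℂ))
      (𝓝 ((R u : ℝ) : ℂ))) :
    ∃ r : ℝ, 0 < r ∧ r < y / 2 ∧ ∀ φ : ℝ → ℝ, ContDiff ℝ ∞ φ → (∀ x, φ x ≠ 0 → |x - y| ≤ r) →
      ∀ u : ℝ, -(y / 4) < u → u < 0 → ∫ p : ℕ × ℝ, φ p.2 * p.2 ^ ((4 - (d : ℝ)) / 2) *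
        (gegPoly (((d : ℝ) - 2) / 2) p.1).eval (u / p.2) ∂X.spectralMeasure = -(R u * φ y) := by
  obtain ⟨r0, hr0, hball⟩ := Metric.mem_nhdsWithin_iff.1 (hX.eventually_regular hyΛ)
  refine ⟨min (r0 / 2) (y / 4), by positivity, (min_le_right _ _).trans_lt (by linarith), ?_⟩
  intro φ hφ hφs u hu1 hu
  have hφy : ∀ x, φ x ≠ 0 → |x - y| ≤ y / 4 := fun x hx => (hφs x hx).trans (min_le_right _ _)
  have hts : tsupport φ ⊆ {x | |x - y| ≤ y / 4} :=
    closure_minimal (fun x hx => hφy x hx) (isClosed_le (by fun_prop) continuous_const)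
  have htest : IsTest u φ := by
    refine ⟨hφ, ?_, ?_⟩
    · refine HasCompactSupport.of_support_subset_isCompact (isCompact_closedBall y (y / 4)) ?_
      intro x hx
      rw [Metric.mem_closedBall, Real.dist_eq]
      exact hφy x hx
    · intro x hx
      have h1 : |x - y| ≤ y / 4 := hts hx
      have := (abs_le.1 h1).1
      change -u < x
      linarith
  have hφ2 : ∀ x, φ x ≠ 0 → -2 * u ≤ x := by
    intro x hx
    have := (abs_le.1 (hφy x hx)).1
    linarith
  obtain ⟨Lp, Lm, hp, hm, -⟩ := hX.partial_waves u hu φ htest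
  have hdisc := hX.discontinuity hd hu htest hφ2 hp hm
  have hdiff : DifferentiableOn ℂ (fun s => X.A s u) (Metric.ball (y : ℂ) r0 \ {(y : ℂ)}) :=
    (hX.analytic u hu).mono fun s hs => hball ⟨hs.1, hs.2⟩
  have hlim := tendsto_integral_discontinuity_of_residue
    (lt_of_le_of_lt (min_le_left _ _) (by linarith : r0 / 2 < r0)) hr0 hdiff (hR u hu)
    hφ.continuous hφs
  have hlim2 := hp.sub hm
  have heq := tendsto_nhds_unique (hlim2.congr' ?_) hlim
  · rw [heq] at hdisc
    have h2 : (2 * Real.pi * Complex.I : ℂ) ≠ 0 := by simp [Real.pi_ne_zero]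
    have h3 : (2 * Real.pi * Complex.I : ℂ) * (-((R u : ℂ) * φ y)) =
        2 * Real.pi * Complex.I * ((∫ p : ℕ × ℝ, φ p.2 * p.2 ^ ((4 - (d : ℝ)) / 2) *
      (gegPoly (((d : ℝ) - 2) / 2) p.1).eval (u / p.2) ∂X.spectralMeasure : ℝ) : ℂ) := by
      rw [← hdisc]; ring
    have h4 := mul_left_cancel₀ h2 h3
    exact_mod_cast h4.symm
  · filter_upwards [self_mem_nhdsWithin] with ε hε
    have hε0 : (0 : ℝ) < ε := hε
    have hint : ∀ t : ℝ, t ≠ 0 → Integrable fun x : ℝ => (φ x : ℂ) *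
        X.A ((x : ℂ) + (t : ℂ) * Complex.I) u := by
      intro t ht
      refine ((Complex.continuous_ofReal.comp hφ.continuous).mul
        (hX.continuous_line hu ht)).integrable_of_hasCompactSupport ?_
      exact (htest.compact.comp_left (g := ((↑) : ℝ → ℂ)) Complex.ofReal_zero).mul_right
    rw [← integral_sub (hint _ (by linarith)) (hint _ (by linarith))]
    simp only [mul_sub]

theorem Bootstrap.tendsto_of_notMem (hX : X.Bootstrap d) {y : ℝ}
    (hyΛ : ENNReal.ofReal y < X.Λ ^ 2) (hyp : (y : ℂ) ∉ X.poles) {u : ℝ} (hu : u < 0) :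
    Tendsto (fun s : ℂ => (s - (y : ℂ)) * X.A s (u : ℂ)) (𝓝[≠] (y : ℂ))
      (𝓝 (((0 : ℝ) : ℝ) : ℂ)) := by
  have hyc : (y : ℂ) ∉ X.poles ∪ X.cut := by
    rintro (h | h)
    · exact hyp h
    · exact absurd h.2 (not_le.2 (by simpa using hyΛ))
  have hn : (X.poles ∪ X.cut)ᶜ ∈ 𝓝 (y : ℂ) := by
    have := eventually_nhdsWithin_iff.1 (hX.eventually_regular hyΛ)
    filter_upwards [this] with s hs
    by_cases h : s = y
    · rw [h]; exact hyc
    · exact hs h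
  have h1 := ((hX.analytic u hu).differentiableAt hn).continuousAt.tendsto
  have h2 : Tendsto (fun s : ℂ => s - (y : ℂ)) (𝓝 (y : ℂ)) (𝓝 0) := by
    have : Continuous fun s : ℂ => s - (y : ℂ) := by fun_prop
    simpa using this.tendsto (y : ℂ)
  have := (h2.mul h1).mono_left (nhdsWithin_le_nhds (s := {(y : ℂ)}ᶜ))
  simpa using this

/-- The spectral measure has no mass near a regular point `y` below the cut-off: in the forward
limit `u → 0⁻` the pairing with a bump at `y` becomes an integral of a non-negative function. -/
theorem Bootstrap.exists_null_ball (hX : X.Bootstrap d) (hd : 3 ≤ d) {y : ℝ} (hy : 0 < y)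
    (hyΛ : ENNReal.ofReal y < X.Λ ^ 2) (hyp : (y : ℂ) ∉ X.poles) :
    ∃ r : ℝ, 0 < r ∧ X.spectralMeasure (Prod.snd ⁻¹' Metric.ball y r) = 0 := by
  obtain ⟨r, hr, hry, hpair⟩ := hX.exists_pairing_eq hd hy hyΛ (R := fun _ => 0)
    fun u hu => hX.tendsto_of_notMem hyΛ hyp hu
  refine ⟨r, hr, ?_⟩
  have hc := Bootstrap.half_le hd
  let b : ContDiffBump y := ⟨r / 2, r, by linarith, by linarith⟩
  have hbr : ∀ x, b x ≠ 0 → |x - y| ≤ r := by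
    intro x hx
    have : x ∈ Function.support b := hx
    rw [b.support_eq, Metric.mem_ball, Real.dist_eq] at this
    exact this.le
  set κ : ℝ → ℝ := fun x => x ^ ((4 - (d : ℝ)) / 2) with hκ
  have hzero := hpair b b.contDiff hbr
  simp only [zero_mul, neg_zero] at hzero
  have hK : IsCompact (Metric.closedBall y r) := isCompact_closedBall y r
  have hK0 : Metric.closedBall y r ⊆ Set.Ioi 0 := by
    intro x hx
    rw [Metric.mem_closedBall, Real.dist_eq] at hx
    have := (abs_le.1 hx).1
    change 0 < x
    linarith
  have hκc : ContinuousOn κ (Metric.closedBall y r) := fun x hx =>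
    (Real.continuousAt_rpow_const _ _ (Or.inl (hK0 hx).ne')).continuousWithinAt
  obtain ⟨C, hC⟩ := hK.exists_bound_of_continuousOn hκc
  have hC0 : 0 ≤ C := (norm_nonneg _).trans (hC y (Metric.mem_closedBall_self hr.le))
  have hmem : ∀ x, b x ≠ 0 → x ∈ Metric.closedBall y r := fun x hx => by
    rw [Metric.mem_closedBall, Real.dist_eq]; exact hbr x hx
  have hbm : Measurable fun p : ℕ × ℝ => b p.2 * κ p.2 :=
    (b.continuous.measurable.comp measurable_snd).mul (measurable_snd.pow_const _)
  have hb1 : ∀ x, |b x * κ x| ≤ C := by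
    intro x
    by_cases hx : b x = 0
    · simpa [hx] using hC0
    · rw [abs_mul, abs_of_nonneg b.nonneg]
      calc _ ≤ 1 * C := mul_le_mul b.le_one (hC x (hmem x hx)) (abs_nonneg _) zero_le_one
        _ = C := one_mul C
  have hi : Integrable (fun p : ℕ × ℝ => b p.2 * κ p.2) X.spectralMeasure :=
    hX.integrable_of_bound (C := C) hK hK0 hbm (fun j x => hb1 x) fun j x hx => by
      have : b x = 0 := by
        by_contra h; exact hx (hmem x h)
      simp [this]
  -- in the forward limit every Gegenbauer polynomial tends to `1`
  have hlim : Tendsto (fun u : ℝ => ∫ p : ℕ × ℝ, b p.2 * κ p.2 *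
      (gegPoly (((d : ℝ) - 2) / 2) p.1).eval (u / p.2) ∂X.spectralMeasure) (𝓝[<] 0)
      (𝓝 (∫ p : ℕ × ℝ, b p.2 * κ p.2 ∂X.spectralMeasure)) := by
    refine tendsto_integral_filter_of_dominated_convergence (fun p => |b p.2 * κ p.2|)
      (Eventually.of_forall fun u =>
        (hbm.mul (measurable_gegPoly_eval_div _ u)).aestronglyMeasurable) ?_ hi.abs ?_
    · have hev : ∀ᶠ u in 𝓝[<] (0 : ℝ), -(y / 4) < u ∧ u < 0 :=
        Ioo_mem_nhdsLT (by linarith : -(y / 4) < 0)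
      filter_upwards [hev] with u hu
      refine Eventually.of_forall fun p => ?_
      by_cases hx : b p.2 = 0
      · simp [hx]
      · have hx1 := (abs_le.1 (hbr _ hx)).1
        have hx0 : 0 < p.2 := hK0 (hmem _ hx)
        rw [norm_mul, Real.norm_eq_abs, Real.norm_eq_abs]
        refine mul_le_of_le_one_right (abs_nonneg _) (abs_gegPoly_eval_le hc _ ?_ ?_)
        · rw [le_div_iff₀ hx0]; linarith [hu.1]
        · exact div_nonpos_of_nonpos_of_nonneg hu.2.le hx0.le
    · refine Eventually.of_forall fun p => ?_
      have h1 : Continuous fun u : ℝ => b p.2 * κ p.2 *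
          (gegPoly (((d : ℝ) - 2) / 2) p.1).eval (u / p.2) :=
        continuous_const.mul ((Polynomial.continuous _).comp (by fun_prop))
      have := (h1.tendsto 0).mono_left (nhdsWithin_le_nhds (s := Set.Iio 0))
      simpa [gegPoly_eval_zero] using this
  have hval : ∫ p : ℕ × ℝ, b p.2 * κ p.2 ∂X.spectralMeasure = 0 := by
    refine tendsto_nhds_unique hlim (tendsto_const_nhds.congr' ?_)
    have hev : ∀ᶠ u in 𝓝[<] (0 : ℝ), -(y / 4) < u ∧ u < 0 :=
      Ioo_mem_nhdsLT (by linarith : -(y / 4) < 0)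
    filter_upwards [hev] with u hu using (hzero u hu.1 hu.2).symm
  have hnn : 0 ≤ᵐ[X.spectralMeasure] fun p : ℕ × ℝ => b p.2 * κ p.2 := by
    filter_upwards [ae_snd_pos] with p hp
    exact mul_nonneg b.nonneg (Real.rpow_nonneg hp.le _)
  have hae := (integral_eq_zero_iff_of_nonneg_ae hnn hi).1 hval
  refine measure_mono_null ?_ (ae_iff.1 (hae.and ae_snd_pos))
  intro p hp hcontra
  have hbp : 0 < b p.2 := b.pos_of_mem_ball hp
  have := Real.rpow_pos_of_pos hcontra.2 ((4 - (d : ℝ)) / 2)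
  exact (mul_pos hbp this).ne' hcontra.1

/-- Below the cut-off, the spectral measure lives on the poles. -/
theorem Bootstrap.null_below_cutoff (hX : X.Bootstrap d) (hd : 3 ≤ d) :
    X.spectralMeasure (Prod.snd ⁻¹' {y : ℝ | ENNReal.ofReal y < X.Λ ^ 2 ∧
      (y : ℂ) ∉ X.poles}) = 0 := by
  have hpos : X.spectralMeasure (Prod.snd ⁻¹' Set.Iic 0) = 0 := by
    refine measure_mono_null ?_ (ae_iff.1 (ae_snd_pos (X := X)))
    intro p hp
    exact not_lt.2 hp
  have hopen : X.spectralMeasure (Prod.snd ⁻¹' {y : ℝ | 0 < y ∧ ENNReal.ofReal y < X.Λ ^ 2 ∧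
      (y : ℂ) ∉ X.poles}) = 0 := by
    have hle : ∀ S : Set ℝ, X.spectralMeasure (Prod.snd ⁻¹' S) ≤
        X.spectralMeasure.map Prod.snd S := fun S =>
      Measure.le_map_apply measurable_snd.aemeasurable S
    refine le_antisymm ((hle _).trans (le_of_eq ?_)) zero_le
    refine measure_null_of_locally_null _ fun y hy => ?_
    obtain ⟨r, hr, hnull⟩ := hX.exists_null_ball hd hy.1 hy.2.1 hy.2.2
    refine ⟨Metric.ball y r, mem_nhdsWithin_of_mem_nhds (Metric.ball_mem_nhds y hr), ?_⟩
    rwa [Measure.map_apply measurable_snd measurableSet_ball]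
  have : Prod.snd ⁻¹' {y : ℝ | ENNReal.ofReal y < X.Λ ^ 2 ∧ (y : ℂ) ∉ X.poles} ⊆
      (Prod.snd ⁻¹' Set.Iic 0 : Set (ℕ × ℝ)) ∪ Prod.snd ⁻¹' {y : ℝ | 0 < y ∧
        ENNReal.ofReal y < X.Λ ^ 2 ∧ (y : ℂ) ∉ X.poles} := by
    intro p hp
    rcases le_or_gt p.2 0 with h | h
    · exact Or.inl h
    · exact Or.inr ⟨h, hp⟩
  exact measure_mono_null this (measure_union_null hpos hopen)

end SUAmplitude

/-! ### The spins at the mass levels -/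

namespace SUAmplitude

variable {X : SUAmplitude} {d : ℕ}

theorem Bootstrap.sq_mass_lt (hX : X.Bootstrap d) {n : ℕ} (hn : X.IsLevel n) :
    ENNReal.ofReal (X.m n ^ 2) < X.Λ ^ 2 := by
  rw [ENNReal.ofReal_pow (hX.mass_nonneg hn)]
  exact ENNReal.pow_right_strictMono two_ne_zero (hX.mass_lt_cutoff n hn)

/-- The spin content of the spectral measure at the mass level `n`, tested against the Taylor
coefficients of the Gegenbauer polynomials, is the one of the residue. -/
theorem Bootstrap.integral_gegCoeff_pole (hX : X.Bootstrap d) (hd : 3 ≤ d) {n : ℕ} (h1 : 1 ≤ n)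
    (hn : X.IsLevel n) (q : ℕ) :
    Integrable (fun p : ℕ × ℝ => gegCoeff (((d : ℝ) - 2) / 2) p.1 q)
        (X.spectralMeasure.restrict (Prod.snd ⁻¹' {X.m n ^ 2})) ∧
      ∫ p in Prod.snd ⁻¹' {X.m n ^ 2}, gegCoeff (((d : ℝ) - 2) / 2) p.1 q ∂X.spectralMeasure =
        ((X.m n ^ 2) ^ ((4 - (d : ℝ)) / 2))⁻¹ * (X.m n ^ (6 - (d : ℤ)) *
          ∑ j ∈ Finset.range (X.J n + 1).toNat,
            X.gSq n j * gegCoeff (((d : ℝ) - 2) / 2) j q) := by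
  set c : ℝ := ((d : ℝ) - 2) / 2 with hcdef
  have hc : 1 / 2 ≤ c := Bootstrap.half_le hd
  set y : ℝ := X.m n ^ 2 with hydef
  have hm := hX.mass_pos h1 hn
  have hy : 0 < y := by positivity
  have hyΛ := hX.sq_mass_lt hn
  rw [← hydef] at hyΛ
  set κ : ℝ → ℝ := fun x => x ^ ((4 - (d : ℝ)) / 2) with hκ
  have hκy : 0 < κ y := Real.rpow_pos_of_pos hy _
  set R : ℝ → ℝ := fun u => -(X.m n ^ (6 - (d : ℤ)) * ∑ j ∈ Finset.range (X.J n + 1).toNat,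
        X.gSq n j * gegenbauerP d j (1 + 2 * u / y)) with hRdef
  have hR := hX.residue_massive n h1 hn
  obtain ⟨r, hr, hry, hpair⟩ := hX.exists_pairing_eq hd hy hyΛ (R := R) hR
  obtain ⟨r1, hr1, hball⟩ := Metric.mem_nhdsWithin_iff.1 (hX.eventually_regular hyΛ)
  set r2 := min r (r1 / 2) with hr2
  have hr20 : 0 < r2 := lt_min hr (by linarith)
  let b : ContDiffBump y := ⟨r2 / 2, r2, by linarith, by linarith⟩
  have hbs : ∀ x, b x ≠ 0 → |x - y| < r2 := by
    intro x hx
    have : x ∈ Function.support b := hx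
    rw [b.support_eq, Metric.mem_ball, Real.dist_eq] at this
    exact this
  have hby : b y = 1 := b.one_of_mem_closedBall (Metric.mem_closedBall_self (by
    change 0 ≤ r2 / 2; linarith))
  have hpb := hpair b b.contDiff fun x hx => (hbs x hx).le.trans (min_le_left _ _)
  have hS : MeasurableSet (Prod.snd ⁻¹' {y} : Set (ℕ × ℝ)) :=
    measurable_snd (measurableSet_singleton y)
  set ν := X.spectralMeasure.restrict (Prod.snd ⁻¹' {y}) with hν
  have hfin : IsFiniteMeasure ν := ⟨by
    rw [hν, Measure.restrict_apply_univ]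
    exact hX.spectralMeasure_lt_top isCompact_singleton (Set.singleton_subset_iff.2 hy)⟩
  -- only the pole itself contributes to the pairing with a narrow bump
  have hval : ∀ u : ℝ, -(y / 4) < u → u < 0 →
      κ y * ∫ p, (gegPoly c p.1).eval (u / y) ∂ν = -R u := by
    intro u hu1 hu
    rw [← integral_const_mul, hν, ← integral_indicator hS]
    have h2 := hpb u hu1 hu
    rw [hby, mul_one] at h2
    rw [← h2]
    refine integral_congr_ae ?_
    have hnull := hX.null_below_cutoff hd
    filter_upwards [measure_eq_zero_iff_ae_notMem.1 hnull] with p hp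
    by_cases hpy : p.2 = y
    · rw [Set.indicator_of_mem (by simpa using hpy), hpy, hby, one_mul]
    · rw [Set.indicator_of_notMem (by simpa using hpy)]
      have : b p.2 = 0 := by
        by_contra hb
        refine hp ?_
        have h3 := (hbs _ hb).trans_le (min_le_right r (r1 / 2))
        have h4 : (p.2 : ℂ) ∉ X.poles ∪ X.cut := by
          refine hball ⟨?_, fun h => hpy (by simpa using h)⟩
          rw [Metric.mem_ball, dist_eq_norm, ← Complex.ofReal_sub, Complex.norm_real,
            Real.norm_eq_abs]
          linarith
        refine ⟨?_, fun h => h4 (Or.inl h)⟩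
        by_contra h5
        exact h4 (Or.inr ⟨Complex.ofReal_im _, by simpa using h5⟩)
      simp [this]
  set G : ℕ → ℝ := fun j => (κ y)⁻¹ * (X.m n ^ (6 - (d : ℤ)) * X.gSq n j) with hG
  set e : ℕ → ℝ := fun q => ∑ j ∈ Finset.range (X.J n + 1).toNat, G j * gegCoeff c j q with he
  have hmeas : ∀ q t, AEStronglyMeasurable
      (fun p : ℕ × ℝ => (Polynomial.derivative^[q] (gegPoly c p.1)).eval t) ν := fun q t =>
    (measurable_from_prod_countable_right fun j => show Measurable fun _ : ℝ =>
      (Polynomial.derivative^[q] (gegPoly c j)).eval t from measurable_const).aestronglyMeasurable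
  have he0 : ∀ q, (X.J n + 1).toNat ≤ q → e q = 0 := by
    intro q hq
    refine Finset.sum_eq_zero fun j hj => ?_
    rw [gegCoeff_eq_zero c ((Finset.mem_range.1 hj).trans_le hq), mul_zero]
  -- comparison of the Taylor coefficients in `t = u / y`; the residue is a polynomial in `t`
  have key := integral_coeff_of_hasSum (ν := ν) (p := fun p : ℕ × ℝ => gegPoly c p.1)
    (δ := 1 / 4) (by norm_num) hmeas
    (Eventually.of_forall fun p q t ht1 ht2 =>
      abs_iterate_derivative_gegPoly_le q hc p.1 (by linarith) ht2)
    (by simp only [gegPoly_eval_zero]; exact integrable_const 1) (e := e)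
    (summable_of_ne_finset_zero (s := Finset.range (X.J n + 1).toNat) fun q hq => by
      rw [he0 q (by simpa using hq)]; simp)
    (fun t ht1 ht2 => by
      have hv := hval (t * y) (by nlinarith) (by nlinarith)
      rw [mul_div_cancel_right₀ _ hy.ne'] at hv
      rw [tsum_eq_sum (s := Finset.range (X.J n + 1).toNat)
        fun q hq => by rw [he0 q (by simpa using hq)]; simp]
      have h5 : ∀ j ∈ Finset.range (X.J n + 1).toNat, gegenbauerP d j (1 + 2 * (t * y) / y) =
          ∑ q ∈ Finset.range (X.J n + 1).toNat, gegCoeff c j q * t ^ q := by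
        intro j hj
        rw [gegenbauerP_eq_eval]
        have : (1 + 2 * (t * y) / y - 1) / 2 = t := by field_simp; ring
        rw [this, Polynomial.eval_eq_sum_range' (n := (X.J n + 1).toNat)]
        · simp only [coeff_gegPoly, hcdef]
        · refine lt_of_le_of_lt (Polynomial.natDegree_le_iff_coeff_eq_zero.2 fun q hq => ?_)
            (Finset.mem_range.1 hj)
          rw [coeff_gegPoly]
          exact gegCoeff_eq_zero _ hq
      have h6 : ∫ p, (gegPoly c p.1).eval t ∂ν = (κ y)⁻¹ * -R (t * y) := by
        rw [← hv]; field_simp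
      rw [h6]
      simp only [hRdef, neg_neg, he, hG, Finset.mul_sum, Finset.sum_mul]
      rw [Finset.sum_comm]
      refine Finset.sum_congr rfl fun j hj => ?_
      rw [h5 j hj, Finset.mul_sum, Finset.mul_sum, Finset.mul_sum]
      exact Finset.sum_congr rfl fun q _ => by ring) q
  simp only [coeff_gegPoly] at key
  refine ⟨key.1, ?_⟩
  rw [key.2]
  simp only [he, hG, Finset.mul_sum]
  exact Finset.sum_congr rfl fun j _ => by ring

/-- No spin above `J n` occurs in the spectral measure at the mass level `n`. -/
theorem Bootstrap.ae_spin_le (hX : X.Bootstrap d) (hd : 3 ≤ d) {n : ℕ} (h1 : 1 ≤ n)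
    (hn : X.IsLevel n) :
    ∀ᵐ p ∂X.spectralMeasure, p.2 = X.m n ^ 2 → (p.1 : ℤ) ≤ X.J n := by
  have hc := Bootstrap.half_le hd
  have hJ := hX.spin_massive n h1 hn
  obtain ⟨hi, hv⟩ := hX.integral_gegCoeff_pole hd h1 hn (X.J n + 1).toNat
  rw [Finset.sum_eq_zero fun j hj => by
    rw [gegCoeff_eq_zero _ (Finset.mem_range.1 hj), mul_zero], mul_zero, mul_zero] at hv
  have h2 := (integral_eq_zero_iff_of_nonneg (fun p => gegCoeff_nonneg hc _ _) hi).1 hv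
  have hS : MeasurableSet (Prod.snd ⁻¹' {X.m n ^ 2} : Set (ℕ × ℝ)) :=
    measurable_snd (measurableSet_singleton _)
  filter_upwards [(ae_restrict_iff' hS).1 h2] with p hp hpy
  by_contra hlt
  refine (gegCoeff_pos hc ?_).ne' (hp hpy)
  omega

/-- The top spin `J n` does occur in the spectral measure at the mass level `n`. -/
theorem Bootstrap.spectralMeasure_top_ne_zero (hX : X.Bootstrap d) (hd : 3 ≤ d) {n : ℕ}
    (h1 : 1 ≤ n) (hn : X.IsLevel n) :
    X.spectralMeasure {((X.J n).toNat, X.m n ^ 2)} ≠ 0 := by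
  intro h0
  have hJ := hX.spin_massive n h1 hn
  obtain ⟨hi, hv⟩ := hX.integral_gegCoeff_pole hd h1 hn (X.J n).toNat
  have hm := hX.mass_pos h1 hn
  have hS : MeasurableSet (Prod.snd ⁻¹' {X.m n ^ 2} : Set (ℕ × ℝ)) :=
    measurable_snd (measurableSet_singleton _)
  have hz : ∫ p in Prod.snd ⁻¹' {X.m n ^ 2}, gegCoeff (((d : ℝ) - 2) / 2) p.1 (X.J n).toNat
      ∂X.spectralMeasure = 0 := by
    refine integral_eq_zero_of_ae ?_
    rw [Filter.EventuallyEq, ae_restrict_iff' hS]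
    filter_upwards [hX.ae_spin_le hd h1 hn, measure_eq_zero_iff_ae_notMem.1 h0] with p hp hp0 hpy
    have h3 := hp hpy
    refine gegCoeff_eq_zero _ ?_
    have h4 : p.1 ≠ (X.J n).toNat := by
      intro h
      exact hp0 (Prod.ext h hpy)
    omega
  rw [hz] at hv
  have hR : (X.J n + 1).toNat = (X.J n).toNat + 1 := by omega
  rw [hR, Finset.sum_range_succ, Finset.sum_eq_zero fun j hj => by
    rw [gegCoeff_eq_zero _ (Finset.mem_range.1 hj), mul_zero], zero_add] at hv
  have hpos := gegCoeff_pos (Bootstrap.half_le hd) (le_refl (X.J n).toNat)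
  have hg := hX.top_massive n h1 hn
  have hk : ((X.m n ^ 2) ^ ((4 - (d : ℝ)) / 2))⁻¹ ≠ 0 :=
    inv_ne_zero (Real.rpow_pos_of_pos (by positivity) _).ne'
  have hz2 : X.m n ^ (6 - (d : ℤ)) ≠ 0 := zpow_ne_zero _ hm.ne'
  exact mul_ne_zero hk (mul_ne_zero hz2 (mul_ne_zero hg hpos.ne')) hv.symm

end SUAmplitude

/-! ### Dispersion relations at fixed `u` -/

/-- A smooth function that vanishes for `x ≤ x₁ / 2` and equals `1` for `x ≥ 3 x₁ / 4`. -/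
noncomputable def leftCut (x₁ x : ℝ) : ℝ := Real.smoothTransition (4 * x / x₁ - 2)

theorem contDiff_leftCut (x₁ : ℝ) : ContDiff ℝ ∞ (leftCut x₁) :=
  Real.smoothTransition.contDiff.comp (by fun_prop)

theorem leftCut_eq_zero {x₁ x : ℝ} (h : 0 < x₁) (hx : x ≤ x₁ / 2) : leftCut x₁ x = 0 := by
  refine Real.smoothTransition.zero_of_nonpos ?_
  rw [sub_nonpos, div_le_iff₀ h]; linarith

theorem leftCut_eq_one {x₁ x : ℝ} (h : 0 < x₁) (hx : 3 * x₁ / 4 ≤ x) : leftCut x₁ x = 1 := by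
  refine Real.smoothTransition.one_of_one_le ?_
  have : 3 ≤ 4 * x / x₁ := by rw [le_div_iff₀ h]; linarith
  linarith

theorem leftCut_nonneg (x₁ x : ℝ) : 0 ≤ leftCut x₁ x := Real.smoothTransition.nonneg _

theorem leftCut_le_one (x₁ x : ℝ) : leftCut x₁ x ≤ 1 := Real.smoothTransition.le_one _

theorem isClosed_posAxis : IsClosed SUAmplitude.posAxis :=
  (isClosed_eq Complex.continuous_im continuous_const).inter
    (isClosed_le continuous_const Complex.continuous_re)

theorem add_mul_I_ne_zero (x : ℝ) {t : ℝ} (ht : t ≠ 0) : (x : ℂ) + (t : ℂ) * Complex.I ≠ 0 := by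
  intro h
  have := congrArg Complex.im h
  simp at this
  exact ht this

theorem add_mul_I_notMem_posAxis (x : ℝ) {t : ℝ} (ht : t ≠ 0) :
    (x : ℂ) + (t : ℂ) * Complex.I ∉ SUAmplitude.posAxis := by
  intro h
  have := h.1
  simp at this
  exact ht this

theorem continuousOn_tsum_mul_pow {c : ℕ → ℂ} {r : ℝ}
    (hc : ∀ s : ℂ, s ≠ 0 → ‖s‖ < r → Summable fun k => c k * s ^ k) :
    ContinuousOn (fun s : ℂ => ∑' k, c k * s ^ k) (Metric.ball 0 r) := by
  intro s hs
  rw [mem_ball_zero_iff] at hs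
  obtain ⟨t, ht1, ht2⟩ := exists_between hs
  have ht0 : 0 < t := (norm_nonneg s).trans_lt ht1
  have hsum : Summable fun k => ‖c k‖ * t ^ k := by
    have := (hc (t : ℂ) (by exact_mod_cast ht0.ne') (by
      rw [Complex.norm_real, Real.norm_of_nonneg ht0.le]; exact ht2)).norm
    simpa [abs_of_pos ht0] using this
  have h1 : ContinuousOn (fun s : ℂ => ∑' k, c k * s ^ k) (Metric.ball 0 t) := by
    refine continuousOn_tsum (fun k => by fun_prop) hsum fun k z hz => ?_
    rw [mem_ball_zero_iff] at hz
    rw [norm_mul, norm_pow]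
    gcongr
  exact (h1.continuousAt (Metric.isOpen_ball.mem_nhds (by simpa using ht1))).continuousWithinAt

open SUAmplitude in
/-- Boundary values of the subtracted function `(B - T_p) / s ^ (p + 1)`, where `T_p` is the Taylor
polynomial of `B` at `0`. The part `l` of the pairing that does not see the discontinuity is the
same on both sides of the axis. -/
theorem exists_tendsto_integral_subtracted {B : ℂ → ℂ} (hB : DifferentiableOn ℂ B posAxisᶜ)
    {b : ℕ → ℂ} {x₁ u : ℝ} (hu : u < 0) (hx₁ : 0 < x₁) (hux : -u ≤ x₁ / 4)
    (hb : ∀ s : ℂ, s ≠ 0 → ‖s‖ < x₁ → HasSum (fun k => b k * s ^ k) (B s))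
    {L : ℝ → (ℝ → ℝ) → ℂ} (hL : ∀ σ : ℝ, |σ| = 1 → ∀ φ : ℝ → ℝ, IsTest u φ → Tendsto (fun ε : ℝ =>
      ∫ x : ℝ, (φ x : ℂ) * B ((x : ℂ) + ((σ * ε : ℝ) : ℂ) * Complex.I)) (𝓝[>] 0) (𝓝 (L σ φ)))
    (p : ℕ) {ψ : ℝ → ℝ} (hψ : ContDiff ℝ ∞ ψ) (hψc : HasCompactSupport ψ) :
    ∃ l : ℂ, ∀ σ : ℝ, |σ| = 1 → Tendsto (fun ε : ℝ => ∫ x : ℝ, (ψ x : ℂ) *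
        ((B ((x : ℂ) + ((σ * ε : ℝ) : ℂ) * Complex.I) - ∑ k ∈ Finset.range (p + 1),
          b k * ((x : ℂ) + ((σ * ε : ℝ) : ℂ) * Complex.I) ^ k) /
          ((x : ℂ) + ((σ * ε : ℝ) : ℂ) * Complex.I) ^ (p + 1))) (𝓝[>] 0)
      (𝓝 (l + L σ fun x => ψ x * leftCut x₁ x / x ^ (p + 1))) := by
  set η := leftCut x₁ with hη
  have hηs : ContDiff ℝ ∞ η := contDiff_leftCut x₁
  let T : ℂ → ℂ := fun s => ∑ k ∈ Finset.range (p + 1), b k * s ^ k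
  have hTc : Continuous T := by fun_prop
  let g : ℂ → ℂ := fun s => (B s - T s) / s ^ (p + 1)
  let ser : ℂ → ℂ := fun s => ∑' k, b (k + (p + 1)) * s ^ k
  have hser : ∀ s : ℂ, s ≠ 0 → ‖s‖ < x₁ →
      HasSum (fun k => b (k + (p + 1)) * s ^ k) (g s) := by
    intro s hs hs1
    have h1 := (hasSum_nat_add_iff' (p + 1)).2 (hb s hs hs1)
    have h2 := h1.div_const (s ^ (p + 1))
    refine h2.congr_fun fun k => ?_
    rw [pow_add]
    field_simp
  let G : ℂ → ℂ := fun s => if ‖s‖ < x₁ then ser s else g s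
  have hGg : ∀ s : ℂ, s ≠ 0 → G s = g s := by
    intro s hs
    by_cases h : ‖s‖ < x₁
    · simp only [G, h, if_true]; exact (hser s hs h).tsum_eq
    · simp only [G, h, if_false]
  set W : Set ℂ := Metric.ball 0 x₁ ∪ posAxisᶜ with hW
  have hWo : IsOpen W := Metric.isOpen_ball.union isClosed_posAxis.isOpen_compl
  have hne0 : ∀ s ∉ posAxis, s ≠ 0 := by
    rintro s hs rfl; exact hs ⟨by simp, by simp⟩
  have hgc : ContinuousOn g posAxisᶜ := by
    refine ContinuousOn.div (hB.continuousOn.sub hTc.continuousOn) (by fun_prop) fun s hs => ?_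
    exact pow_ne_zero _ (hne0 s hs)
  have hGc : ContinuousOn G W := by
    intro s hs
    refine ContinuousAt.continuousWithinAt ?_
    rcases hs with hs | hs
    · have h1 : ContinuousAt ser s := (continuousOn_tsum_mul_pow fun s hs hs1 =>
        (hser s hs hs1).summable).continuousAt (Metric.isOpen_ball.mem_nhds hs)
      refine h1.congr ?_
      filter_upwards [Metric.isOpen_ball.mem_nhds hs] with z hz
      simp only [G]
      rw [if_pos (by simpa using hz)]
    · have h1 : ContinuousAt g s := hgc.continuousAt (isClosed_posAxis.isOpen_compl.mem_nhds hs)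
      refine h1.congr ?_
      filter_upwards [isClosed_posAxis.isOpen_compl.mem_nhds hs] with z hz
      exact (hGg z (hne0 z hz)).symm
  -- the part of the test function to the left of the first threshold
  let ψl : ℝ → ℝ := fun x => ψ x * (1 - η x)
  have hψl : Continuous ψl := hψ.continuous.mul (continuous_const.sub hηs.continuous)
  have hψlc : HasCompactSupport ψl := hψc.mul_right
  have hψlW : ∀ x ∈ tsupport ψl, (x : ℂ) ∈ W := by
    intro x hx
    have h1 : x ≤ 3 * x₁ / 4 := by
      refine closure_minimal (t := Set.Iic (3 * x₁ / 4)) (fun z hz => ?_) isClosed_Iic hx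
      by_contra h
      refine hz ?_
      simp only [ψl, hη]
      rw [leftCut_eq_one hx₁ (not_le.1 h).le]; simp
    rcases lt_or_ge x 0 with h0 | h0
    · refine Or.inr fun h => ?_
      have := h.2
      simp at this
      linarith
    · refine Or.inl ?_
      rw [mem_ball_zero_iff, Complex.norm_real, Real.norm_of_nonneg h0]
      linarith
  -- the part of the test function on the physical region
  let ψr : ℝ → ℝ := fun x => ψ x * η x
  have hψr : ContDiff ℝ ∞ ψr := hψ.mul hηs
  have hψrc : HasCompactSupport ψr := hψc.mul_right
  have hψrs : ∀ x ∈ tsupport ψr, x₁ / 2 ≤ x := by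
    intro x hx
    refine closure_minimal (t := Set.Ici (x₁ / 2)) (fun z hz => ?_) isClosed_Ici hx
    by_contra h
    refine hz ?_
    simp only [ψr, hη]
    rw [leftCut_eq_zero hx₁ (not_le.1 h).le]; simp
  have htest : IsTest u ψr := ⟨hψr, hψrc, fun x hx => by
    have := hψrs x hx
    change -u < x
    linarith⟩
  have hψrW : ∀ x ∈ tsupport ψr, (x : ℂ) ∈ {s : ℂ | s ≠ 0} := by
    intro x hx
    have h1 : 0 < x := by have := hψrs x hx; linarith
    change (x : ℂ) ≠ 0
    exact_mod_cast h1.ne'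
  have hTpc : ContinuousOn (fun s => T s / s ^ (p + 1)) {s : ℂ | s ≠ 0} :=
    hTc.continuousOn.div (by fun_prop) fun s hs => pow_ne_zero _ hs
  refine ⟨(∫ x : ℝ, (ψl x : ℂ) * G x) - ∫ x : ℝ, (ψr x : ℂ) * (T x / (x : ℂ) ^ (p + 1)),
    fun σ hσ => ?_⟩
  have hσ0 : σ ≠ 0 := by rintro rfl; simp at hσ
  have hBline : ∀ ε : ℝ, 0 < ε →
      Continuous fun x : ℝ => B ((x : ℂ) + ((σ * ε : ℝ) : ℂ) * Complex.I) := fun ε hε =>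
    hB.continuousOn.comp_continuous (by fun_prop) fun x =>
      add_mul_I_notMem_posAxis x (mul_ne_zero hσ0 hε.ne')
  have t1 := tendsto_integral_of_continuousOn hWo hGc hψl hψlc hψlW σ
  have t2 := tendsto_integral_of_continuousOn isOpen_ne hTpc hψr.continuous hψrc hψrW σ
  have t3 := tendsto_integral_mul_div_pow hu hσ0 hBline (hL σ hσ) (p + 1) htest
  have h := (t1.2.sub t2.2).add t3
  refine h.congr' ?_
  filter_upwards [self_mem_nhdsWithin, t1.1, t2.1] with ε hε i1 i2
  have hε0 : (0 : ℝ) < ε := hε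
  have ht0 : σ * ε ≠ 0 := mul_ne_zero hσ0 hε0.ne'
  have i3 : Integrable fun x : ℝ => (ψr x : ℂ) * (B ((x : ℂ) + ((σ * ε : ℝ) : ℂ) * Complex.I) /
      ((x : ℂ) + ((σ * ε : ℝ) : ℂ) * Complex.I) ^ (p + 1)) := by
    refine Continuous.integrable_of_hasCompactSupport ?_
      (hψrc.comp_left (g := ((↑) : ℝ → ℂ)) Complex.ofReal_zero).mul_right
    refine (Complex.continuous_ofReal.comp hψr.continuous).mul ((hBline ε hε0).div (by fun_prop) ?_)
    exact fun x => pow_ne_zero _ (add_mul_I_ne_zero x ht0)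
  have i12 := i1.sub i2
  simp only [Pi.sub_def] at i12
  rw [← integral_sub i1 i2, ← integral_add i12 i3]
  congr 1; funext x
  rw [hGg _ (add_mul_I_ne_zero x ht0)]
  simp only [g, ψl, ψr, T]
  push_cast
  ring

theorem integral_mul_scale (ψ : ℝ → ℝ) (g : ℂ → ℂ) {R : ℝ} (hR : 0 < R) (σ y : ℝ) :
    ∫ x : ℝ, (ψ x : ℂ) * ((R : ℂ) * g ((R : ℂ) * ((x : ℂ) + ((σ * y : ℝ) : ℂ) * Complex.I))) =
      ∫ x : ℝ, ((ψ (x / R) : ℝ) : ℂ) * g ((x : ℂ) + ((σ * (R * y) : ℝ) : ℂ) * Complex.I) := by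
  have h := Measure.integral_comp_mul_left (fun x : ℝ => ((ψ (x / R) : ℝ) : ℂ) *
    g ((x : ℂ) + ((σ * (R * y) : ℝ) : ℂ) * Complex.I)) R
  have h3 : ∀ z : ℂ, z = (R : ℂ) * (|R⁻¹| • z) := by
    intro z
    rw [abs_of_pos (inv_pos.2 hR), Complex.real_smul, ← mul_assoc, ← Complex.ofReal_mul,
      mul_inv_cancel₀ hR.ne']
    simp
  rw [h3 (∫ x : ℝ, ((ψ (x / R) : ℝ) : ℂ) * _), ← h, ← integral_const_mul]
  congr 1; funext x
  rw [mul_div_cancel_left₀ _ hR.ne']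
  have : ((R * x : ℝ) : ℂ) + ((σ * (R * y) : ℝ) : ℂ) * Complex.I =
      (R : ℂ) * ((x : ℂ) + ((σ * y : ℝ) : ℂ) * Complex.I) := by push_cast; ring
  rw [this]
  ring

/-- If the pairings with all derivatives of the cutoff converge, only the one with the cutoff itself
contributes to the limit of the almost analytic pairing. -/
theorem tendsto_cutoffPairing (K : ℕ) {σ : ℝ} {f : ℂ → ℂ} {l : ℕ → ℂ}
    (h : ∀ k, Tendsto (fun y : ℝ => ∫ x : ℝ, ((iteratedDeriv k (cutoff : ℝ → ℝ) x : ℝ) : ℂ) *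
      f ((x : ℂ) + ((σ * y : ℝ) : ℂ) * Complex.I)) (𝓝[>] 0) (𝓝 (l k))) :
    Tendsto (cutoffPairing K σ f) (𝓝[>] 0) (𝓝 (l 0)) := by
  have h0 : ∀ k ∈ Finset.range (K + 1), Tendsto (fun y : ℝ =>
      ((σ * y : ℝ) * Complex.I) ^ k / (k.factorial : ℂ) *
      ∫ x : ℝ, ((iteratedDeriv k (cutoff : ℝ → ℝ) x : ℝ) : ℂ) *
      f ((x : ℂ) + ((σ * y : ℝ) : ℂ) * Complex.I)) (𝓝[>] 0) (𝓝 (if k = 0 then l 0 else 0)) := by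
    intro k _
    have hc : Continuous fun y : ℝ => (((σ * y : ℝ) : ℂ) * Complex.I) ^ k / (k.factorial : ℂ) := by
      fun_prop
    have h1 := ((hc.tendsto 0).mono_left (nhdsWithin_le_nhds (s := Set.Ioi 0))).mul (h k)
    rcases Nat.eq_zero_or_pos k with rfl | hk
    · simpa using h1
    · simpa [hk.ne'] using h1
  have := tendsto_finsetSum _ h0
  rw [Finset.sum_ite_eq' (Finset.range (K + 1)) 0 (fun _ => l 0)] at this
  rwa [if_pos (Finset.mem_range.2 (Nat.succ_pos K))] at this

theorem cutoffPairing_sub_sum (K : ℕ) {σ y : ℝ} {f : ℂ → ℂ} {h : ℕ → ℂ → ℂ} (c : ℕ → ℂ)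
    (s : Finset ℕ)
    (hf : Continuous fun x : ℝ => f ((x : ℂ) + ((σ * y : ℝ) : ℂ) * Complex.I))
    (hh : ∀ k ∈ s, Continuous fun x : ℝ => h k ((x : ℂ) + ((σ * y : ℝ) : ℂ) * Complex.I)) :
    cutoffPairing K σ (fun z => f z - ∑ k ∈ s, c k * h k z) y =
      cutoffPairing K σ f y - ∑ k ∈ s, c k * cutoffPairing K σ (h k) y := by
  have hint : ∀ (n : ℕ) {f : ℂ → ℂ},
      Continuous (fun x : ℝ => f ((x : ℂ) + ((σ * y : ℝ) : ℂ) * Complex.I)) →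
      Integrable fun x : ℝ => ((iteratedDeriv n (cutoff : ℝ → ℝ) x : ℝ) : ℂ) *
        f ((x : ℂ) + ((σ * y : ℝ) : ℂ) * Complex.I) := fun n f hf =>
    ((Complex.continuous_ofReal.comp (contDiff_iteratedDeriv_cutoff n).continuous).mul
      hf).integrable_of_hasCompactSupport
      ((hasCompactSupport_iteratedDeriv_cutoff n).comp_left (g := ((↑) : ℝ → ℂ))
        Complex.ofReal_zero).mul_right
  have key : ∀ n, ∫ x : ℝ, ((iteratedDeriv n (cutoff : ℝ → ℝ) x : ℝ) : ℂ) *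
      (f ((x : ℂ) + ((σ * y : ℝ) : ℂ) * Complex.I) -
        ∑ k ∈ s, c k * h k ((x : ℂ) + ((σ * y : ℝ) : ℂ) * Complex.I)) =
      (∫ x : ℝ, ((iteratedDeriv n (cutoff : ℝ → ℝ) x : ℝ) : ℂ) *
        f ((x : ℂ) + ((σ * y : ℝ) : ℂ) * Complex.I)) -
      ∑ k ∈ s, c k * ∫ x : ℝ, ((iteratedDeriv n (cutoff : ℝ → ℝ) x : ℝ) : ℂ) *
        h k ((x : ℂ) + ((σ * y : ℝ) : ℂ) * Complex.I) := by
    intro n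
    have hs : ∀ k ∈ s, Integrable fun x : ℝ => c k *
        (((iteratedDeriv n (cutoff : ℝ → ℝ) x : ℝ) : ℂ) *
          h k ((x : ℂ) + ((σ * y : ℝ) : ℂ) * Complex.I)) := fun k hk =>
      (hint n (hh k hk)).const_mul (c k)
    simp only [← integral_const_mul]
    rw [← integral_finsetSum s hs, ← integral_sub (hint n hf) (integrable_finsetSum s hs)]
    congr 1; funext x
    rw [mul_sub, Finset.mul_sum]
    congr 1
    exact Finset.sum_congr rfl fun k _ => by ring
  simp only [cutoffPairing, key]
  simp only [mul_sub (_ / _), Finset.sum_sub_distrib, Finset.mul_sum]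
  congr 1
  rw [Finset.sum_comm]
  exact Finset.sum_congr rfl fun k _ => Finset.sum_congr rfl fun n _ => by ring

/-- The contribution of the coefficient of `s ^ p`: the Sokhotski–Plemelj formula at the origin. -/
theorem tendsto_cutoffPairing_inv (K : ℕ) :
    Tendsto (fun y =>
        cutoffPairing K 1 (fun z => 1 / z) y - cutoffPairing K (-1) (fun z => 1 / z) y)
      (𝓝[>] 0) (𝓝 (-(2 * Real.pi * Complex.I))) := by
  have hterm : ∀ k ∈ Finset.range (K + 1), Tendsto (fun y : ℝ =>
      ((1 * y : ℝ) * Complex.I) ^ k / (k.factorial : ℂ) *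
      (∫ x : ℝ, ((iteratedDeriv k (cutoff : ℝ → ℝ) x : ℝ) : ℂ) *
        (1 / ((x : ℂ) + ((1 * y : ℝ) : ℂ) * Complex.I))) -
      ((-1 * y : ℝ) * Complex.I) ^ k / (k.factorial : ℂ) *
      (∫ x : ℝ, ((iteratedDeriv k (cutoff : ℝ → ℝ) x : ℝ) : ℂ) *
        (1 / ((x : ℂ) + ((-1 * y : ℝ) : ℂ) * Complex.I)))) (𝓝[>] 0)
      (𝓝 (if k = 0 then -(2 * Real.pi * Complex.I) else 0)) := by
    intro k _
    rcases k with _ | k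
    · have h := tendsto_integral_simple_pole contDiff_cutoff.continuous hasCompactSupport_cutoff 0
      rw [cutoff_eq_one (by simp)] at h
      simp only [Complex.ofReal_zero, sub_zero, Complex.ofReal_one, mul_one] at h
      simp only [if_true, pow_zero, Nat.factorial_zero, Nat.cast_one, div_one, one_mul,
        iteratedDeriv_zero]
      refine h.congr' ?_
      filter_upwards [self_mem_nhdsWithin] with y hy
      have hy0 : (0 : ℝ) < y := hy
      have hint : ∀ t : ℝ, t ≠ 0 → Integrable fun x : ℝ => ((cutoff x : ℝ) : ℂ) *
          (1 / ((x : ℂ) + (t : ℂ) * Complex.I)) := by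
        intro t ht
        refine Continuous.integrable_of_hasCompactSupport ?_
          (hasCompactSupport_cutoff.comp_left (g := ((↑) : ℝ → ℂ)) Complex.ofReal_zero).mul_right
        exact (Complex.continuous_ofReal.comp contDiff_cutoff.continuous).mul
          (continuous_const.div (by fun_prop) fun x => add_mul_I_ne_zero x ht)
      have i1 := hint y hy0.ne'
      have i2 := hint (-1 * y) (by linarith)
      rw [one_mul, ← integral_sub i1 i2]
      simp only [mul_sub]
    · have hts : ∀ x ∈ tsupport (iteratedDeriv (k + 1) (cutoff : ℝ → ℝ)),
          (x : ℂ) ∈ {s : ℂ | s ≠ 0} := by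
        intro x hx
        have h1 : 1 ≤ |x| := by
          refine closure_minimal (t := {x : ℝ | 1 ≤ |x|}) (fun z hz => ?_)
            (isClosed_le continuous_const continuous_abs) hx
          by_contra h
          exact hz (iteratedDeriv_succ_cutoff_eq_zero k (not_le.1 h))
        intro h0
        have : x = 0 := by exact_mod_cast h0
        rw [this, abs_zero] at h1
        linarith
      have hlim : ∀ σ : ℝ, Tendsto (fun y : ℝ =>
          ((σ * y : ℝ) * Complex.I) ^ (k + 1) / ((k + 1).factorial : ℂ) *
          (∫ x : ℝ, ((iteratedDeriv (k + 1) (cutoff : ℝ → ℝ) x : ℝ) : ℂ) *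
            (1 / ((x : ℂ) + ((σ * y : ℝ) : ℂ) * Complex.I)))) (𝓝[>] 0) (𝓝 0) := by
        intro σ
        have h1 := (tendsto_integral_of_continuousOn isOpen_ne (h := fun z : ℂ => 1 / z)
          (continuousOn_const.div continuousOn_id fun s hs => hs)
          (contDiff_iteratedDeriv_cutoff (k + 1)).continuous
          (hasCompactSupport_iteratedDeriv_cutoff (k + 1)) hts σ).2
        have hc : Continuous fun y : ℝ =>
            (((σ * y : ℝ) : ℂ) * Complex.I) ^ (k + 1) / ((k + 1).factorial : ℂ) := by fun_prop
        have h2 := ((hc.tendsto 0).mono_left (nhdsWithin_le_nhds (s := Set.Ioi 0))).mul h1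
        simpa using h2
      simpa using (hlim 1).sub (hlim (-1))
  have := tendsto_finsetSum _ hterm
  rw [Finset.sum_ite_eq' (Finset.range (K + 1)) 0 (fun _ => -(2 * Real.pi * Complex.I))] at this
  simpa only [cutoffPairing, ← Finset.sum_sub_distrib, Finset.mem_range, Nat.succ_pos, if_true]
    using this

open SUAmplitude in
/-- The finite-energy dispersion relation: up to an error controlled by the size of `B` on the arc
`|s| ∼ R`, the coefficient of `s ^ p` in the expansion of `B` at `0` is the discontinuity of `B`
paired with `1 / s ^ (p + 1)`, smoothly cut off at `s ∼ R`. -/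
theorem exists_norm_discontinuity_sub_coeff_le (K : ℕ) : ∃ C : ℝ, 0 ≤ C ∧
    ∀ (B : ℂ → ℂ) (b : ℕ → ℂ) (x₁ u R S : ℝ) (p : ℕ) (L : ℝ → (ℝ → ℝ) → ℂ),
    DifferentiableOn ℂ B posAxisᶜ → u < 0 → 0 < x₁ → -u ≤ x₁ / 4 →
    (∀ s : ℂ, s ≠ 0 → ‖s‖ < x₁ → HasSum (fun k => b k * s ^ k) (B s)) →
    (∀ σ : ℝ, |σ| = 1 → ∀ φ : ℝ → ℝ, IsTest u φ → Tendsto (fun ε : ℝ =>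
      ∫ x : ℝ, (φ x : ℂ) * B ((x : ℂ) + ((σ * ε : ℝ) : ℂ) * Complex.I)) (𝓝[>] 0)
        (𝓝 (L σ φ))) → 0 < R → 0 ≤ S →
    (∀ σ : ℝ, |σ| = 1 → ∀ x y : ℝ, |x| ≤ 2 → 0 < y → y ≤ 1 → (1 ≤ |x| ∨ y = 1) →
      y ^ K * ‖(R : ℂ) * (B ((R : ℂ) * ((x : ℂ) + ((σ * y : ℝ) : ℂ) * Complex.I)) /
        ((R : ℂ) * ((x : ℂ) + ((σ * y : ℝ) : ℂ) * Complex.I)) ^ (p + 1))‖ ≤ S) →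
    ‖L 1 (fun x => cutoff (x / R) * leftCut x₁ x / x ^ (p + 1)) -
      L (-1) (fun x => cutoff (x / R) * leftCut x₁ x / x ^ (p + 1)) -
      2 * Real.pi * Complex.I * b p‖ ≤
      C * (S + ∑ k ∈ Finset.range p, ‖b k‖ * (R ^ (p - k))⁻¹) := by
  obtain ⟨C, hC0, hC⟩ := exists_norm_cutoffPairing_le K
  refine ⟨2 * C, by positivity, ?_⟩
  intro B b x₁ u R S p L hB hu hx₁ hux hb hL hR hS hgrow
  let g : ℂ → ℂ := fun s => (B s - ∑ k ∈ Finset.range (p + 1), b k * s ^ k) / s ^ (p + 1)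
  let f : ℂ → ℂ := fun z => (R : ℂ) * (B ((R : ℂ) * z) / ((R : ℂ) * z) ^ (p + 1))
  let h : ℕ → ℂ → ℂ := fun k z => z ^ k / z ^ (p + 1)
  let c : ℕ → ℂ := fun k => b k * ((R : ℂ) ^ (p - k))⁻¹
  have hRc : (R : ℂ) ≠ 0 := by exact_mod_cast hR.ne'
  -- the rescaled subtracted function
  have hdec : ∀ z : ℂ, z ≠ 0 → (R : ℂ) * g ((R : ℂ) * z) =
      f z - ∑ k ∈ Finset.range (p + 1), c k * h k z := by
    intro z hz
    simp only [g, f]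
    rw [sub_div, mul_sub, Finset.sum_div, Finset.mul_sum]
    congr 1
    refine Finset.sum_congr rfl fun k hk => ?_
    have hk' : k ≤ p := Nat.lt_succ_iff.1 (Finset.mem_range.1 hk)
    simp only [c, h]
    have e : (R : ℂ) ^ (p + 1) = R ^ (p - k) * R ^ k * R := by
      rw [← pow_add, Nat.sub_add_cancel hk', pow_succ]
    rw [mul_pow, mul_pow, e]
    field_simp
  -- its boundary values
  have hlimg : ∃ l : ℂ, ∀ σ : ℝ, |σ| = 1 → Tendsto
      (cutoffPairing K σ fun z => (R : ℂ) * g ((R : ℂ) * z)) (𝓝[>] 0)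
      (𝓝 (l + L σ fun x => cutoff (x / R) * leftCut x₁ x / x ^ (p + 1))) := by
    have hsm : ∀ k, ContDiff ℝ ∞ fun x => iteratedDeriv k (cutoff : ℝ → ℝ) (x / R) := fun k =>
      (contDiff_iteratedDeriv_cutoff k).comp (by fun_prop)
    have hcs : ∀ k, HasCompactSupport fun x => iteratedDeriv k (cutoff : ℝ → ℝ) (x / R) := by
      intro k
      refine HasCompactSupport.of_support_subset_isCompact
        (isCompact_closedBall (0 : ℝ) (2 * R)) fun x hx => ?_
      rw [mem_closedBall_zero_iff, Real.norm_eq_abs]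
      by_contra hlt
      refine hx (iteratedDeriv_cutoff_eq_zero k ?_)
      rw [abs_div, abs_of_pos hR, lt_div_iff₀ hR]
      exact not_le.1 hlt
    choose l hl using fun k =>
      exists_tendsto_integral_subtracted hB hu hx₁ hux hb hL p (hsm k) (hcs k)
    refine ⟨l 0, fun σ hσ => ?_⟩
    have hRy : Tendsto (fun y : ℝ => R * y) (𝓝[>] 0) (𝓝[>] 0) := by
      rw [tendsto_nhdsWithin_iff]
      constructor
      · have : Continuous fun y : ℝ => R * y := by fun_prop
        simpa using (this.tendsto 0).mono_left nhdsWithin_le_nhds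
      · filter_upwards [self_mem_nhdsWithin] with y hy using mul_pos hR hy
    have := tendsto_cutoffPairing K (σ := σ) (f := fun z => (R : ℂ) * g ((R : ℂ) * z))
      (l := fun k => l k + L σ fun x => iteratedDeriv k (cutoff : ℝ → ℝ) (x / R) *
        leftCut x₁ x / x ^ (p + 1)) fun k => by
          refine ((hl k σ hσ).comp hRy).congr fun y => ?_
          exact (integral_mul_scale _ g hR σ y).symm
    simpa only [iteratedDeriv_zero] using this
  obtain ⟨l, hl⟩ := hlimg
  -- `l` drops out of the discontinuity, and the term `b p / z` of the subtraction is added back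
  have hlim := ((hl 1 (by simp)).sub (hl (-1) (by simp))).add
    ((tendsto_cutoffPairing_inv K).const_mul (b p))
  have hval : ∀ z1 z2 : ℂ, l + z1 - (l + z2) + b p * -(2 * Real.pi * Complex.I) =
      z1 - z2 - 2 * Real.pi * Complex.I * b p := fun z1 z2 => by ring
  rw [hval] at hlim
  refine le_of_tendsto hlim.norm ?_
  -- the bound at positive heights
  have hne : ∀ σ : ℝ, |σ| = 1 → ∀ s : ℂ, 0 < σ * s.im → s ≠ 0 := by
    rintro σ - s hs rfl; simp at hs
  have hfd : ∀ σ : ℝ, |σ| = 1 → DifferentiableOn ℂ f {s | 0 < σ * s.im} := by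
    intro σ hσ s hs
    have hsne := hne σ hσ s hs
    have hsP : (R : ℂ) * s ∉ posAxis := by
      intro hmem
      have h1 := hmem.1
      rw [Complex.im_ofReal_mul] at h1
      rcases mul_eq_zero.1 h1 with h2 | h2
      · exact hR.ne' h2
      · have hs' : 0 < σ * s.im := hs
        rw [h2, mul_zero] at hs'
        exact lt_irrefl _ hs'
    have hBd : DifferentiableAt ℂ (fun z => B ((R : ℂ) * z)) s :=
      (hB.differentiableAt (isClosed_posAxis.isOpen_compl.mem_nhds hsP)).comp s
        (differentiableAt_id.const_mul _)
    refine (DifferentiableAt.const_mul (hBd.div (by fun_prop) ?_) _).differentiableWithinAt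
    exact pow_ne_zero _ (mul_ne_zero hRc hsne)
  have hhd : ∀ k, ∀ σ : ℝ, |σ| = 1 → DifferentiableOn ℂ (h k) {s | 0 < σ * s.im} := by
    intro k σ hσ s hs
    refine DifferentiableAt.differentiableWithinAt ?_
    exact (differentiableAt_id.pow k).div (differentiableAt_id.pow (p + 1))
      (pow_ne_zero _ (hne σ hσ s hs))
  have hfb : ∀ σ : ℝ, |σ| = 1 → ∀ y, 0 < y → y ≤ 1 → ‖cutoffPairing K σ f y‖ ≤ C * S :=
    fun σ hσ y hy hy1 => hC f σ S hσ (hfd σ hσ) hS (hgrow σ hσ) y hy hy1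
  have hhb : ∀ k ≤ p, ∀ σ : ℝ, |σ| = 1 → ∀ y, 0 < y → y ≤ 1 →
      ‖cutoffPairing K σ (h k) y‖ ≤ C := by
    intro k hk σ hσ y hy hy1
    have := hC (h k) σ 1 hσ (hhd k σ hσ) zero_le_one (fun x t hx ht ht1 hxt => by
      set z : ℂ := (x : ℂ) + ((σ * t : ℝ) : ℂ) * Complex.I with hz
      have hz1 : 1 ≤ ‖z‖ := by
        rcases hxt with h1 | h1
        · refine h1.trans ?_
          have := Complex.abs_re_le_norm z
          simpa [hz] using this
        · have := Complex.abs_im_le_norm z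
          simpa [hz, h1, hσ] using this
      have hz0 : z ≠ 0 := by
        intro h0; rw [h0, norm_zero] at hz1; linarith
      simp only [h]
      rw [norm_div, norm_pow, norm_pow]
      have h1 : ‖z‖ ^ k / ‖z‖ ^ (p + 1) ≤ 1 := by
        rw [div_le_one (by positivity)]
        exact pow_le_pow_right₀ hz1 (by omega)
      have h2 : t ^ K ≤ 1 := pow_le_one₀ ht.le ht1
      calc _ ≤ 1 * 1 := mul_le_mul h2 h1 (by positivity) zero_le_one
        _ = 1 := one_mul 1) y hy hy1
    rwa [mul_one] at this
  filter_upwards [Ioc_mem_nhdsGT (zero_lt_one' ℝ)] with y hy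
  have hline : ∀ σ : ℝ, |σ| = 1 → ∀ x : ℝ,
      (x : ℂ) + ((σ * y : ℝ) : ℂ) * Complex.I ∈ {s : ℂ | 0 < σ * s.im} := by
    intro σ hσ x
    have hσ2 : σ * σ = 1 := by rw [← abs_mul_abs_self, hσ, one_mul]
    have : 0 < σ * (σ * y) := by rw [← mul_assoc, hσ2, one_mul]; exact hy.1
    simpa using this
  have hpd : ∀ σ : ℝ, |σ| = 1 → cutoffPairing K σ (fun z => (R : ℂ) * g ((R : ℂ) * z)) y =
      cutoffPairing K σ f y - ∑ k ∈ Finset.range (p + 1), c k * cutoffPairing K σ (h k) y := by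
    intro σ hσ
    rw [← cutoffPairing_sub_sum K c _
      ((hfd σ hσ).continuousOn.comp_continuous (by fun_prop) (hline σ hσ))
      fun k _ => (hhd k σ hσ).continuousOn.comp_continuous (by fun_prop) (hline σ hσ)]
    simp only [cutoffPairing]
    refine Finset.sum_congr rfl fun n _ => ?_
    congr 2
    funext x
    rw [hdec _ (hne σ hσ _ (hline σ hσ x))]
  have hhp : ∀ σ : ℝ, |σ| = 1 →
      cutoffPairing K σ (h p) y = cutoffPairing K σ (fun z => 1 / z) y := by
    intro σ hσ
    simp only [cutoffPairing]
    refine Finset.sum_congr rfl fun n _ => ?_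
    congr 2
    funext x
    have := hne σ hσ _ (hline σ hσ x)
    simp only [h]
    rw [pow_succ]
    field_simp
  have hcp : c p = b p := by simp [c]
  have h1 : |(1 : ℝ)| = 1 := abs_one
  have h2 : |(-1 : ℝ)| = 1 := by simp
  rw [hpd 1 h1, hpd (-1) h2, Finset.sum_range_succ, Finset.sum_range_succ, hcp, hhp 1 h1,
    hhp (-1) h2]
  have e : ∀ f1 f2 s1 s2 i1 i2 : ℂ, f1 - (s1 + b p * i1) - (f2 - (s2 + b p * i2)) +
      b p * (i1 - i2) = f1 - f2 - (s1 - s2) := by intros; ring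
  rw [e, ← Finset.sum_sub_distrib]
  have hsumb : ‖∑ k ∈ Finset.range p, (c k * cutoffPairing K 1 (h k) y -
      c k * cutoffPairing K (-1) (h k) y)‖ ≤
      ∑ k ∈ Finset.range p, 2 * C * (‖b k‖ * (R ^ (p - k))⁻¹) := by
    refine norm_sum_le_of_le _ fun k hk => ?_
    have hk' : k ≤ p := (Finset.mem_range.1 hk).le
    rw [← mul_sub, norm_mul]
    have hc : ‖c k‖ = ‖b k‖ * (R ^ (p - k))⁻¹ := by
      simp only [c]
      rw [norm_mul, norm_inv, norm_pow, Complex.norm_real, Real.norm_of_nonneg hR.le]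
    rw [hc, mul_comm]
    gcongr
    refine (norm_sub_le _ _).trans ?_
    linarith [hhb k hk' 1 h1 y hy.1 hy.2, hhb k hk' (-1) h2 y hy.1 hy.2]
  refine (norm_sub_le _ _).trans ?_
  have := (norm_sub_le (cutoffPairing K 1 f y) (cutoffPairing K (-1) f y))
  rw [mul_add, Finset.mul_sum]
  linarith [hfb 1 h1 y hy.1 hy.2, hfb (-1) h2 y hy.1 hy.2]

/-! ### The low-energy expansion and the boundary values without massless poles -/

theorem coeff_eq_zero_of_hasSum_zero {c : ℕ → ℂ} {r : ℝ} (hr : 0 < r)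
    (hc : ∀ s : ℂ, s ≠ 0 → ‖s‖ < r → HasSum (fun k => c k * s ^ k) 0) (k : ℕ) : c k = 0 := by
  induction k using Nat.strong_induction_on with
  | _ k ih =>
    have h1 : ∀ s : ℂ, s ≠ 0 → ‖s‖ < r → HasSum (fun i => c (i + k) * s ^ i) 0 := by
      intro s hs hsr
      have h2 := (hasSum_nat_add_iff' k).2 (hc s hs hsr)
      rw [Finset.sum_eq_zero fun i hi => by rw [ih i (Finset.mem_range.1 hi), zero_mul],
        sub_zero] at h2
      have h3 := h2.div_const (s ^ k)
      rw [zero_div] at h3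
      refine h3.congr_fun fun i => ?_
      rw [pow_add]; field_simp
    have hcont := (continuousOn_tsum_mul_pow fun s hs hsr => (h1 s hs hsr).summable).continuousAt
      (Metric.ball_mem_nhds (0 : ℂ) hr)
    have h4 : Tendsto (fun s : ℂ => ∑' i, c (i + k) * s ^ i) (𝓝[≠] 0) (𝓝 0) := by
      refine tendsto_const_nhds.congr' ?_
      filter_upwards [self_mem_nhdsWithin, mem_nhdsWithin_of_mem_nhds (Metric.ball_mem_nhds 0 hr)]
        with s hs hsr
      exact ((h1 s hs (by simpa using hsr)).tsum_eq).symm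
    have h5 := tendsto_nhds_unique (hcont.tendsto.mono_left nhdsWithin_le_nhds) h4
    rw [tsum_eq_single 0 fun i hi => by simp [hi]] at h5
    simpa using h5

namespace SUAmplitude

variable {X : SUAmplitude} {d : ℕ}

theorem Bootstrap.isLowEnergy (hX : X.Bootstrap d) (h1 : X.IsLevel 1) {z : ℂ}
    (hz : ‖z‖ < X.m 1 ^ 2) : X.IsLowEnergy z := by
  constructor
  · intro n hn hnl
    refine hz.trans_le ?_
    have hm1 := hX.mass_pos le_rfl h1
    rcases hn.eq_or_lt with rfl | hlt
    · exact le_rfl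
    · have := hX.mass_lt 1 n hlt hnl
      gcongr
  · exact (ENNReal.ofReal_le_ofReal hz.le).trans_lt (hX.sq_mass_lt h1)

theorem massless_comm (s u : ℂ) : X.massless s u = X.massless u s := by
  simp only [massless]
  congr 1
  exact Finset.sum_congr rfl fun j _ => by rw [add_comm]

/-- The low-energy coefficients `c p q` of `s ^ p u ^ q`; they are symmetric by crossing. -/
theorem Bootstrap.exists_coefficients (hX : X.Bootstrap d) (h1 : X.IsLevel 1) :
    ∃ c : ℕ → ℕ → ℂ, (∀ p q, c p q = c q p) ∧
      ∀ s u : ℂ, s ≠ 0 → u ≠ 0 → ‖s‖ < X.m 1 ^ 2 → ‖u‖ < X.m 1 ^ 2 →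
        HasSum (fun pq : ℕ × ℕ => c pq.1 pq.2 * s ^ pq.1 * u ^ pq.2) (X.A s u - X.massless s u) := by
  obtain ⟨a, ha⟩ := hX.low_energy
  set x₁ := X.m 1 ^ 2 with hx₁
  have hx₁0 : 0 < x₁ := by have := hX.mass_pos le_rfl h1; positivity
  have hs : ∀ s u : ℂ, s ≠ 0 → u ≠ 0 → ‖s‖ < x₁ → ‖u‖ < x₁ →
      HasSum (fun pq : ℕ × ℕ => a (pq.1 + pq.2) pq.2 * s ^ pq.1 * u ^ pq.2)
        (X.A s u - X.massless s u) := fun s u hs hu hs1 hu1 =>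
    ha s u hs hu (hX.isLowEnergy h1 hs1) (hX.isLowEnergy h1 hu1)
  refine ⟨fun p q => a (p + q) q, ?_, hs⟩
  let e : ℕ → ℕ → ℂ := fun p q => a (p + q) q - a (q + p) p
  have he : ∀ s u : ℂ, s ≠ 0 → u ≠ 0 → ‖s‖ < x₁ → ‖u‖ < x₁ →
      HasSum (fun pq : ℕ × ℕ => e pq.1 pq.2 * s ^ pq.1 * u ^ pq.2) 0 := by
    intro s u hs0 hu0 hs1 hu1
    have t1 := hs s u hs0 hu0 hs1 hu1
    have t2 := (Equiv.prodComm ℕ ℕ).hasSum_iff.2 (hs u s hu0 hs0 hu1 hs1)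
    rw [hX.crossing u s, massless_comm u s] at t2
    have t3 := t1.sub t2
    rw [sub_self] at t3
    refine t3.congr_fun fun pq => ?_
    simp only [e, Function.comp, Equiv.prodComm_apply, Prod.fst_swap, Prod.snd_swap]
    ring
  have hzero : ∀ p q, e p q = 0 := by
    intro p
    refine coeff_eq_zero_of_hasSum_zero hx₁0 fun u hu hu1 => ?_
    have hp : ∀ k, (∑' q, e k q * u ^ q) = 0 := by
      refine coeff_eq_zero_of_hasSum_zero hx₁0 fun s hs0 hs1 => ?_
      have h2 := he s u hs0 hu hs1 hu1
      refine (h2.prod_fiberwise fun k => (h2.summable.prod_factor k).hasSum).congr_fun fun k => ?_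
      rw [← tsum_mul_right]
      exact tsum_congr fun q => by ring
    have hh2 : (x₁ / 2 : ℝ) ≠ 0 := by positivity
    have h2 := he ((x₁ / 2 : ℝ) : ℂ) u (by exact_mod_cast hh2) hu
      (by rw [Complex.norm_real, Real.norm_of_nonneg (by positivity)]; linarith) hu1
    have h3 := (h2.summable.prod_factor p).mul_left ((((x₁ / 2 : ℝ) : ℂ) ^ p)⁻¹)
    have h4 : Summable fun q => e p q * u ^ q := by
      refine h3.congr fun q => ?_
      have : (((x₁ / 2 : ℝ) : ℂ) ^ p) ≠ 0 := pow_ne_zero _ (by exact_mod_cast hh2)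
      field_simp
    have := h4.hasSum
    rwa [hp p] at this
  intro p q
  exact sub_eq_zero.1 (hzero p q)

theorem poles_union_cut_subset_posAxis : X.poles ∪ X.cut ⊆ posAxis ∪ {s | s.im = 0 ∧ X.Λ = 0} := by
  rintro s (⟨n, _, rfl⟩ | hs)
  · refine Or.inl ⟨Complex.ofReal_im _, ?_⟩
    rw [Complex.ofReal_re]; positivity
  · by_cases h : 0 ≤ s.re
    · exact Or.inl ⟨hs.1, h⟩
    · refine Or.inr ⟨hs.1, ?_⟩
      have h2 := hs.2
      rw [ENNReal.ofReal_of_nonpos (not_le.1 h).le] at h2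
      exact pow_eq_zero_iff two_ne_zero |>.1 (le_antisymm h2 zero_le)

theorem Bootstrap.cutoff_pos (hX : X.Bootstrap d) : 0 < X.Λ := by
  have h0 : X.IsLevel 0 := lt_of_lt_of_le (by simp) hX.levels_pos
  simpa [hX.mass_zero] using hX.mass_lt_cutoff 0 h0

theorem Bootstrap.differentiableOn_amplitude (hX : X.Bootstrap d) {u : ℝ} (hu : u < 0) :
    DifferentiableOn ℂ (fun s => X.A s u) posAxisᶜ := by
  refine (hX.analytic u hu).mono fun s hs hmem => ?_
  rcases poles_union_cut_subset_posAxis hmem with h | h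
  · exact hs h
  · exact hX.cutoff_pos.ne' h.2

theorem ne_zero_of_notMem_posAxis {s : ℂ} (hs : s ∉ posAxis) : s ≠ 0 := by
  rintro rfl; exact hs ⟨by simp, by simp⟩

theorem differentiableOn_massless (u : ℂ) : DifferentiableOn ℂ (fun s => X.massless s u) {0}ᶜ := by
  unfold massless
  refine DifferentiableOn.fun_neg (DifferentiableOn.fun_sum fun j _ => ?_)
  refine DifferentiableOn.const_mul (DifferentiableOn.add ?_ (by fun_prop)) _
  exact (differentiableOn_const _).div differentiableOn_id fun s hs => hs

/-- The discontinuity of the amplitude without its massless poles, as an integral against the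
spectral measure. -/
theorem Bootstrap.exists_boundary_values (hX : X.Bootstrap d) (hd : 3 ≤ d) {u : ℝ} (hu : u < 0) :
    ∃ L : ℝ → (ℝ → ℝ) → ℂ, (∀ σ : ℝ, |σ| = 1 → ∀ φ : ℝ → ℝ, IsTest u φ → Tendsto (fun ε : ℝ =>
      ∫ x : ℝ, (φ x : ℂ) * (X.A ((x : ℂ) + ((σ * ε : ℝ) : ℂ) * Complex.I) u -
        X.massless ((x : ℂ) + ((σ * ε : ℝ) : ℂ) * Complex.I) u)) (𝓝[>] 0) (𝓝 (L σ φ))) ∧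
      ∀ φ : ℝ → ℝ, IsTest u φ → (∀ x, φ x ≠ 0 → -2 * u ≤ x) → L 1 φ - L (-1) φ =
        2 * Real.pi * Complex.I * ((∫ p : ℕ × ℝ, φ p.2 * p.2 ^ ((4 - (d : ℝ)) / 2) *
          (gegPoly (((d : ℝ) - 2) / 2) p.1).eval (u / p.2) ∂X.spectralMeasure : ℝ) : ℂ) := by
  have hbv : ∀ σ : ℝ, ∀ φ : ℝ → ℝ, ∃ l : ℂ, |σ| = 1 → IsTest u φ → X.HasBoundaryValue σ u φ l := by
    intro σ φ
    by_cases h : |σ| = 1 ∧ IsTest u φ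
    · obtain ⟨Lp, Lm, hp, hm, -⟩ := hX.partial_waves u hu φ h.2
      rcases (abs_eq zero_le_one).1 h.1 with rfl | rfl
      · exact ⟨Lp, fun _ _ => hp⟩
      · exact ⟨Lm, fun _ _ => hm⟩
    · exact ⟨0, fun h1 h2 => absurd ⟨h1, h2⟩ h⟩
  choose LA hLA using hbv
  refine ⟨fun σ φ => LA σ φ - ∫ x : ℝ, (φ x : ℂ) * X.massless x u, fun σ hσ φ hφ => ?_,
    fun φ hφ hφs => ?_⟩
  · have hm := tendsto_integral_of_continuousOn (isOpen_compl_singleton (x := (0 : ℂ)))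
      (differentiableOn_massless (X := X) (u : ℂ)).continuousOn hφ.smooth.continuous hφ.compact
      (fun x hx => by
        have h1 : -u < x := hφ.supp hx
        have h2 : x ≠ 0 := by linarith
        simpa using h2) σ
    refine ((hLA σ φ hσ hφ).sub hm.2).congr' ?_
    filter_upwards [self_mem_nhdsWithin, hm.1] with ε hε i2
    have hε0 : (0 : ℝ) < ε := hε
    have hσ0 : σ ≠ 0 := by rintro rfl; simp at hσ
    have i1 : Integrable fun x : ℝ => (φ x : ℂ) *
        X.A ((x : ℂ) + ((σ * ε : ℝ) : ℂ) * Complex.I) u := by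
      refine ((Complex.continuous_ofReal.comp hφ.smooth.continuous).mul
        (hX.continuous_line hu (mul_ne_zero hσ0 hε0.ne'))).integrable_of_hasCompactSupport ?_
      exact (hφ.compact.comp_left (g := ((↑) : ℝ → ℂ)) Complex.ofReal_zero).mul_right
    rw [← integral_sub i1 i2]
    simp only [mul_sub]
  · rw [sub_sub_sub_cancel_right]
    exact hX.discontinuity hd hu hφ hφs (hLA 1 φ (by simp) hφ) (hLA (-1) φ (by simp) hφ)

/-! ### The Regge bound -/

theorem angDist_nonneg (s : ℂ) : 0 ≤ angDist s := div_nonneg Metric.infDist_nonneg (norm_nonneg s)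

theorem angDist_le_one (s : ℂ) : angDist s ≤ 1 := by
  refine div_le_one_of_le₀ ?_ (norm_nonneg s)
  have h0 : (0 : ℂ) ∈ posAxis := ⟨by simp, by simp⟩
  simpa using Metric.infDist_le_dist_of_mem h0 (x := s)

theorem abs_im_div_norm_le_angDist (s : ℂ) : |s.im| / ‖s‖ ≤ angDist s := by
  unfold angDist
  gcongr
  refine (Metric.le_infDist (⟨0, by simp, by simp⟩ : posAxis.Nonempty)).2 fun z hz => ?_
  rw [dist_eq_norm]
  have := Complex.abs_im_le_norm (s - z)
  rwa [Complex.sub_im, hz.1, sub_zero] at this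

/-- The exponent `max(α, J_0 + 1)` from which on the dispersion relations converge. -/
noncomputable def subtractions (X : SUAmplitude) : ℕ := (max X.α (X.J 0 + 1)).toNat

theorem Bootstrap.subtractions_cast (hX : X.Bootstrap d) :
    (X.subtractions : ℤ) = max X.α (X.J 0 + 1) := by
  have := hX.spin_massless
  rw [subtractions, Int.toNat_of_nonneg]
  exact le_max_of_le_right (by omega)

theorem Bootstrap.exists_massless_bound (hX : X.Bootstrap d) {u : ℝ} (hu : u < 0) :
    ∃ D : ℝ, 0 ≤ D ∧ ∀ s : ℂ, 1 ≤ ‖s‖ → ‖X.massless s u‖ * ‖s‖ ≤ D * ‖s‖ ^ X.subtractions := by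
  refine ⟨∑ j ∈ Finset.range (X.J 0 + 1).toNat, |X.lamSq j| * (|u| ^ j + |u|⁻¹),
    Finset.sum_nonneg fun j _ => by positivity, fun s hs => ?_⟩
  have hs0 : 0 < ‖s‖ := by linarith
  rw [massless, norm_neg]
  calc ‖∑ j ∈ Finset.range (X.J 0 + 1).toNat, (X.lamSq j : ℂ) * ((u : ℂ) ^ j / s + s ^ j / u)‖ * ‖s‖
      ≤ (∑ j ∈ Finset.range (X.J 0 + 1).toNat,
          |X.lamSq j| * (|u| ^ j / ‖s‖ + ‖s‖ ^ j / |u|)) * ‖s‖ := by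
        gcongr
        refine norm_sum_le_of_le _ fun j _ => ?_
        rw [norm_mul, Complex.norm_real, Real.norm_eq_abs]
        gcongr
        refine (norm_add_le _ _).trans ?_
        simp
    _ ≤ _ := by
        rw [Finset.sum_mul, Finset.sum_mul]
        refine Finset.sum_le_sum fun j hj => ?_
        have hj' : j + 1 ≤ X.subtractions := by
          have h1 := Finset.mem_range.1 hj
          have h2 := hX.subtractions_cast
          have h3 : X.J 0 + 1 ≤ (X.subtractions : ℤ) := by rw [h2]; exact le_max_right _ _
          omega
        have e1 : (1 : ℝ) ≤ ‖s‖ ^ X.subtractions := one_le_pow₀ hs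
        have e2 : ‖s‖ ^ (j + 1) ≤ ‖s‖ ^ X.subtractions := pow_le_pow_right₀ hs hj'
        have hu0 : 0 < |u| := abs_pos.2 hu.ne
        have e3 : |X.lamSq j| * (|u| ^ j / ‖s‖ + ‖s‖ ^ j / |u|) * ‖s‖ =
            |X.lamSq j| * (|u| ^ j * 1 + |u|⁻¹ * ‖s‖ ^ (j + 1)) := by
          rw [pow_succ]; field_simp
        rw [e3, mul_assoc, add_mul]
        gcongr

/-- The Regge bounds at fixed `u` and in the forward limit, with the same power of `angDist`. Where
`angDist` is small, the additional factor of it makes the forward bound as good as the one at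
fixed `u`. -/
theorem Bootstrap.exists_regge_bounds (hX : X.Bootstrap d) :
    ∃ (K : ℕ) (δ C R : ℝ), 0 < δ ∧ 0 ≤ C ∧
      (∀ u : ℝ, -δ < u → u < 0 → ∀ s : ℂ, s ∉ posAxis → R ≤ ‖s‖ →
        angDist s ^ K * ‖X.A s u - X.massless s u‖ ≤ C * ‖s‖ ^ X.subtractions) ∧
      ∀ u : ℝ, -δ < u → u < 0 → ∀ η : ℝ, 0 < η → ∃ R' : ℝ, ∀ s : ℂ, s ∉ posAxis → R' ≤ ‖s‖ →
        angDist s ^ K * ‖X.A s u - X.massless s u‖ ≤ η * ‖s‖ ^ X.subtractions := by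
  obtain ⟨M, δ, C, R, hδ, hfw⟩ := hX.regge_forward
  have hfw' : ∀ u : ℝ, -δ < u → u < 0 → ∀ s : ℂ, s ∉ posAxis → R ≤ ‖s‖ →
      angDist s ^ M * ‖X.A s u - X.massless s u‖ ≤ max C 0 * ‖s‖ ^ X.subtractions := by
    intro u h1 h2 s hs hR
    have h3 := hfw u h1 h2 s hs hR
    rw [← hX.subtractions_cast, zpow_natCast] at h3
    refine h3.trans ?_
    gcongr
    exact le_max_left _ _
  have hsucc : ∀ (s : ℂ) (B : ℝ), angDist s ^ (M + 1) * B = angDist s * (angDist s ^ M * B) :=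
    fun s B => by ring
  refine ⟨M + 1, δ, max C 0, R, hδ, le_max_right _ _, fun u h1 h2 s hs hR => ?_,
    fun u h1 h2 η hη => ?_⟩
  · rw [hsucc]
    refine (mul_le_of_le_one_left ?_ (angDist_le_one s)).trans (hfw' u h1 h2 s hs hR)
    have := angDist_nonneg s
    positivity
  obtain ⟨Mu, hMu⟩ := hX.regge u h2
  obtain ⟨D, hD0, hD⟩ := hX.exists_massless_bound h2
  -- below the angle `τ` the forward bound suffices
  set τ : ℝ := min 1 (η / (max C 0 + 1)) with hτ
  have hC1 : 0 < max C 0 + 1 := by have := le_max_right C 0; linarith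
  have hτ0 : 0 < τ := lt_min one_pos (by positivity)
  have hτC : τ * max C 0 ≤ η := by
    have h3 : τ ≤ η / (max C 0 + 1) := min_le_right _ _
    rw [le_div_iff₀ hC1] at h3
    nlinarith
  set η' : ℝ := η * τ ^ Mu / 2 with hη'
  have hη'0 : 0 < η' := by positivity
  have hev := (hMu.eventually_lt_const hη'0)
  rw [eventually_inf_principal, Filter.HasBasis.eventually_iff
    (Filter.hasBasis_cobounded_norm (E := ℂ))] at hev
  obtain ⟨R1, -, hR1⟩ := hev
  refine ⟨max (max R R1) (max 1 (D / η')), fun s hs hR => ?_⟩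
  have hRs : R ≤ ‖s‖ := (le_max_left _ _).trans ((le_max_left _ _).trans hR)
  have hR1s : R1 ≤ ‖s‖ := (le_max_right _ _).trans ((le_max_left _ _).trans hR)
  have h1s : 1 ≤ ‖s‖ := (le_max_left _ _).trans ((le_max_right _ _).trans hR)
  have hDs : D / η' ≤ ‖s‖ := (le_max_right _ _).trans ((le_max_right _ _).trans hR)
  have hs0 : 0 < ‖s‖ := by linarith
  have hθ0 := angDist_nonneg s
  have hθ1 := angDist_le_one s
  rcases le_or_gt (angDist s) τ with hθ | hθ
  · rw [hsucc]
    calc angDist s * (angDist s ^ M * ‖X.A s u - X.massless s u‖)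
        ≤ τ * (max C 0 * ‖s‖ ^ X.subtractions) :=
          mul_le_mul hθ (hfw' u h1 h2 s hs hRs) (by positivity) hτ0.le
      _ ≤ η * ‖s‖ ^ X.subtractions := by
          rw [← mul_assoc]; gcongr
  -- above the angle `τ`, the power of `angDist` in the bound at fixed `u` costs the constant
  -- `τ ^ Mu` that is built into `η'`
  · have hA : angDist s ^ Mu * ‖X.A s u‖ ≤ η' * ‖s‖ ^ X.subtractions := by
      have h3 := (hR1 (x := s) hR1s hs).le
      rw [mul_div_assoc', div_le_iff₀ (zpow_pos hs0 _)] at h3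
      refine h3.trans ?_
      gcongr
      rw [← zpow_natCast]
      refine zpow_le_zpow_right₀ h1s ?_
      rw [hX.subtractions_cast]
      exact le_max_left _ _
    have hm : ‖X.massless s u‖ ≤ η' * ‖s‖ ^ X.subtractions := by
      have h3 := hD s h1s
      rw [div_le_iff₀ hη'0] at hDs
      have h4 : ‖X.massless s u‖ * ‖s‖ ≤ (η' * ‖s‖ ^ X.subtractions) * ‖s‖ := by
        refine h3.trans ?_
        have : D * ‖s‖ ^ X.subtractions ≤ (‖s‖ * η') * ‖s‖ ^ X.subtractions := by gcongr
        linarith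
      exact le_of_mul_le_mul_right h4 hs0
    have hB : angDist s ^ Mu * ‖X.A s u - X.massless s u‖ ≤
        η * τ ^ Mu * ‖s‖ ^ X.subtractions := by
      calc angDist s ^ Mu * ‖X.A s u - X.massless s u‖
          ≤ angDist s ^ Mu * (‖X.A s u‖ + ‖X.massless s u‖) := by
            gcongr; exact norm_sub_le _ _
        _ ≤ angDist s ^ Mu * ‖X.A s u‖ + 1 * ‖X.massless s u‖ := by
            rw [mul_add]; gcongr; exact pow_le_one₀ hθ0 hθ1
        _ ≤ _ := by
            have : η * τ ^ Mu = η' + η' := by rw [hη']; ring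
            rw [this]; linarith
    have h5 : τ ^ Mu ≤ angDist s ^ Mu := by gcongr
    have h6 : τ ^ Mu * ‖X.A s u - X.massless s u‖ ≤ τ ^ Mu * (η * ‖s‖ ^ X.subtractions) := by
      calc _ ≤ angDist s ^ Mu * ‖X.A s u - X.massless s u‖ := by gcongr
        _ ≤ _ := hB
        _ = _ := by ring
    have h7 := le_of_mul_le_mul_left h6 (by positivity)
    calc angDist s ^ (M + 1) * ‖X.A s u - X.massless s u‖
        ≤ 1 * ‖X.A s u - X.massless s u‖ := by gcongr; exact pow_le_one₀ hθ0 hθ1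
      _ ≤ _ := by rw [one_mul]; exact h7

/-- The Regge bound in the scaled variable `z = s / R`, for use in the dispersion relation. -/
theorem scaled_regge_bound {B : ℂ → ℂ} {K β p : ℕ} {η R₀ R : ℝ} (hη : 0 ≤ η)
    (hB : ∀ s : ℂ, s ∉ posAxis → R₀ ≤ ‖s‖ → angDist s ^ K * ‖B s‖ ≤ η * ‖s‖ ^ β)
    (hR1 : 1 ≤ R) (hR : R₀ ≤ R) (hp : β ≤ p) {σ : ℝ} (hσ : |σ| = 1) {x y : ℝ} (hx : |x| ≤ 2)
    (hy : 0 < y) (hy1 : y ≤ 1) (hxy : 1 ≤ |x| ∨ y = 1) :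
    y ^ K * ‖(R : ℂ) * (B ((R : ℂ) * ((x : ℂ) + ((σ * y : ℝ) : ℂ) * Complex.I)) /
        ((R : ℂ) * ((x : ℂ) + ((σ * y : ℝ) : ℂ) * Complex.I)) ^ (p + 1))‖ ≤ 3 ^ K * η := by
  have hR0 : 0 < R := by linarith
  set z : ℂ := (x : ℂ) + ((σ * y : ℝ) : ℂ) * Complex.I with hz
  have hzim : z.im = σ * y := by simp [hz]
  have hz1 : 1 ≤ ‖z‖ := by
    rcases hxy with h1 | h1
    · refine h1.trans ?_
      have := Complex.abs_re_le_norm z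
      simpa [hz] using this
    · have := Complex.abs_im_le_norm z
      simpa [hz, h1, hσ] using this
  have hz3 : ‖z‖ ≤ 3 := by
    refine (norm_add_le _ _).trans ?_
    rw [norm_mul, Complex.norm_I, mul_one, Complex.norm_real, Complex.norm_real, Real.norm_eq_abs,
      Real.norm_eq_abs, abs_mul, hσ, one_mul, abs_of_pos hy]
    linarith
  have hz0 : 0 < ‖z‖ := by linarith
  set s : ℂ := (R : ℂ) * z with hs
  have hsn : ‖s‖ = R * ‖z‖ := by
    rw [hs, norm_mul, Complex.norm_real, Real.norm_of_nonneg hR0.le]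
  have hsim : |s.im| = R * y := by
    rw [hs, Complex.im_ofReal_mul, hzim, abs_mul, abs_mul, hσ, one_mul, abs_of_pos hR0,
      abs_of_pos hy]
  have hsP : s ∉ posAxis := by
    intro h
    rw [h.1, abs_zero] at hsim
    have := mul_pos hR0 hy
    linarith
  have hRs : R₀ ≤ ‖s‖ := by rw [hsn]; nlinarith
  -- from `|z| ≤ 3`
  have hyθ : y ≤ 3 * angDist s := by
    have h1 := abs_im_div_norm_le_angDist s
    rw [hsim, hsn, mul_div_mul_left _ _ hR0.ne', div_le_iff₀ hz0] at h1
    have := angDist_nonneg s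
    nlinarith
  have h1 := hB s hsP hRs
  have h2 : ‖s‖ ^ β * R ≤ ‖s‖ ^ (p + 1) := by
    rw [pow_succ]
    have h3 : 1 ≤ ‖s‖ := by rw [hsn]; nlinarith
    have h4 : R ≤ ‖s‖ := by rw [hsn]; nlinarith
    exact mul_le_mul (pow_le_pow_right₀ h3 hp) h4 hR0.le (by positivity)
  rw [norm_mul, norm_div, norm_pow, Complex.norm_real, Real.norm_of_nonneg hR0.le]
  have hs0 : 0 < ‖s‖ := by rw [hsn]; positivity
  rw [mul_div_assoc', mul_div_assoc', div_le_iff₀ (by positivity)]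
  have hθ := angDist_nonneg s
  calc y ^ K * (R * ‖B s‖) ≤ (3 * angDist s) ^ K * (R * ‖B s‖) := by gcongr
    _ = 3 ^ K * R * (angDist s ^ K * ‖B s‖) := by ring
    _ ≤ 3 ^ K * R * (η * ‖s‖ ^ β) := by gcongr
    _ = 3 ^ K * η * (‖s‖ ^ β * R) := by ring
    _ ≤ 3 ^ K * η * ‖s‖ ^ (p + 1) := by gcongr

end SUAmplitude

namespace SUAmplitude

variable {X : SUAmplitude} {d : ℕ}

/-! ### Moments of the spectral measure -/

/-- Below the first massive threshold the spectral measure vanishes. -/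
theorem Bootstrap.ae_threshold_le (hX : X.Bootstrap d) (hd : 3 ≤ d) (h1 : X.IsLevel 1) :
    ∀ᵐ p ∂X.spectralMeasure, X.m 1 ^ 2 ≤ p.2 := by
  filter_upwards [measure_eq_zero_iff_ae_notMem.1 (hX.null_below_cutoff hd), ae_snd_pos]
    with p hp hp0
  by_contra hlt
  refine hp ⟨(ENNReal.ofReal_le_ofReal (not_le.1 hlt).le).trans_lt (hX.sq_mass_lt h1), ?_⟩
  rintro ⟨n, hn, hpn⟩
  have hpn' : p.2 = X.m n ^ 2 := by exact_mod_cast hpn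
  rcases Nat.eq_zero_or_pos n with rfl | hn0
  · rw [hX.mass_zero] at hpn'
    simp at hpn'
    exact hp0.ne' hpn'
  · have hm1 := hX.mass_pos le_rfl h1
    have h2 : X.m 1 ≤ X.m n := by
      rcases (Nat.succ_le_of_lt hn0).eq_or_lt with h | h
      · rw [← h]
      · exact (hX.mass_lt 1 n h hn).le
    refine hlt ?_
    rw [hpn']
    gcongr

/-- The integrand of the dispersion relation for the coefficient of `s ^ p`, cut off at `s ∼ R`. -/
noncomputable def dispersionWeight (x₁ : ℝ) (d p : ℕ) (R x : ℝ) : ℝ :=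
  cutoff (x / R) * leftCut x₁ x / x ^ (p + 1) * x ^ ((4 - (d : ℝ)) / 2)

theorem dispersionWeight_nonneg {x₁ : ℝ} {d p : ℕ} {R x : ℝ} (hx : 0 ≤ x) :
    0 ≤ dispersionWeight x₁ d p R x :=
  mul_nonneg (div_nonneg (mul_nonneg cutoff.nonneg (leftCut_nonneg _ _)) (pow_nonneg hx _))
    (Real.rpow_nonneg hx _)

theorem dispersionWeight_le {x₁ : ℝ} {d p : ℕ} {R x : ℝ} (hx : 0 ≤ x) :
    dispersionWeight x₁ d p R x ≤ 1 / x ^ (p + 1) * x ^ ((4 - (d : ℝ)) / 2) := by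
  unfold dispersionWeight
  have h1 := Real.rpow_nonneg hx ((4 - (d : ℝ)) / 2)
  gcongr
  exact mul_le_one₀ cutoff.le_one (leftCut_nonneg _ _) (leftCut_le_one _ _)

theorem measurable_dispersionWeight (x₁ : ℝ) (d p : ℕ) (R : ℝ) :
    Measurable (dispersionWeight x₁ d p R) := by
  refine Measurable.mul (Measurable.div (Measurable.mul ?_ ?_) (by fun_prop)) (by fun_prop)
  · exact contDiff_cutoff.continuous.measurable.comp (measurable_id.div_const R)
  · exact (contDiff_leftCut x₁).continuous.measurable

theorem isTest_dispersion {x₁ u : ℝ} (hx₁ : 0 < x₁) (hu : u < 0) (hux : -u ≤ x₁ / 4) {R : ℝ}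
    (hR : 0 < R) (p : ℕ) : IsTest u fun x => cutoff (x / R) * leftCut x₁ x / x ^ (p + 1) := by
  refine IsTest.div_pow hu ⟨?_, ?_, ?_⟩ (p + 1)
  · exact (contDiff_cutoff.comp (by fun_prop)).mul (contDiff_leftCut x₁)
  · refine HasCompactSupport.mul_right (f := fun x => cutoff (x / R)) ?_
    refine HasCompactSupport.of_support_subset_isCompact
      (isCompact_closedBall (0 : ℝ) (2 * R)) fun x hx => ?_
    rw [mem_closedBall_zero_iff, Real.norm_eq_abs]
    by_contra hlt
    refine hx (cutoff_eq_zero ?_)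
    rw [abs_div, abs_of_pos hR, le_div_iff₀ hR]
    exact (not_le.1 hlt).le
  · intro x hx
    have h1 : x₁ / 2 ≤ x := by
      refine closure_minimal (t := Set.Ici (x₁ / 2)) (fun z hz => ?_) isClosed_Ici hx
      by_contra h
      refine hz ?_
      simp only
      rw [leftCut_eq_zero hx₁ (not_le.1 h).le, mul_zero]
    change -u < x
    linarith

theorem integrable_dispersionWeight (hX : X.Bootstrap d) {x₁ : ℝ} (hx₁ : 0 < x₁) {R : ℝ}
    (hR : 0 < R) (p : ℕ) :
    Integrable (fun w : ℕ × ℝ => dispersionWeight x₁ d p R w.2) X.spectralMeasure := by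
  have hK0 : Set.Icc (x₁ / 2) (2 * R) ⊆ Set.Ioi 0 := fun x hx => by
    have := hx.1
    change 0 < x
    linarith
  have hc : ContinuousOn (fun x : ℝ => 1 / x ^ (p + 1) * x ^ ((4 - (d : ℝ)) / 2))
      (Set.Icc (x₁ / 2) (2 * R)) := by
    intro x hx
    have h0 : x ≠ 0 := (hK0 hx).ne'
    refine ContinuousAt.continuousWithinAt (ContinuousAt.mul ?_
      (Real.continuousAt_rpow_const _ _ (Or.inl h0)))
    exact continuousAt_const.div (by fun_prop) (pow_ne_zero _ h0)
  obtain ⟨C, hC⟩ := isCompact_Icc.exists_bound_of_continuousOn hc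
  have hsupp : ∀ x, x ∉ Set.Icc (x₁ / 2) (2 * R) → dispersionWeight x₁ d p R x = 0 := by
    intro x hx
    unfold dispersionWeight
    rcases le_or_gt x (x₁ / 2) with h | h
    · simp [leftCut_eq_zero hx₁ h]
    · have h2 : 2 * R < x := by
        by_contra h3
        exact hx ⟨h.le, not_lt.1 h3⟩
      rw [cutoff_eq_zero (by
        rw [abs_div, abs_of_pos hR, le_div_iff₀ hR]
        exact h2.le.trans (le_abs_self x))]
      simp
  refine hX.integrable_of_bound (C := max C 0) isCompact_Icc hK0
    ((measurable_dispersionWeight x₁ d p R).comp measurable_snd) (fun j x => ?_)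
    fun j x hx => hsupp x hx
  by_cases hx : x ∈ Set.Icc (x₁ / 2) (2 * R)
  · have hx0 : 0 ≤ x := (hK0 hx).le
    change |dispersionWeight x₁ d p R x| ≤ _
    rw [abs_of_nonneg (dispersionWeight_nonneg hx0)]
    exact (dispersionWeight_le hx0).trans
      (((le_abs_self _).trans (hC x hx)).trans (le_max_left _ _))
  · change |dispersionWeight x₁ d p R x| ≤ _
    rw [hsupp x hx]
    simp

/-- The dispersion relations for the low-energy coefficients: with `p` at least the number of
subtractions, the smoothly cut off dispersion integral is bounded uniformly in `R` and in the
forward limit, and it converges to `∑_q c p q u ^ q` at fixed `u`. -/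
theorem Bootstrap.exists_dispersion (hX : X.Bootstrap d) (hd : 3 ≤ d) (h1 : X.IsLevel 1)
    {c : ℕ → ℕ → ℂ}
    (hc : ∀ s u : ℂ, s ≠ 0 → u ≠ 0 → ‖s‖ < X.m 1 ^ 2 → ‖u‖ < X.m 1 ^ 2 →
      HasSum (fun pq : ℕ × ℕ => c pq.1 pq.2 * s ^ pq.1 * u ^ pq.2) (X.A s u - X.massless s u)) :
    ∃ δ : ℝ, 0 < δ ∧ δ ≤ X.m 1 ^ 2 / 4 ∧ ∀ p : ℕ, X.subtractions ≤ p →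
      (∃ C R₀ : ℝ, 0 < R₀ ∧ ∀ u : ℝ, -δ < u → u < 0 → ∀ R : ℝ, R₀ ≤ R →
        |∫ w : ℕ × ℝ, dispersionWeight (X.m 1 ^ 2) d p R w.2 *
          (gegPoly (((d : ℝ) - 2) / 2) w.1).eval (u / w.2) ∂X.spectralMeasure| ≤ C) ∧
      ∀ u : ℝ, -δ < u → u < 0 → Tendsto (fun R : ℝ =>
        ((∫ w : ℕ × ℝ, dispersionWeight (X.m 1 ^ 2) d p R w.2 *
          (gegPoly (((d : ℝ) - 2) / 2) w.1).eval (u / w.2) ∂X.spectralMeasure : ℝ) : ℂ)) atTop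
        (𝓝 (∑' q, c p q * (u : ℂ) ^ q)) := by
  set x₁ := X.m 1 ^ 2 with hx₁def
  have hx₁ : 0 < x₁ := by have := hX.mass_pos le_rfl h1; positivity
  obtain ⟨K, δ₀, C₁, R₁, hδ₀, hC₁, hunif, hfix⟩ := hX.exists_regge_bounds
  obtain ⟨C₂, hC₂, hdisp⟩ := exists_norm_discontinuity_sub_coeff_le K
  refine ⟨min δ₀ (x₁ / 4), lt_min hδ₀ (by positivity), min_le_right _ _, fun p hp => ?_⟩
  -- the coefficients of the expansion in `s` at fixed `u`
  let b : ℝ → ℕ → ℂ := fun u k => ∑' q, c k q * (u : ℂ) ^ q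
  have hhalf : ‖((x₁ / 2 : ℝ) : ℂ)‖ < x₁ := by
    rw [Complex.norm_real, Real.norm_of_nonneg (by positivity)]; linarith
  have hhalf0 : ((x₁ / 2 : ℝ) : ℂ) ≠ 0 := by
    have : (x₁ / 2 : ℝ) ≠ 0 := by positivity
    exact_mod_cast this
  have hsumq : ∀ k, Summable fun q => ‖c k q‖ * (x₁ / 2) ^ q := by
    intro k
    have h2 := ((hc _ _ hhalf0 hhalf0 hhalf hhalf).summable.prod_factor k).norm.mul_left
      ((((x₁ / 2 : ℝ)) ^ k)⁻¹)
    refine h2.congr fun q => ?_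
    rw [norm_mul, norm_mul, norm_pow, norm_pow, Complex.norm_real,
      Real.norm_of_nonneg (by positivity)]
    have : (x₁ / 2 : ℝ) ^ k ≠ 0 := by positivity
    field_simp
  have hbb : ∀ u : ℝ, -(x₁ / 4) < u → u < 0 → ∀ k, ‖b u k‖ ≤ ∑' q, ‖c k q‖ * (x₁ / 2) ^ q := by
    intro u hu1 hu k
    refine tsum_of_norm_bounded (hsumq k).hasSum fun q => ?_
    rw [norm_mul, norm_pow, Complex.norm_real, Real.norm_eq_abs, abs_of_neg hu]
    have : -u ≤ x₁ / 2 := by linarith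
    gcongr
    linarith
  have hbs : ∀ u : ℝ, -(x₁ / 4) < u → u < 0 → ∀ s : ℂ, s ≠ 0 → ‖s‖ < x₁ →
      HasSum (fun k => b u k * s ^ k) (X.A s u - X.massless s u) := by
    intro u hu1 hu s hs hs1
    have hu0 : (u : ℂ) ≠ 0 := by exact_mod_cast hu.ne
    have hun : ‖(u : ℂ)‖ < x₁ := by
      rw [Complex.norm_real, Real.norm_eq_abs, abs_of_neg hu]; linarith
    have h2 := hc s u hs hu0 hs1 hun
    refine (h2.prod_fiberwise fun k => (h2.summable.prod_factor k).hasSum).congr_fun fun k => ?_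
    rw [← tsum_mul_right]
    exact tsum_congr fun q => by ring
  -- the finite-energy dispersion relation
  have hmain : ∀ u : ℝ, -(min δ₀ (x₁ / 4)) < u → u < 0 → ∀ η R₀ : ℝ, 0 ≤ η →
      (∀ s : ℂ, s ∉ posAxis → R₀ ≤ ‖s‖ →
        angDist s ^ K * ‖X.A s u - X.massless s u‖ ≤ η * ‖s‖ ^ X.subtractions) →
      ∀ R, 1 ≤ R → R₀ ≤ R →
      ‖((∫ w : ℕ × ℝ, dispersionWeight x₁ d p R w.2 *
          (gegPoly (((d : ℝ) - 2) / 2) w.1).eval (u / w.2) ∂X.spectralMeasure : ℝ) : ℂ) - b u p‖ ≤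
        C₂ * (3 ^ K * η + ∑ k ∈ Finset.range p, ‖b u k‖ * (R ^ (p - k))⁻¹) := by
    intro u hu1 hu η R₀ hη hB R hR1 hR
    have hR0 : 0 < R := by linarith
    have hu2 : -(x₁ / 4) < u := by
      have := min_le_right δ₀ (x₁ / 4); linarith
    obtain ⟨L, hL, hLdisc⟩ := hX.exists_boundary_values hd hu
    have hBd : DifferentiableOn ℂ (fun s => X.A s u - X.massless s u) posAxisᶜ :=
      (hX.differentiableOn_amplitude hu).sub ((differentiableOn_massless (u : ℂ)).mono
        fun s hs => ne_zero_of_notMem_posAxis hs)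
    have h3 := hdisp (fun s => X.A s u - X.massless s u) (b u) x₁ u R (3 ^ K * η) p L hBd hu hx₁
      (by linarith) (hbs u hu2 hu) hL hR0 (by positivity)
      (fun σ hσ x y hx hy hy1 hxy =>
        scaled_regge_bound hη hB hR1 hR hp hσ hx hy hy1 hxy)
    have htest := isTest_dispersion hx₁ hu (by linarith) hR0 p
    have h4 := hLdisc _ htest fun x hx => by
      by_contra hlt
      refine hx ?_
      rw [leftCut_eq_zero hx₁ (by linarith), mul_zero, zero_div]
    rw [h4, ← mul_sub, norm_mul] at h3
    have h5 : (1 : ℝ) ≤ ‖(2 * Real.pi * Complex.I : ℂ)‖ := by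
      rw [norm_mul, norm_mul, Complex.norm_I, mul_one, Complex.norm_ofNat, Complex.norm_real,
        Real.norm_of_nonneg Real.pi_pos.le]
      linarith [Real.pi_gt_three]
    exact (le_mul_of_one_le_left (norm_nonneg _) h5).trans h3
  constructor
  · set N : ℕ → ℝ := fun k => ∑' q, ‖c k q‖ * (x₁ / 2) ^ q with hN
    refine ⟨C₂ * (3 ^ K * C₁ + ∑ k ∈ Finset.range p, N k) + N p, max R₁ 1, by positivity,
      fun u hu1 hu R hR => ?_⟩
    have hR1 : 1 ≤ R := (le_max_right _ _).trans hR
    have hu2 : -(x₁ / 4) < u := by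
      have := min_le_right δ₀ (x₁ / 4); linarith
    have hu3 : -δ₀ < u := by
      have := min_le_left δ₀ (x₁ / 4); linarith
    have h2 := hmain u hu1 hu C₁ R₁ hC₁ (hunif u hu3 hu) R hR1 ((le_max_left _ _).trans hR)
    have h3 : ∑ k ∈ Finset.range p, ‖b u k‖ * (R ^ (p - k))⁻¹ ≤ ∑ k ∈ Finset.range p, N k := by
      refine Finset.sum_le_sum fun k _ => ?_
      have h4 : (R ^ (p - k))⁻¹ ≤ 1 := inv_le_one_of_one_le₀ (one_le_pow₀ hR1)
      calc _ ≤ ‖b u k‖ * 1 := by gcongr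
        _ ≤ N k := by rw [mul_one]; exact hbb u hu2 hu k
    have h5 := norm_sub_norm_le ((∫ w : ℕ × ℝ, dispersionWeight x₁ d p R w.2 *
          (gegPoly (((d : ℝ) - 2) / 2) w.1).eval (u / w.2) ∂X.spectralMeasure : ℝ) : ℂ) (b u p)
    rw [Complex.norm_real, Real.norm_eq_abs] at h5
    have h6 := hbb u hu2 hu p
    have h7 : C₂ * (3 ^ K * C₁ + ∑ k ∈ Finset.range p, ‖b u k‖ * (R ^ (p - k))⁻¹) ≤
        C₂ * (3 ^ K * C₁ + ∑ k ∈ Finset.range p, N k) := by gcongr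
    linarith
  · intro u hu1 hu
    have hu3 : -δ₀ < u := by
      have := min_le_left δ₀ (x₁ / 4); linarith
    rw [Metric.tendsto_atTop]
    intro ε hε
    have hpow : Tendsto (fun R : ℝ => ∑ k ∈ Finset.range p, ‖b u k‖ * (R ^ (p - k))⁻¹) atTop
        (𝓝 0) := by
      have h2 : ∀ k ∈ Finset.range p,
          Tendsto (fun R : ℝ => ‖b u k‖ * (R ^ (p - k))⁻¹) atTop (𝓝 0) := by
        intro k hk
        have hk' : p - k ≠ 0 := by
          have := Finset.mem_range.1 hk; omega
        simpa using (tendsto_inv_atTop_zero.comp (tendsto_pow_atTop hk')).const_mul ‖b u k‖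
      simpa using tendsto_finsetSum _ h2
    set τ := ε / (2 * (C₂ + 1)) with hτ
    have hτ0 : 0 < τ := by positivity
    have hη : (0 : ℝ) < τ / 3 ^ K := by positivity
    obtain ⟨R₀, hR₀⟩ := hfix u hu3 hu _ hη
    obtain ⟨R₂, hR₂⟩ := eventually_atTop.1 (hpow.eventually_lt_const hτ0)
    refine ⟨max (max 1 R₀) R₂, fun R hR => ?_⟩
    have h2 := hmain u hu1 hu _ R₀ hη.le hR₀ R
      ((le_max_left _ _).trans ((le_max_left _ _).trans hR))
      ((le_max_right _ _).trans ((le_max_left _ _).trans hR))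
    have h3 := hR₂ R ((le_max_right _ _).trans hR)
    rw [dist_eq_norm]
    refine h2.trans_lt ?_
    have h4 : (3 : ℝ) ^ K * (τ / 3 ^ K) = τ := by field_simp
    rw [h4]
    calc C₂ * (τ + ∑ k ∈ Finset.range p, ‖b u k‖ * (R ^ (p - k))⁻¹) ≤ C₂ * (τ + τ) := by gcongr
      _ < (C₂ + 1) * (τ + τ) := by gcongr; linarith
      _ = ε := by rw [hτ]; field_simp; norm_num

theorem iterate_derivative_comp_C_mul_X (P : Polynomial ℝ) (a : ℝ) (q : ℕ) :
    Polynomial.derivative^[q] (P.comp (Polynomial.C a * Polynomial.X)) =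
      Polynomial.C (a ^ q) * (Polynomial.derivative^[q] P).comp (Polynomial.C a * Polynomial.X) := by
  induction q with
  | zero => simp
  | succ q ih =>
    rw [Function.iterate_succ_apply', ih, Polynomial.derivative_C_mul, Polynomial.derivative_comp,
      Function.iterate_succ_apply']
    simp only [Polynomial.derivative_mul, Polynomial.derivative_C, zero_mul,
      Polynomial.derivative_X, mul_one, zero_add, pow_succ, Polynomial.C_mul]
    ring

/-- The moments of the spectral measure are the low-energy coefficients: for `p` at least the number
of subtractions, the coefficient of `s ^ p u ^ q` is a positive sum over the states of spin at
least `q`. In particular these moments are symmetric in `p` and `q`. -/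
theorem Bootstrap.exists_moments (hX : X.Bootstrap d) (hd : 3 ≤ d) (h1 : X.IsLevel 1) :
    ∃ r : ℕ → ℕ → ℝ, (∀ p q, r p q = r q p) ∧ ∀ p q, X.subtractions ≤ p →
      Integrable (fun w : ℕ × ℝ => w.2 ^ ((4 - (d : ℝ)) / 2) * (w.2⁻¹) ^ (p + 1 + q) *
        gegCoeff (((d : ℝ) - 2) / 2) w.1 q) X.spectralMeasure ∧
      ∫ w : ℕ × ℝ, w.2 ^ ((4 - (d : ℝ)) / 2) * (w.2⁻¹) ^ (p + 1 + q) *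
        gegCoeff (((d : ℝ) - 2) / 2) w.1 q ∂X.spectralMeasure = r p q := by
  obtain ⟨a, hsymm, ha⟩ := hX.exists_coefficients h1
  refine ⟨fun p q => (a p q).re, fun p q => congrArg Complex.re (hsymm p q), fun p q hp => ?_⟩
  obtain ⟨δ, hδ, hδx, hdisp⟩ := hX.exists_dispersion hd h1 ha
  obtain ⟨⟨C, R₀, hR₀, hbound⟩, hlim⟩ := hdisp p hp
  set x₁ := X.m 1 ^ 2 with hx₁def
  have hx₁ : 0 < x₁ := by have := hX.mass_pos le_rfl h1; positivity
  set c : ℝ := ((d : ℝ) - 2) / 2 with hcdef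
  have hc : 1 / 2 ≤ c := Bootstrap.half_le hd
  set κ : ℝ → ℝ := fun x => x ^ ((4 - (d : ℝ)) / 2) with hκ
  have hthr := hX.ae_threshold_le hd h1
  set W : ℝ → ℝ → ℝ := dispersionWeight x₁ d p with hW
  set Wlim : ℝ → ℝ := fun x => 1 / x ^ (p + 1) * κ x with hWlim
  have hWm : ∀ R, Measurable fun w : ℕ × ℝ => W R w.2 := fun R =>
    (measurable_dispersionWeight x₁ d p R).comp measurable_snd
  have hWi : ∀ R, 0 < R → Integrable (fun w : ℕ × ℝ => W R w.2) X.spectralMeasure := fun R hR =>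
    integrable_dispersionWeight hX hx₁ hR p
  have hWlimm : Measurable fun w : ℕ × ℝ => Wlim w.2 := by
    refine Measurable.mul (by fun_prop) (measurable_snd.pow_const _)
  have hQ1 : ∀ u : ℝ, -δ < u → u ≤ 0 → ∀ w : ℕ × ℝ, x₁ ≤ w.2 →
      |(gegPoly c w.1).eval (u / w.2)| ≤ 1 := by
    intro u hu1 hu w hw
    have hw0 : 0 < w.2 := by linarith
    refine abs_gegPoly_eval_le hc _ ?_ (div_nonpos_of_nonpos_of_nonneg hu hw0.le)
    rw [le_div_iff₀ hw0]; linarith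
  -- forward limit at fixed cut-off
  have hfwd : ∀ R, R₀ ≤ R → ∫ w : ℕ × ℝ, W R w.2 ∂X.spectralMeasure ≤ C := by
    intro R hR
    have hR0 : 0 < R := hR₀.trans_le hR
    have hev : ∀ᶠ u in 𝓝[<] (0 : ℝ), -δ < u ∧ u < 0 := Ioo_mem_nhdsLT (by linarith : -δ < 0)
    have ht : Tendsto (fun u : ℝ => ∫ w : ℕ × ℝ, W R w.2 *
        (gegPoly c w.1).eval (u / w.2) ∂X.spectralMeasure) (𝓝[<] 0)
        (𝓝 (∫ w : ℕ × ℝ, W R w.2 ∂X.spectralMeasure)) := by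
      refine tendsto_integral_filter_of_dominated_convergence (fun w => |W R w.2|)
        (Eventually.of_forall fun u =>
          ((hWm R).mul (measurable_gegPoly_eval_div _ u)).aestronglyMeasurable) ?_ (hWi R hR0).abs ?_
      · filter_upwards [hev] with u hu
        filter_upwards [hthr] with w hw
        rw [norm_mul, Real.norm_eq_abs, Real.norm_eq_abs]
        exact mul_le_of_le_one_right (abs_nonneg _) (hQ1 u hu.1 hu.2.le w hw)
      · refine Eventually.of_forall fun w => ?_
        have h2 : Continuous fun u : ℝ => W R w.2 * (gegPoly c w.1).eval (u / w.2) :=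
          continuous_const.mul ((Polynomial.continuous _).comp (by fun_prop))
        simpa [gegPoly_eval_zero] using (h2.tendsto 0).mono_left
          (nhdsWithin_le_nhds (s := Set.Iio 0))
    refine le_of_tendsto ht ?_
    filter_upwards [hev] with u hu
    exact (le_abs_self _).trans (hbound u hu.1 hu.2 R hR)
  -- the weight without cut-off is the limit
  have hptR : ∀ w : ℕ × ℝ, x₁ ≤ w.2 → ∀ R, 0 < R → w.2 ≤ R → W R w.2 = Wlim w.2 := by
    intro w hw R hR0 hR
    simp only [hW, dispersionWeight, hWlim]
    rw [cutoff_eq_one (by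
      rw [abs_div, abs_of_pos hR0, abs_of_pos (by linarith), div_le_one hR0]; exact hR),
      leftCut_eq_one hx₁ (by linarith), one_mul]
  have hpt : ∀ w : ℕ × ℝ, x₁ ≤ w.2 → Tendsto (fun R => W R w.2) atTop (𝓝 (Wlim w.2)) := by
    intro w hw
    refine tendsto_const_nhds.congr' ?_
    filter_upwards [eventually_ge_atTop w.2] with R hR
    exact (hptR w hw R (by linarith) hR).symm
  have hWlim_nonneg : ∀ w : ℕ × ℝ, x₁ ≤ w.2 → 0 ≤ Wlim w.2 := by
    intro w hw
    have hw0 : 0 ≤ w.2 := by linarith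
    have := Real.rpow_nonneg hw0 ((4 - (d : ℝ)) / 2)
    simp only [hWlim, hκ]; positivity
  have hWlim_int : Integrable (fun w : ℕ × ℝ => Wlim w.2) X.spectralMeasure := by
    refine ⟨hWlimm.aestronglyMeasurable, ?_⟩
    rw [hasFiniteIntegral_iff_ofReal (hthr.mono hWlim_nonneg)]
    have hseq : Tendsto (fun n : ℕ => (n : ℝ)) atTop atTop := tendsto_natCast_atTop_atTop
    calc ∫⁻ w, ENNReal.ofReal (Wlim w.2) ∂X.spectralMeasure
        = ∫⁻ w, liminf (fun n : ℕ => ENNReal.ofReal (W n w.2)) atTop ∂X.spectralMeasure := by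
          refine lintegral_congr_ae (hthr.mono fun w hw => ?_)
          exact (((ENNReal.continuous_ofReal.tendsto _).comp
            ((hpt w hw).comp hseq)).liminf_eq).symm
      _ ≤ liminf (fun n : ℕ => ∫⁻ w, ENNReal.ofReal (W n w.2) ∂X.spectralMeasure) atTop :=
          lintegral_liminf_le fun n => (hWm n).ennreal_ofReal
      _ ≤ ENNReal.ofReal C := by
          refine Filter.liminf_le_of_frequently_le' (Eventually.frequently ?_)
          filter_upwards [hseq.eventually_ge_atTop R₀] with n hn
          have hn0 : (0 : ℝ) < n := hR₀.trans_le hn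
          rw [← ofReal_integral_eq_lintegral_ofReal (hWi n hn0)
            (ae_snd_pos.mono fun w hw => dispersionWeight_nonneg hw.le)]
          exact ENNReal.ofReal_le_ofReal (hfwd n hn)
      _ < ⊤ := ENNReal.ofReal_lt_top
  -- the unsubtracted dispersion relation at fixed `u`
  have hrel : ∀ u : ℝ, -δ < u → u < 0 → ((∫ w : ℕ × ℝ, Wlim w.2 *
      (gegPoly c w.1).eval (u / w.2) ∂X.spectralMeasure : ℝ) : ℂ) =
      ∑' q, a p q * (u : ℂ) ^ q := by
    intro u hu1 hu
    refine tendsto_nhds_unique ((Complex.continuous_ofReal.tendsto _).comp ?_) (hlim u hu1 hu)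
    refine tendsto_integral_filter_of_dominated_convergence (fun w => |Wlim w.2|)
      (Eventually.of_forall fun R =>
        ((hWm R).mul (measurable_gegPoly_eval_div _ u)).aestronglyMeasurable) ?_ hWlim_int.abs ?_
    · refine Eventually.of_forall fun R => ?_
      filter_upwards [hthr] with w hw
      have hw0 : 0 ≤ w.2 := by linarith
      rw [norm_mul, Real.norm_eq_abs, Real.norm_eq_abs]
      refine (mul_le_of_le_one_right (abs_nonneg _) (hQ1 u hu1 hu.le w hw)).trans ?_
      rw [abs_of_nonneg (dispersionWeight_nonneg hw0)]
      exact (dispersionWeight_le hw0).trans (le_abs_self _)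
    · filter_upwards [hthr] with w hw
      exact (hpt w hw).mul_const _
  have hhalf0 : ((x₁ / 2 : ℝ) : ℂ) ≠ 0 := by
    have : (x₁ / 2 : ℝ) ≠ 0 := by positivity
    exact_mod_cast this
  have hhalf : ‖((x₁ / 2 : ℝ) : ℂ)‖ < x₁ := by
    rw [Complex.norm_real, Real.norm_of_nonneg (by positivity)]; linarith
  have hsumq : Summable fun q => ‖a p q‖ * δ ^ q := by
    have h2 := ((ha _ _ hhalf0 hhalf0 hhalf hhalf).summable.prod_factor p).norm.mul_left
      ((((x₁ / 2 : ℝ)) ^ p)⁻¹)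
    refine h2.of_nonneg_of_le (fun q => by positivity) fun q => ?_
    rw [norm_mul, norm_mul, norm_pow, norm_pow, Complex.norm_real,
      Real.norm_of_nonneg (by positivity)]
    have h3 : (x₁ / 2 : ℝ) ^ p ≠ 0 := by positivity
    have h4 : ((x₁ / 2) ^ p)⁻¹ * (‖a p q‖ * (x₁ / 2) ^ p * (x₁ / 2) ^ q) =
        ‖a p q‖ * (x₁ / 2) ^ q := by field_simp
    rw [h4]
    gcongr
    linarith
  -- the Taylor expansion in the forward limit
  let P : ℕ × ℝ → Polynomial ℝ := fun w =>
    Polynomial.C (Wlim w.2) * (gegPoly c w.1).comp (Polynomial.C w.2⁻¹ * Polynomial.X)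
  have hPit : ∀ q w y, (Polynomial.derivative^[q] (P w)).eval y = Wlim w.2 * ((w.2⁻¹) ^ q *
      (Polynomial.derivative^[q] (gegPoly c w.1)).eval (y / w.2)) := by
    intro q w y
    simp only [P]
    rw [Polynomial.iterate_derivative_C_mul, iterate_derivative_comp_C_mul_X]
    simp only [Polynomial.eval_mul, Polynomial.eval_C, Polynomial.eval_comp, Polynomial.eval_X]
    rw [div_eq_inv_mul]
  have key := integral_coeff_of_hasSum (ν := X.spectralMeasure) (p := P) hδ
    (fun q y => by
      simp only [hPit]
      refine Measurable.aestronglyMeasurable (hWlimm.mul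
        ((measurable_snd.inv.pow_const q).mul ?_))
      exact measurable_from_prod_countable_right fun j =>
        (Polynomial.continuous (Polynomial.derivative^[q] (gegPoly c j))).measurable.comp
          (show Measurable fun x : ℝ => y / x from measurable_const.div measurable_id))
    (by
      filter_upwards [hthr] with w hw q y hy1 hy2
      have hw0 : 0 < w.2 := by linarith
      have h2 := hWlim_nonneg w hw
      have h3 : 0 ≤ (w.2⁻¹) ^ q := by positivity
      rw [hPit, hPit, abs_mul (Wlim w.2), abs_mul (w.2⁻¹ ^ q), abs_of_nonneg h2, abs_of_nonneg h3,
        zero_div]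
      gcongr
      refine abs_iterate_derivative_gegPoly_le q hc w.1 ?_
        (div_nonpos_of_nonpos_of_nonneg hy2 hw0.le)
      rw [le_div_iff₀ hw0]; linarith)
    (by
      refine hWlim_int.congr (Eventually.of_forall fun w => ?_)
      have := hPit 0 w 0
      simp only [Function.iterate_zero, id, pow_zero, zero_div, gegPoly_eval_zero,
        mul_one] at this
      exact this.symm)
    (e := fun q => (a p q).re)
    (hsumq.of_nonneg_of_le (fun q => by positivity) fun q => by
      gcongr; exact Complex.abs_re_le_norm _)
    (fun u hu1 hu => by
      have h2 := hrel u hu1 hu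
      have h3 : Summable fun q => a p q * (u : ℂ) ^ q := by
        refine Summable.of_norm_bounded hsumq fun q => ?_
        rw [norm_mul, norm_pow, Complex.norm_real, Real.norm_eq_abs, abs_of_neg hu]
        have : -u ≤ δ := by linarith
        gcongr
        linarith
      have h4 := (Complex.hasSum_re h3.hasSum).tsum_eq
      rw [← h2, Complex.ofReal_re] at h4
      have h5 : ∀ w, (P w).eval u = Wlim w.2 * (gegPoly c w.1).eval (u / w.2) := by
        intro w
        have := hPit 0 w u
        simpa using this
      simp only [h5]
      rw [← h4]
      refine tsum_congr fun q => ?_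
      rw [← Complex.ofReal_pow, Complex.re_mul_ofReal]) q
  have hco : ∀ w : ℕ × ℝ, (P w).coeff q =
      w.2 ^ ((4 - (d : ℝ)) / 2) * (w.2⁻¹) ^ (p + 1 + q) * gegCoeff c w.1 q := by
    intro w
    simp only [P, hWlim, hκ]
    rw [Polynomial.coeff_C_mul, Polynomial.comp_C_mul_X_coeff, coeff_gegPoly, pow_add, one_div,
      inv_pow]
    ring
  simp only [hco] at key
  exact key

end SUAmplitude

/-! ### Growth of the moments -/

/-- The integrand `x ^ e * x ^ (-(p + 1 + q)) * v_{j,q}`, at spin `j = w.1` and energy squared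
`x = w.2`, of the moment that equals the coefficient of `s ^ p u ^ q` in the low-energy expansion,
where `v_{j,q}` are the Taylor coefficients of the Gegenbauer polynomials. -/
noncomputable def momentWeight (e c : ℝ) (p q : ℕ) (w : ℕ × ℝ) : ℝ :=
  w.2 ^ e * (w.2⁻¹) ^ (p + 1 + q) * gegCoeff c w.1 q

theorem momentWeight_nonneg {e c : ℝ} (hc : 1 / 2 ≤ c) (p q : ℕ) {w : ℕ × ℝ} (hw : 0 < w.2) :
    0 ≤ momentWeight e c p q w := by
  have := Real.rpow_pos_of_pos hw e
  have := gegCoeff_nonneg hc w.1 q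
  unfold momentWeight
  positivity

theorem momentWeight_eq_zero {e c : ℝ} (p : ℕ) {q : ℕ} {w : ℕ × ℝ} (h : w.1 < q) :
    momentWeight e c p q w = 0 := by
  rw [momentWeight, gegCoeff_eq_zero _ h, mul_zero]

theorem momentWeight_add (e c : ℝ) (p k q : ℕ) (w : ℕ × ℝ) :
    momentWeight e c (p + k) q w = (w.2⁻¹) ^ k * momentWeight e c p q w := by
  unfold momentWeight
  ring

section Moments

variable {ν : Measure (ℕ × ℝ)} {e c : ℝ} {β : ℕ} {r : ℕ → ℕ → ℝ}

/-- Symmetric moments are log-convex in either index: as a function of `q`,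
`r n q = r q n` is a moment sequence of a positive measure on the powers of `x⁻¹`. -/
theorem sq_moment_le (hc : 1 / 2 ≤ c) (hν : ∀ᵐ w ∂ν, 0 < w.2) (hsymm : ∀ p q, r p q = r q p)
    (hr : ∀ p q, β ≤ p → Integrable (momentWeight e c p q) ν ∧
      ∫ w, momentWeight e c p q w ∂ν = r p q)
    (n : ℕ) {q : ℕ} (hq : β ≤ q) : r n (q + 1) ^ 2 ≤ r n q * r n (q + 2) := by
  obtain ⟨i0, h0⟩ := hr q n hq
  obtain ⟨i1, h1⟩ := hr (q + 1) n (by omega)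
  obtain ⟨i2, h2⟩ := hr (q + 2) n (by omega)
  have key : ∀ t : ℝ, 0 ≤ r n (q + 2) * (t * t) + (-2 * r n (q + 1)) * t + r n q := by
    intro t
    have h3 : ∫ w, (t ^ 2 * momentWeight e c (q + 2) n w - 2 * t * momentWeight e c (q + 1) n w +
        momentWeight e c q n w) ∂ν = t ^ 2 * r n (q + 2) - 2 * t * r n (q + 1) + r n q := by
      rw [integral_add (f := fun w => t ^ 2 * momentWeight e c (q + 2) n w -
          2 * t * momentWeight e c (q + 1) n w) ((i2.const_mul _).sub (i1.const_mul _)) i0,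
        integral_sub (i2.const_mul _) (i1.const_mul _), integral_const_mul, integral_const_mul,
        h0, h1, h2, hsymm q, hsymm (q + 1), hsymm (q + 2)]
    have h4 : 0 ≤ ∫ w, (t ^ 2 * momentWeight e c (q + 2) n w -
        2 * t * momentWeight e c (q + 1) n w + momentWeight e c q n w) ∂ν := by
      refine integral_nonneg_of_ae (hν.mono fun w hw => ?_)
      have h5 : t ^ 2 * momentWeight e c (q + 2) n w - 2 * t * momentWeight e c (q + 1) n w +
          momentWeight e c q n w = (t * w.2⁻¹ - 1) ^ 2 * momentWeight e c q n w := by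
        rw [momentWeight_add, momentWeight_add]
        ring
      refine le_of_le_of_eq ?_ h5.symm
      exact mul_nonneg (sq_nonneg _) (momentWeight_nonneg hc _ _ hw)
    rw [h3] at h4
    linarith
  have := discrim_le_zero key
  rw [discrim] at this
  linarith

/-- If all the spins `≥ j` sit at `x ≥ y`, then `r n i = O(y ^ (-n))` for `i ≥ j`. -/
theorem moment_mul_pow_le (hc : 1 / 2 ≤ c) (hν : ∀ᵐ w ∂ν, 0 < w.2)
    (hr : ∀ p q, β ≤ p → Integrable (momentWeight e c p q) ν ∧
      ∫ w, momentWeight e c p q w ∂ν = r p q)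
    {y : ℝ} (hy : 0 < y) {i : ℕ} (hs : ∀ᵐ w ∂ν, i ≤ w.1 → y ≤ w.2) {n : ℕ} (hn : β ≤ n) :
    r n i * y ^ n ≤ r β i * y ^ β := by
  obtain ⟨k, rfl⟩ := Nat.exists_eq_add_of_le hn
  obtain ⟨i0, h0⟩ := hr β i le_rfl
  obtain ⟨i1, h1⟩ := hr (β + k) i hn
  rw [← h0, ← h1, ← integral_mul_const, ← integral_mul_const]
  refine integral_mono_ae (i1.mul_const _) (i0.mul_const _) ?_
  filter_upwards [hν, hs] with w hw hws
  rcases lt_or_ge w.1 i with h | h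
  · simp [momentWeight_eq_zero _ h]
  · have h2 : w.2⁻¹ * y ≤ 1 := by
      rw [inv_mul_le_iff₀ hw, mul_one]
      exact hws h
    have h3 : momentWeight e c (β + k) i w * y ^ (β + k) =
        (w.2⁻¹ * y) ^ k * (momentWeight e c β i w * y ^ β) := by
      rw [momentWeight_add]
      ring
    rw [h3]
    have := momentWeight_nonneg (e := e) hc β i hw
    exact mul_le_of_le_one_left (by positivity) (pow_le_one₀ (by positivity) h2)

/-- If all the spins `≥ i` sit strictly above `y`, then `r n i = o(y ^ (-n))`. -/
theorem tendsto_moment_mul_pow (hc : 1 / 2 ≤ c) (hν : ∀ᵐ w ∂ν, 0 < w.2)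
    (hr : ∀ p q, β ≤ p → Integrable (momentWeight e c p q) ν ∧
      ∫ w, momentWeight e c p q w ∂ν = r p q)
    {y : ℝ} (hy : 0 < y) {i : ℕ} (hs : ∀ᵐ w ∂ν, i ≤ w.1 → y < w.2) :
    Tendsto (fun k => r (β + k) i * y ^ (β + k)) atTop (𝓝 0) := by
  obtain ⟨i0, -⟩ := hr β i le_rfl
  have h3 : ∀ k w, momentWeight e c (β + k) i w * y ^ (β + k) =
      (w.2⁻¹ * y) ^ k * (momentWeight e c β i w * y ^ β) := fun k w => by
    rw [momentWeight_add]
    ring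
  have hrk : ∀ k, r (β + k) i * y ^ (β + k) =
      ∫ w, (w.2⁻¹ * y) ^ k * (momentWeight e c β i w * y ^ β) ∂ν := fun k => by
    rw [← (hr (β + k) i (by omega)).2, ← integral_mul_const]
    simp only [h3]
  simp only [hrk]
  rw [← integral_zero (ℕ × ℝ) ℝ (μ := ν)]
  refine tendsto_integral_filter_of_dominated_convergence
    (fun w => momentWeight e c β i w * y ^ β) (Eventually.of_forall fun k => ?_)
    (Eventually.of_forall fun k => ?_) (i0.mul_const _) ?_
  · simp only [← h3]
    exact ((hr (β + k) i (by omega)).1.mul_const _).aestronglyMeasurable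
  · filter_upwards [hν, hs] with w hw hws
    have h4 := momentWeight_nonneg (e := e) hc β i hw
    rw [Real.norm_of_nonneg (by positivity)]
    rcases lt_or_ge w.1 i with h | h
    · simp [momentWeight_eq_zero _ h]
    · have h2 : w.2⁻¹ * y ≤ 1 := by
        rw [inv_mul_le_iff₀ hw, mul_one]
        exact (hws h).le
      exact mul_le_of_le_one_left (by positivity) (pow_le_one₀ (by positivity) h2)
  · filter_upwards [hν, hs] with w hw hws
    rcases lt_or_ge w.1 i with h | h
    · simp [momentWeight_eq_zero _ h]
    · have h2 : w.2⁻¹ * y < 1 := by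
        rw [inv_mul_lt_iff₀ hw, mul_one]
        exact hws h
      simpa using (tendsto_pow_atTop_nhds_zero_of_lt_one (by positivity) h2).mul_const
        (momentWeight e c β i w * y ^ β)

/-- Symmetric moments exclude a gap in the sequential appearance of the spins: if all the spins
`≥ j` sit at `x ≥ y`, then the spins at `x = y` cannot have a maximum `L > j`. Indeed log-convexity
propagates the growth rate `y ^ (-n)` of `r n (j + 1)` to all `r n i` with `i > j`, whereas
`r n (L + 1)` is smaller. -/
theorem false_of_symmetric_moments (hc : 1 / 2 ≤ c) (hν : ∀ᵐ w ∂ν, 0 < w.2)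
    (hsymm : ∀ p q, r p q = r q p)
    (hr : ∀ p q, β ≤ p → Integrable (momentWeight e c p q) ν ∧
      ∫ w, momentWeight e c p q w ∂ν = r p q)
    {y : ℝ} (hy : 0 < y) {j L : ℕ} (hj : β ≤ j) (hL : j + 1 ≤ L)
    (hs : ∀ᵐ w ∂ν, j ≤ w.1 → y ≤ w.2) (htop : ∀ᵐ w ∂ν, w.2 = y → w.1 ≤ L)
    (hne : ν {(L, y)} ≠ 0) (hfin : ν {(L, y)} ≠ ⊤) : False := by
  have lower : ∀ i, j + 1 ≤ i → ∃ a, 0 < a ∧ ∀ n, β ≤ n → a ≤ r n i * y ^ n := by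
    intro i hi
    induction i, hi using Nat.le_induction with
    | base =>
      refine ⟨ν.real {(L, y)} * (y ^ e * (y⁻¹) ^ (1 + (j + 1)) * gegCoeff c L (j + 1)), ?_,
        fun n hn => ?_⟩
      · have h1 : 0 < ν.real {(L, y)} := ENNReal.toReal_pos hne hfin
        have h2 := gegCoeff_pos hc hL
        have h3 := Real.rpow_pos_of_pos hy e
        positivity
      · obtain ⟨i0, h0⟩ := hr n (j + 1) hn
        have h1 := setIntegral_le_integral (s := {(L, y)}) i0
          (hν.mono fun w hw => momentWeight_nonneg hc _ _ hw)
        rw [integral_singleton, h0, smul_eq_mul] at h1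
        refine le_trans (le_of_eq ?_) (mul_le_mul_of_nonneg_right h1 (pow_nonneg hy.le n))
        have h2 : (y⁻¹) ^ n * y ^ n = 1 := by rw [← mul_pow, inv_mul_cancel₀ hy.ne', one_pow]
        have h3 : n + 1 + (j + 1) = (1 + (j + 1)) + n := by omega
        simp only [momentWeight]
        rw [h3, pow_add y⁻¹ (1 + (j + 1)) n]
        linear_combination -(ν.real {(L, y)} * y ^ e * (y⁻¹) ^ (1 + (j + 1)) *
          gegCoeff c L (j + 1)) * h2
    | succ i hi ih =>
      obtain ⟨a, ha, hle⟩ := ih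
      obtain ⟨q, rfl⟩ : ∃ q, i = q + 1 := ⟨i - 1, by omega⟩
      have hq : β ≤ q := by omega
      have hup := fun n hn => moment_mul_pow_le (i := q) (n := n) hc hν hr hy
        (hs.mono fun w hw h => hw (by omega)) hn
      set U := r β q * y ^ β
      have hnn : ∀ n, β ≤ n → ∀ q, 0 ≤ r n q * y ^ n := fun n hn q => by
        rw [← (hr n q hn).2]
        exact mul_nonneg (integral_nonneg_of_ae
          (hν.mono fun w hw => momentWeight_nonneg hc _ _ hw)) (pow_nonneg hy.le n)
      have hU : 0 ≤ U := hnn β le_rfl q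
      refine ⟨a ^ 2 / (U + 1), by positivity, fun n hn => ?_⟩
      rw [div_le_iff₀ (by positivity)]
      have h1 := sq_moment_le hc hν hsymm hr n hq
      have h2 := hnn n hn (q + 2)
      calc a ^ 2 ≤ (r n (q + 1) * y ^ n) ^ 2 := by
            have := hle n hn
            gcongr
        _ = r n (q + 1) ^ 2 * (y ^ n * y ^ n) := by ring
        _ ≤ r n q * r n (q + 2) * (y ^ n * y ^ n) := by gcongr
        _ = (r n q * y ^ n) * (r n (q + 2) * y ^ n) := by ring
        _ ≤ (U + 1) * (r n (q + 2) * y ^ n) := by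
            gcongr
            linarith [hup n hn]
        _ = r n (q + 1 + 1) * y ^ n * (U + 1) := by ring
  obtain ⟨a, ha, hle⟩ := lower (L + 1) (by omega)
  have hlim := tendsto_moment_mul_pow (i := L + 1) hc hν hr hy (by
    filter_upwards [hs, htop] with w h1 h2 h3
    refine lt_of_le_of_ne (h1 (by omega)) fun h => ?_
    have := h2 h.symm
    omega)
  exact absurd (ge_of_tendsto' hlim fun k => hle (β + k) (by omega)) (not_le.2 ha)

end Moments

/-! ### Sequential spin -/

namespace SUAmplitude

variable {X : SUAmplitude} {d : ℕ}

/-- A massive level that exchanges a spin above `j ≥ max(α, J_0 + 1)` lies above a level whose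
maximum spin is at least `j`. -/
theorem Bootstrap.exists_lower_level (hX : X.Bootstrap d) (hd : 3 ≤ d) {P j : ℕ} (hP1 : 1 ≤ P)
    (hP : X.IsLevel P) (hj : max X.α (X.J 0 + 1) ≤ (j : ℤ)) (hJ : (j : ℤ) + 1 ≤ X.J P) :
    ∃ p < P, (j : ℤ) ≤ X.J p := by
  by_contra! hcon
  obtain ⟨r, hsymm, hr⟩ := hX.exists_moments hd (isLevel_mono hP1 hP)
  have hy : 0 < X.m P ^ 2 := pow_pos (hX.mass_pos hP1 hP) 2
  refine false_of_symmetric_moments (ν := X.spectralMeasure) (e := (4 - (d : ℝ)) / 2)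
    (y := X.m P ^ 2) (j := j) (L := (X.J P).toNat) (Bootstrap.half_le hd) ae_snd_pos hsymm hr hy
    ?_ (by omega) ?_ ?_ (hX.spectralMeasure_top_ne_zero hd hP1 hP) ?_
  · have := hX.subtractions_cast
    omega
  · have hlow : ∀ᵐ w ∂X.spectralMeasure, ∀ p, 1 ≤ p → X.IsLevel p → w.2 = X.m p ^ 2 →
        (w.1 : ℤ) ≤ X.J p :=
      ae_all_iff.2 fun p => eventually_imp_distrib_left.2 fun h1 =>
        eventually_imp_distrib_left.2 fun h2 => hX.ae_spin_le hd h1 h2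
    filter_upwards [measure_eq_zero_iff_ae_notMem.1 (hX.null_below_cutoff hd), ae_snd_pos, hlow]
      with w hw hw0 hwl hwj
    by_contra! hlt
    refine hw ⟨(ENNReal.ofReal_le_ofReal hlt.le).trans_lt (hX.sq_mass_lt hP), ?_⟩
    rintro ⟨p, hp, hwp⟩
    have hwp' : w.2 = X.m p ^ 2 := by exact_mod_cast hwp
    have hp1 : 1 ≤ p := by
      refine Nat.one_le_iff_ne_zero.2 fun h => hw0.ne' ?_
      rw [hwp', h, hX.mass_zero, zero_pow two_ne_zero]
    have hpP : p < P := by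
      by_contra! h
      have h2 : X.m P ≤ X.m p := by
        rcases h.eq_or_lt with h | h
        · rw [h]
        · exact (hX.mass_lt P p h hp).le
      have h3 : X.m P ^ 2 ≤ X.m p ^ 2 := pow_le_pow_left₀ (hX.mass_nonneg hP) h2 2
      linarith
    have h4 := hwl p hp1 hp hwp'
    have h5 := hcon p hpP
    omega
  · filter_upwards [hX.ae_spin_le hd hP1 hP] with w hw hwy
    have := hw hwy
    omega
  · refine ((measure_mono ?_).trans_lt
      (hX.spectralMeasure_lt_top isCompact_singleton (Set.singleton_subset_iff.2 hy))).ne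
    rintro w rfl
    rfl

theorem maxBelow_mono (X : SUAmplitude) : Monotone X.maxBelow :=
  monotone_nat_of_le_succ fun _ => le_max_left _ _

theorem J_le_maxBelow (X : SUAmplitude) {p n : ℕ} (h : p < n) : X.J p ≤ X.maxBelow n :=
  (le_max_right _ _).trans (X.maxBelow_mono (Nat.succ_le_of_lt h))

end SUAmplitude

theorem theorem1 (d : ℕ) (hd : 3 ≤ d) (X : SUAmplitude) (hX : X.Bootstrap d) :
    (∀ n : ℕ, 1 ≤ n → X.IsLevel n → X.J n ≤ X.maxBelow n + 1) ∧
    (∀ j : ℕ, max X.α (X.J 0 + 1) ≤ (j : ℤ) → ∀ n' : ℕ, X.IsLightest n' (j + 1) →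
      ∃ n : ℕ, X.IsLightest n j ∧ X.m n < X.m n') := by
  classical
  constructor
  · intro n hn1 hn
    by_contra! hlt
    have h0 : X.J 0 ≤ X.maxBelow n := X.J_le_maxBelow hn1
    have hα : X.α - 1 ≤ X.maxBelow n := X.maxBelow_mono (Nat.zero_le n)
    have hm := hX.spin_massless
    obtain ⟨j, hj⟩ := Int.eq_ofNat_of_zero_le (show 0 ≤ X.maxBelow n + 1 by omega)
    obtain ⟨p, hp, hjp⟩ := hX.exists_lower_level hd hn1 hn (j := j) (by omega) (by omega)
    have := X.J_le_maxBelow hp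
    omega
  · rintro j hj n' ⟨hn', ⟨hJn', -⟩, -⟩
    have hex : ∃ P, (j : ℤ) + 1 ≤ X.J P := ⟨n', by exact_mod_cast hJn'⟩
    -- the lowest level whose maximum spin exceeds `j`
    have hPJ := Nat.find_spec hex
    have hPmin := fun p (hp : p < Nat.find hex) => Nat.find_min hex hp
    have hPn' : Nat.find hex ≤ n' := Nat.find_min' hex (by exact_mod_cast hJn')
    set P := Nat.find hex
    have hJ0 : X.J 0 + 1 ≤ j := (le_max_right _ _).trans hj
    have hP1 : 1 ≤ P := by
      refine Nat.one_le_iff_ne_zero.2 fun h => ?_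
      rw [h] at hPJ
      omega
    obtain ⟨p, hp, hjp⟩ := hX.exists_lower_level hd hP1 (SUAmplitude.isLevel_mono hPn' hn') hj hPJ
    have hJp : X.J p = j := by
      have := hPmin p hp
      omega
    have hp0 : p ≠ 0 := by
      rintro rfl
      omega
    have hpl : X.IsLevel p := SUAmplitude.isLevel_mono (hp.le.trans hPn') hn'
    have hpe : X.Exchanges p j := by
      refine ⟨hjp, ?_⟩
      rw [if_neg hp0]
      have := hX.top_massive p (Nat.one_le_iff_ne_zero.2 hp0) hpl
      rwa [hJp, Int.toNat_natCast] at this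
    have hexch : ∃ n, X.Exchanges n j := ⟨p, hpe⟩
    have hle : Nat.find hexch ≤ p := Nat.find_min' hexch hpe
    exact ⟨Nat.find hexch, ⟨SUAmplitude.isLevel_mono hle hpl, Nat.find_spec hexch,
      fun q hq => Nat.find_min hexch hq⟩, hX.mass_lt _ _ (by omega) hn'⟩
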